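/- Let $L\subseteq[0,\infty)$ be a set of real numbers that is dense in some non-empty open set $U\subseteq\mathbb R$ (that is, $U\subseteq\overline L$). A finite simple graph is an $L$-interval graph if each vertex $v$ can be assigned a half-open interval $[\ell(v),r(v))$ with $r(v)-\ell(v)\in L$ so that two distinct vertices are adjacent if and only if their intervals intersect. Consider the following parameterized problem, FO model checking on $L$-interval graphs: given an $L$-interval graph $G$ (by its adjacency matrix) and a first-order sentence $\varphi$ in the language of graphs, decide whether $G\models\varphi$; the parameter is the length of $\varphi$. Then this problem is W[2]-hard, that is, every parameterized problem $A$ in W[2] is fpt-reducible to it: there are computable functions $f,g$, a constant $c$ and a Turing machine that transforms each instance $x$ of $A$ with parameter $k$, in at most $f(k)(|x|+1)^c$ steps, into an $L$-interval graph $G$ and a sentence $\varphi$ of length at most $g(k)$ such that $x$ is a yes-instance of $A$ if and only if $G\models\varphi$. Here W[2] is the class of parameterized problems that are, for some constant $h$, fpt-reducible to the following problem: given a Boolean circuit of weft at most $2$ (each directed path to the output has at most $2$ gates of fan-in greater than $2$) and depth at most $h$, and an integer $k\ge 0$, which is the parameter, decide whether the circuit accepts an assignment in which exactly $k$ input nodes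 are true. -/

import Mathlib

/-! ## Parameterized problems, fpt-reductions -/

/-- A parameterized (promise) decision problem: a type of instances, each of which is written as a
string over a finite alphabet, a parameter, and the set of yes-instances.  A classical parameterized
language is the case in which the instances are all strings. -/
structure ParamProblem where
  /-- the instances -/
  Inst : Type
  /-- the alphabet in which instances are written -/
  Alphabet : Type
  /-- the alphabet is finite -/
  alphabetFintype : Fintype Alphabet
  /-- the string that represents an instance -/
  encode : Inst → List Alphabet
  /-- different instances have different strings -/
  encode_injective : Function.Injective encode
  /-- the parameter -/
  param : Inst → ℕ
  /-- the yes-instances -/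
  Yes : Inst → Prop

/-- `A` is fpt-reducible to `B` (many-one): a (deterministic, multi-stack) Turing machine maps every
instance `x` of `A` with parameter `k` to an equivalent instance of `B`, in at most
`f k * (|x| + 1) ^ c` steps, and the parameter of the new instance is at most `g k`, where `f` and
`g` are computable functions and `c` is a constant. -/
def FPTReducible (A B : ParamProblem) : Prop :=
  ∃ (R : A.Inst → B.Inst) (M : Turing.TM2ComputableAux A.Alphabet B.Alphabet)
    (f g : ℕ → ℕ) (c : ℕ),
    Computable f ∧ Computable g ∧
    (∀ x, A.Yes x ↔ B.Yes (R x)) ∧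
    (∀ x, B.param (R x) ≤ g (A.param x)) ∧
    ∀ x, Nonempty (Turing.TM2OutputsInTime M.tm
      ((A.encode x).map M.inputAlphabet.symm)
      (some ((B.encode (R x)).map M.outputAlphabet.symm))
      (f (A.param x) * ((A.encode x).length + 1) ^ c))

/-! ## Blocks of equal length -/

/-- The concatenation of `n` words. -/
def concatRows {α : Type} {n : ℕ} (row : Fin n → List α) : List α :=
  (List.ofFn row).flatten

theorem concatRows_injective {α : Type} {n l : ℕ} {row row' : Fin n → List α}
    (h : ∀ i, (row i).length = l) (h' : ∀ i, (row' i).length = l)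
    (e : concatRows row = concatRows row') : row = row' := by
  apply List.ofFn_injective
  rw [List.eq_iff_flatten_eq]
  refine ⟨e, ?_⟩
  rw [List.map_ofFn, List.map_ofFn]
  congr 1
  funext i
  simp [h, h']

theorem countP_concatRows {α : Type} {n : ℕ} {row : Fin n → List α} (p : α → Bool)
    (h : ∀ i, (row i).countP p = 1) : (concatRows row).countP p = n := by
  rw [concatRows, List.countP_flatten, List.map_ofFn]
  have : (List.countP p ∘ row) = fun _ => 1 := funext h
  rw [this]
  simp [List.ofFn_const]

theorem append_map_inj {α β : Type} {a a' : List α} {b b' : List β}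
    (h : a.map (Sum.inl : α → α ⊕ β) ++ b.map Sum.inr = a'.map Sum.inl ++ b'.map Sum.inr) :
    a = a' ∧ b = b' := by
  have h1 := congrArg (List.filterMap Sum.getLeft?) h
  have h2 := congrArg (List.filterMap Sum.getRight?) h
  simp [List.filterMap_append, List.filterMap_map, Function.comp_def] at h1 h2
  exact ⟨h1, h2⟩

/-! ## Boolean circuits and the class W[t] -/

/-- The kinds of nodes of a Boolean circuit. -/
inductive NodeKind
  | input
  | conj
  | disj
  | neg
  deriving DecidableEq

instance : Fintype NodeKind :=
  ⟨{.input, .conj, .disj, .neg}, by rintro ⟨⟩ <;> decide⟩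

/-- A Boolean circuit with one output: a finite directed acyclic graph whose nodes are numbered along
a topological order; input nodes have fan-in zero, negation gates have fan-in one, and conjunction
and disjunction gates have arbitrary fan-in. -/
@[ext] structure BoolCircuit where
  /-- the number of nodes -/
  size : ℕ
  /-- the kind of each node -/
  kind : Fin size → NodeKind
  /-- `wire i j = true` if there is a wire from node `i` to node `j` -/
  wire : Fin size → Fin size → Bool
  /-- the output node -/
  output : Fin size
  /-- wires go from smaller to larger numbers -/
  lt_of_wire : ∀ i j, wire i j = true → i < j
  /-- input nodes have fan-in zero -/
  wire_input : ∀ i j, kind j = NodeKind.input → wire i j = false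
  /-- negation gates have fan-in one -/
  wire_neg : ∀ j, kind j = NodeKind.neg → ∃! i, wire i j = true

namespace BoolCircuit

/-- The value of node `j` when exactly the input nodes in `S` are set to true. -/
def value (C : BoolCircuit) (S : Finset (Fin C.size)) (j : Fin C.size) : Prop :=
  match C.kind j with
  | .input => j ∈ S
  | .conj => ∀ i, ∀ _ : C.wire i j = true, C.value S i
  | .disj => ∃ i, ∃ _ : C.wire i j = true, C.value S i
  | .neg => ∀ i, ∀ _ : C.wire i j = true, ¬ C.value S i
termination_by j
decreasing_by all_goals exact C.lt_of_wire _ _ (by assumption)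

/-- The circuit accepts some assignment of weight exactly `k`: some assignment that sets exactly `k`
input nodes to true makes the output node true. -/
def HasWeightedSolution (C : BoolCircuit) (k : ℕ) : Prop :=
  ∃ S : Finset (Fin C.size),
    (∀ i ∈ S, C.kind i = NodeKind.input) ∧ S.card = k ∧ C.value S C.output

/-- The fan-in of a node. -/
def fanIn (C : BoolCircuit) (j : Fin C.size) : ℕ :=
  (Finset.univ.filter fun i => C.wire i j = true).card

/-- `p` is the list of nodes of a directed path that ends in the output node. -/
def IsOutputPath (C : BoolCircuit) (p : List (Fin C.size)) : Prop :=
  p.IsChain (fun i j => C.wire i j = true) ∧ p.getLast? = some C.output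

/-- Every directed path to the output node has at most `h` wires. -/
def DepthLE (C : BoolCircuit) (h : ℕ) : Prop :=
  ∀ p, C.IsOutputPath p → p.length ≤ h + 1

/-- Every directed path to the output node has at most `t` large gates, that is, gates with fan-in
larger than two. -/
def WeftLE (C : BoolCircuit) (t : ℕ) : Prop :=
  ∀ p, C.IsOutputPath p → p.countP (fun j => decide (2 < C.fanIn j)) ≤ t

/-- The letters used to write down a circuit: kinds of nodes, and bits. -/
abbrev Letter : Type := NodeKind ⊕ Bool

/-- The description of node `j`: its kind, the bits that tell from which nodes there is a wire to
`j`, and a bit that tells whether `j` is the output node. -/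
def row (C : BoolCircuit) (j : Fin C.size) : List Letter :=
  Sum.inl (C.kind j) :: (List.ofFn (fun i => Sum.inr (C.wire i j)) ++
    [Sum.inr (decide (j = C.output))])

/-- The string that describes a circuit. -/
def code (C : BoolCircuit) : List Letter := concatRows C.row

theorem code_injective : Function.Injective code := by
  intro C D h
  have count : ∀ C : BoolCircuit, C.code.countP Sum.isLeft = C.size := by
    intro C
    refine countP_concatRows _ fun j => ?_
    have hz : (List.ofFn (fun i => (Sum.inr (C.wire i j) : Letter))).countP Sum.isLeft = 0 := by
      simp [List.countP_eq_zero, List.mem_ofFn]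
    simp only [row, List.countP_cons, List.countP_append, hz]
    simp
  have hs : C.size = D.size := by rw [← count C, h, count D]
  obtain ⟨n, kC, wC, oC, _, _, _⟩ := C
  obtain ⟨m, kD, wD, oD, _, _, _⟩ := D
  obtain rfl : n = m := hs
  have hr := concatRows_injective (l := n + 2) (fun i => by simp [row]) (fun i => by simp [row]) h
  have key : ∀ j, kC j = kD j ∧ (fun i => wC i j) = (fun i => wD i j) ∧
      (j = oC ↔ j = oD) := by
    intro j
    have hj := congrFun hr j
    simp only [row, List.cons.injEq, Sum.inl.injEq] at hj
    obtain ⟨h1, h2⟩ := hj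
    obtain ⟨h3, h4⟩ := List.append_inj h2 (by simp)
    refine ⟨h1, ?_, by simpa using h4⟩
    have := List.ofFn_injective h3
    funext i
    simpa using congrFun this i
  obtain rfl : kC = kD := funext fun j => (key j).1
  obtain rfl : wC = wD := by
    funext i j
    exact congrFun (key j).2.1 i
  obtain rfl : oC = oD := ((key oC).2.2).1 rfl
  rfl

end BoolCircuit

/-- Weighted satisfiability of circuits of weft at most `t` and depth at most `h`, parameterized by
the weight `k`: does the given circuit have a satisfying assignment of weight exactly `k`?
The weight is written in unary. -/
def weightedCircuitSat (t h : ℕ) : ParamProblem where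
  Inst := {C : BoolCircuit // C.WeftLE t ∧ C.DepthLE h} × ℕ
  Alphabet := BoolCircuit.Letter ⊕ Unit
  alphabetFintype := inferInstance
  encode x := x.1.1.code.map Sum.inl ++ (List.replicate x.2 ()).map Sum.inr
  encode_injective := by
    rintro ⟨⟨C, hC⟩, k⟩ ⟨⟨D, hD⟩, l⟩ e
    obtain ⟨h1, h2⟩ := append_map_inj e
    obtain rfl : C = D := BoolCircuit.code_injective h1
    obtain rfl : k = l := by simpa using congrArg List.length h2
    rfl
  param x := x.2
  Yes x := x.1.1.HasWeightedSolution x.2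

/-- The class W[t]: the parameterized problems that are fpt-reducible, for some constant `h`, to
weighted satisfiability of circuits of weft at most `t` and depth at most `h`. -/
def InW (t : ℕ) (A : ParamProblem) : Prop := ∃ h, FPTReducible A (weightedCircuitSat t h)

/-- A problem is W[t]-hard if every problem in W[t] is fpt-reducible to it. -/
def WHard (t : ℕ) (B : ParamProblem) : Prop := ∀ A, InW t A → FPTReducible A B

/-! ## First-order model checking on graphs -/

/-- The letters used to write down a first-order formula in the language of graphs. -/
inductive FOLetter
  | falsum
  | eq
  | adj
  | imp
  | all
  | tick
  | comma
  deriving DecidableEq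

instance : Fintype FOLetter :=
  ⟨{.falsum, .eq, .adj, .imp, .all, .tick, .comma}, by rintro ⟨⟩ <;> decide⟩

/-- The variable with index `i` is written in unary. -/
def varCode (i : ℕ) : List FOLetter := List.replicate i FOLetter.tick ++ [FOLetter.comma]

/-- The only terms of the language of graphs are variables; in a formula that comes from a sentence
they are the bound variables, numbered from the outermost quantifier to the innermost one. -/
def termCode {n : ℕ} : FirstOrder.Language.graph.Term (Empty ⊕ Fin n) → List FOLetter
  | .var (Sum.inl e) => e.elim
  | .var (Sum.inr i) => varCode i
  | .func f _ => isEmptyElim f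

/-- A formula in prefix notation. -/
def formulaCode : {n : ℕ} → FirstOrder.Language.graph.BoundedFormula Empty n → List FOLetter
  | _, .falsum => [FOLetter.falsum]
  | _, .equal s t => FOLetter.eq :: (termCode s ++ termCode t)
  | _, .rel _ ts => FOLetter.adj :: concatRows fun i => termCode (ts i)
  | _, .imp φ ψ => FOLetter.imp :: (formulaCode φ ++ formulaCode ψ)
  | _, .all φ => FOLetter.all :: formulaCode φ

theorem varCode_append_inj {i j : ℕ} {s s' : List FOLetter}
    (h : varCode i ++ s = varCode j ++ s') : i = j ∧ s = s' := by
  induction i generalizing j with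
  | zero => cases j <;> simp_all [varCode, List.replicate_succ]
  | succ i ih =>
    cases j with
    | zero => simp_all [varCode, List.replicate_succ]
    | succ j =>
      have := @ih j (by simpa [varCode, List.replicate_succ] using h)
      simpa using this

theorem termCode_append_inj {n : ℕ} {t t' : FirstOrder.Language.graph.Term (Empty ⊕ Fin n)}
    {s s' : List FOLetter} (h : termCode t ++ s = termCode t' ++ s') : t = t' ∧ s = s' := by
  match t, t', h with
  | .var (Sum.inl e), _, _ => exact e.elim
  | .func f _, _, _ => exact isEmptyElim f
  | _, .var (Sum.inl e), _ => exact e.elim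
  | _, .func f _, _ => exact isEmptyElim f
  | .var (Sum.inr i), .var (Sum.inr j), h =>
    obtain ⟨h1, h2⟩ := varCode_append_inj (by simpa only [termCode] using h)
    exact ⟨by rw [Fin.ext h1], h2⟩

theorem formulaCode_append_inj {n : ℕ}
    {φ ψ : FirstOrder.Language.graph.BoundedFormula Empty n} {s s' : List FOLetter}
    (h : formulaCode φ ++ s = formulaCode ψ ++ s') : φ = ψ ∧ s = s' := by
  induction φ generalizing s s' with
  | falsum => cases ψ <;> simp_all [formulaCode]
  | equal t u =>
    cases ψ with
    | equal t' u' =>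
      simp only [formulaCode, List.cons_append, List.append_assoc, List.cons.injEq, true_and] at h
      obtain ⟨h1, h2⟩ := termCode_append_inj h
      obtain ⟨h3, h4⟩ := termCode_append_inj h2
      exact ⟨by rw [h1, h3], h4⟩
    | _ => simp [formulaCode] at h
  | rel R ts =>
    cases ψ with
    | rel R' ts' =>
      cases R
      cases R'
      simp only [formulaCode, concatRows, List.ofFn_succ, List.ofFn_zero, List.flatten_cons,
        List.flatten_nil, List.append_nil, List.cons_append, List.append_assoc, List.cons.injEq,
        true_and] at h
      obtain ⟨h0, h⟩ := termCode_append_inj h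
      obtain ⟨h1, h⟩ := termCode_append_inj h
      refine ⟨?_, h⟩
      congr 1
      funext i
      fin_cases i
      · exact h0
      · exact h1
    | _ => simp [formulaCode] at h
  | imp φ₁ φ₂ ih₁ ih₂ =>
    cases ψ with
    | imp ψ₁ ψ₂ =>
      simp only [formulaCode, List.cons_append, List.append_assoc, List.cons.injEq, true_and] at h
      obtain ⟨h1, h2⟩ := ih₁ h
      obtain ⟨h3, h4⟩ := ih₂ h2
      exact ⟨by rw [h1, h3], h4⟩
    | _ => simp [formulaCode] at h
  | all φ ih =>
    cases ψ with
    | all ψ =>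
      simp only [formulaCode, List.cons_append, List.cons.injEq, true_and] at h
      obtain ⟨h1, h2⟩ := ih h
      exact ⟨by rw [h1], h2⟩
    | _ => simp [formulaCode] at h

open Classical in
/-- A row of the adjacency matrix of a graph, followed by an end mark. -/
noncomputable def adjRow {n : ℕ} (G : SimpleGraph (Fin n)) (i : Fin n) : List (Option Bool) :=
  List.ofFn (fun j => some (decide (G.Adj i j))) ++ [none]

/-- The adjacency matrix of a graph, row by row. -/
noncomputable def graphCode {n : ℕ} (G : SimpleGraph (Fin n)) : List (Option Bool) :=
  concatRows (adjRow G)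

theorem graphCode_size {n : ℕ} (G : SimpleGraph (Fin n)) :
    (graphCode G).countP Option.isNone = n := by
  refine countP_concatRows _ fun j => ?_
  simp [adjRow, List.countP_eq_zero, List.mem_ofFn]

theorem graphCode_injective {n : ℕ} :
    Function.Injective (graphCode : SimpleGraph (Fin n) → List (Option Bool)) := by
  intro G H h
  have hr := concatRows_injective (l := n + 1) (fun i => by simp [adjRow])
    (fun i => by simp [adjRow]) h
  ext i j
  have h2 := List.ofFn_injective (List.append_cancel_right (congrFun hr i))
  simpa using congrFun h2 j

/-- An instance of first-order model checking on the class `𝒞`: a finite graph from `𝒞` and a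
first-order sentence in the language of graphs. -/
structure ModelCheckingInst (𝒞 : ∀ n : ℕ, SimpleGraph (Fin n) → Prop) where
  /-- the number of vertices -/
  order : ℕ
  /-- the graph -/
  graph : SimpleGraph (Fin order)
  /-- the graph belongs to the class -/
  mem : 𝒞 order graph
  /-- the sentence -/
  sentence : FirstOrder.Language.graph.Sentence

/-- First-order model checking on the class `𝒞`, parameterized by the length of the sentence: does
the given graph satisfy the given sentence? -/
noncomputable def foModelChecking (𝒞 : ∀ n : ℕ, SimpleGraph (Fin n) → Prop) : ParamProblem where
  Inst := ModelCheckingInst 𝒞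
  Alphabet := Option Bool ⊕ FOLetter
  alphabetFintype := inferInstance
  encode x := (graphCode x.graph).map Sum.inl ++ (formulaCode x.sentence).map Sum.inr
  encode_injective := by
    rintro ⟨n, G, hG, φ⟩ ⟨m, H, hH, ψ⟩ e
    obtain ⟨h1, h2⟩ := append_map_inj e
    obtain rfl : n = m := by rw [← graphCode_size G, h1, graphCode_size H]
    obtain rfl : G = H := graphCode_injective h1
    obtain rfl : φ = ψ := (formulaCode_append_inj (congrArg (· ++ []) h2)).1
    rfl
  param x := (formulaCode x.sentence).length
  Yes x := @FirstOrder.Language.Sentence.Realize _ (Fin x.order) x.graph.structure x.sentence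

/-! ## `L`-interval graphs -/

/-- `G` is an `L`-interval graph: the vertices can be represented by half-open intervals `[ℓ v, r v)`
of lengths from `L` so that two different vertices are adjacent if and only if their intervals
intersect. -/
def IsIntervalGraphWithLengths {V : Type*} (L : Set ℝ) (G : SimpleGraph V) : Prop :=
  ∃ l r : V → ℝ, (∀ v, r v - l v ∈ L) ∧
    ∀ v w, v ≠ w → (G.Adj v w ↔ (Set.Ico (l v) (r v) ∩ Set.Ico (l w) (r w)).Nonempty)

/-!
Let `A` be reducible to weighted satisfiability of circuits of depth at most `h`.  It suffices to
turn a circuit `C` with `n` nodes and a weight `k`, in polynomial time, into an `L`-interval graph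
and a sentence that depends on `h` and `k` only.

*The graph.*  All vertices lie in four clusters, numbered from left to right.  Vertices of the same
cluster are adjacent, and vertices of neighbouring clusters are adjacent if the left end of the
right one comes before the right end of the left one, for a prescribed order of the ends
(`ClusterAdj`). Every finite graph of this kind is an `L`-interval graph: if `L` is dense near
some positive `a`, all lengths can be taken so close to `a` that intervals of cluster `c`
start near `c * a` and end near `(c + 1) * a`, where density leaves the order of the ends free
(`isIntervalGraphWithLengths_of_clusterAdj`).

The middle cluster holds pairs `(left end, right end)`: a node `i` of the circuit is the pair
`(i + 1, i + 1)`, and a wire from `i` to `j` is the pair `(i + 1, j + 1)`.  The neighbouring clusters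
consist of thresholds, so that two vertices have the same left ends if they have the same neighbours
among the left thresholds, and likewise on the right.  Nodes are recognized because they come in two
copies (`Vert.exists_same_iff`), and conjunctions and disjunctions are marked by pairs whose left
end is smaller, or larger, than all others.  The left side is recognized by a hub, which is the only
neighbour of the only leaf (`Vert.leaf_and_adj_iff`).  So first-order formulas can speak about
nodes, wires and kinds of nodes.  An additional node `n`, marked both as a conjunction and as a
disjunction, is fed by the output of the circuit, so that the output can be recognized too.

*The sentence* `GraphFormula.sentence` says that there are `k` different input nodes that make the
additional node true.  Since the depth is bounded, the value of a node is expressed by a formula of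
bounded nesting, which follows the wires backwards (`GraphFormula.val`,
`BoolCircuit.levelValue_iff`).

*The machine.*  The string of the graph and the sentence is printed by a program on stacks with
loops over counters (`StackProg`, `StackProg.Printable`); such programs are compiled to the
statements of a multi-stack Turing machine step by step (`StackProg.Exec.steps`), and composed with
the machine that reduces `A` to circuits (`StackProg.outputsInTime_chain`).  The output of that
machine is not longer than its input and its running time allow
(`StackProg.exists_length_output_le`), which bounds the time of the composition.
-/

open Function

/-! ### Stack programs and their compilation -/

/-- Structured programs on finitely many stacks, the stacks being indexed by `K` and holding letters
from `Γ`.  All control information is in the program text: `pop` and `loop` branch on the letter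
that they remove. -/
inductive StackProg (K Γ : Type) : Type
  /-- do nothing -/
  | skip : StackProg K Γ
  /-- push a letter -/
  | push (k : K) (a : Γ) : StackProg K Γ
  /-- one program after the other -/
  | seq (p q : StackProg K Γ) : StackProg K Γ
  /-- pop a letter, if there is one, and branch on it -/
  | pop (k : K) (body : Option Γ → StackProg K Γ) : StackProg K Γ
  /-- pop letters until the stack is empty, and run the body for each of them -/
  | loop (k : K) (body : Γ → StackProg K Γ) : StackProg K Γ

namespace StackProg

variable {K Γ : Type} [DecidableEq K]

/-- `p.Exec S S' t`: started with stack contents `S`, the program `p` stops after `t` steps with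
stack contents `S'`. -/
inductive Exec : StackProg K Γ → (K → List Γ) → (K → List Γ) → ℕ → Prop
  | skip (S : K → List Γ) : Exec .skip S S 1
  | push (k : K) (a : Γ) (S : K → List Γ) : Exec (.push k a) S (update S k (a :: S k)) 1
  | seq {p q : StackProg K Γ} {S S' S'' : K → List Γ} {t t' : ℕ} :
      Exec p S S' t → Exec q S' S'' t' → Exec (.seq p q) S S'' (t + t')
  | pop {k : K} {body : Option Γ → StackProg K Γ} {S S' : K → List Γ} {t : ℕ} :
      Exec (body (S k).head?) (update S k (S k).tail) S' t → Exec (.pop k body) S S' (1 + t)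
  | loop_nil {k : K} {body : Γ → StackProg K Γ} {S : K → List Γ} :
      S k = [] → Exec (.loop k body) S S 1
  | loop_cons {k : K} {body : Γ → StackProg K Γ} {S S' S'' : K → List Γ} {a : Γ} {l : List Γ}
      {t t' : ℕ} :
      S k = a :: l → Exec (body a) (update S k l) S' t → Exec (.loop k body) S' S'' t' →
      Exec (.loop k body) S S'' (1 + t + t')

/-- The program points of a stack program. -/
def Lbl : StackProg K Γ → Type
  | .skip => Unit
  | .push _ _ => Unit
  | .seq p q => p.Lbl ⊕ q.Lbl
  | .pop _ body => Option (Σ a, (body a).Lbl)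
  | .loop _ body => Option (Σ a, (body a).Lbl)

omit [DecidableEq K] in
theorem finite_lbl [Finite Γ] (p : StackProg K Γ) : Finite p.Lbl := by
  induction p with
  | skip => exact inferInstanceAs (Finite Unit)
  | push => exact inferInstanceAs (Finite Unit)
  | seq p q hp hq => exact @Finite.instSum _ _ hp hq
  | pop k body ih =>
    have := ih
    exact inferInstanceAs (Finite (Option (Σ a, (body a).Lbl)))
  | loop k body ih =>
    have := ih
    exact inferInstanceAs (Finite (Option (Σ a, (body a).Lbl)))

/-- The program point at which a program starts. -/
def entry : (p : StackProg K Γ) → p.Lbl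
  | .skip => ()
  | .push _ _ => ()
  | .seq p _ => Sum.inl p.entry
  | .pop _ _ => none
  | .loop _ _ => none

/-- The alphabets of two families of stacks, all stacks of the second family sharing one alphabet.
-/
abbrev JoinAlphabet {K₁ : Type} (Γ₁ : K₁ → Type) (K Γ : Type) : K₁ ⊕ K → Type
  | .inl k => Γ₁ k
  | .inr _ => Γ

/-- The statement that a Turing machine executes at a program point, where `emb` turns program
points into labels of the machine, and `exit` is the label at which the machine continues after the
program. The stacks of the program are those with index `Sum.inr k`; other stacks `Sum.inl k` are
not touched. The second component of the state of the machine holds the letter popped last. -/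
def stmt {K₁ : Type} {Γ₁ : K₁ → Type} {σ Λ : Type} :
    (p : StackProg K Γ) → (p.Lbl → Λ) → Λ → p.Lbl →
      Turing.TM2.Stmt (JoinAlphabet Γ₁ K Γ) Λ (σ × Option Γ)
  | .skip, _, exit, _ => .goto fun _ => exit
  | .push k a, _, exit, _ => .push (Sum.inr k) (fun _ => a) (.goto fun _ => exit)
  | .seq p q, emb, _, .inl l => p.stmt (fun l => emb (.inl l)) (emb (.inr q.entry)) l
  | .seq _ q, emb, exit, .inr l => q.stmt (fun l => emb (.inr l)) exit l
  | .pop k body, emb, _, none =>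
    .pop (Sum.inr k) (fun v o => (v.1, o)) (.goto fun v => emb (some ⟨v.2, (body v.2).entry⟩))
  | .pop _ body, emb, exit, some ⟨a, l⟩ => (body a).stmt (fun l => emb (some ⟨a, l⟩)) exit l
  | .loop k body, emb, exit, none =>
    .pop (Sum.inr k) (fun v o => (v.1, o)) (.goto fun v => v.2.elim exit
      fun a => emb (some ⟨a, (body a).entry⟩))
  | .loop _ body, emb, _, some ⟨a, l⟩ =>
    (body a).stmt (fun l => emb (some ⟨a, l⟩)) (emb none) l

/-- The contents of two families of stacks, as one family. -/
def joinStacks {K₁ : Type} {Γ₁ : K₁ → Type} (T : ∀ k, List (Γ₁ k)) (S : K → List Γ) :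
    ∀ k, List (JoinAlphabet Γ₁ K Γ k)
  | .inl k => T k
  | .inr k => S k

theorem update_joinStacks_inr {K₁ : Type} [DecidableEq K₁] {Γ₁ : K₁ → Type}
    (T : ∀ k, List (Γ₁ k)) (S : K → List Γ) (k : K) (l : List Γ) :
    update (joinStacks T S) (Sum.inr k) l = joinStacks T (update S k l) := by
  funext x
  rcases x with x | x
  · exact update_of_ne (by simp) _ _
  · by_cases h : x = k
    · subst h
      exact (update_self _ _ _).trans (update_self (β := fun _ => List Γ) x l S).symm
    · have e : S x = update S k l x := (update_of_ne h l S).symm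
      exact (update_of_ne (by simpa using h) _ _).trans e

theorem update_joinStacks_inl {K₁ : Type} [DecidableEq K₁] {Γ₁ : K₁ → Type}
    (T : ∀ k, List (Γ₁ k)) (S : K → List Γ) (k : K₁) (l : List (Γ₁ k)) :
    update (joinStacks T S) (Sum.inl k) l = joinStacks (update T k l) S := by
  funext x
  rcases x with x | x
  · by_cases h : x = k
    · subst h
      exact (update_self _ _ _).trans (update_self x l T).symm
    · have e : T x = update T k l x := (update_of_ne h l T).symm
      exact (update_of_ne (by simpa using h) _ _).trans e
  · exact update_of_ne (by simp) _ _

/-- `t` steps of a machine lead from one configuration to another one. -/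
def Steps {C : Type} (f : C → Option C) (t : ℕ) (c c' : C) : Prop :=
  (flip bind f)^[t] (some c) = some c'

theorem Steps.trans {C : Type} {f : C → Option C} {t t' : ℕ} {c c' c'' : C}
    (h : Steps f t c c') (h' : Steps f t' c' c'') : Steps f (t + t') c c'' := by
  unfold Steps at *
  rw [add_comm, Function.iterate_add_apply, h, h']

theorem Steps.one {C : Type} {f : C → Option C} {c c' : C} (h : f c = some c') :
    Steps f 1 c c' := h

/-- The compiled program does what the program does, with the same number of steps. -/
theorem Exec.steps {K₁ : Type} [DecidableEq K₁] {Γ₁ : K₁ → Type} {σ Λ : Type}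
    {m : Λ → Turing.TM2.Stmt (JoinAlphabet Γ₁ K Γ) Λ (σ × Option Γ)}
    (T : ∀ k, List (Γ₁ k)) (s : σ) {p : StackProg K Γ} {S S' : K → List Γ} {t : ℕ}
    (h : p.Exec S S' t) (emb : p.Lbl → Λ) (exit : Λ) (hm : ∀ l, m (emb l) = p.stmt emb exit l)
    (o : Option Γ) :
    ∃ o' : Option Γ, Steps (Turing.TM2.step m) t ⟨some (emb p.entry), (s, o), joinStacks T S⟩
      ⟨some exit, (s, o'), joinStacks T S'⟩ := by
  have step : ∀ (l : Λ) (v : σ × Option Γ) (S : K → List Γ) q, m l = q →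
      Turing.TM2.step m ⟨some l, v, joinStacks T S⟩ =
        some (Turing.TM2.stepAux q v (joinStacks T S)) := by
    rintro l v S q rfl
    rfl
  induction h generalizing exit o with
  | skip S => exact ⟨o, Steps.one (step _ _ _ _ (hm ()))⟩
  | push k a S =>
    refine ⟨o, Steps.one ((step _ _ _ _ (hm ())).trans ?_)⟩
    rw [← update_joinStacks_inr]
    rfl
  | @seq p q S S' S'' t t' h h' ih ih' =>
    obtain ⟨o₁, h₁⟩ := ih (fun l => emb (.inl l)) (emb (.inr q.entry)) (fun l => hm (.inl l)) o
    obtain ⟨o₂, h₂⟩ := ih' (fun l => emb (.inr l)) exit (fun l => hm (.inr l)) o₁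
    exact ⟨o₂, h₁.trans h₂⟩
  | @pop k body S S' t h ih =>
    obtain ⟨o₁, h₁⟩ := ih (fun l => emb (some ⟨_, l⟩)) exit (fun l => hm (some ⟨_, l⟩)) (S k).head?
    refine ⟨o₁, Steps.trans (Steps.one ((step _ _ _ _ (hm none)).trans ?_)) h₁⟩
    rw [← update_joinStacks_inr]
    rfl
  | @loop_nil k body S h =>
    refine ⟨none, Steps.one ((step _ _ _ _ (hm none)).trans ?_)⟩
    have e : joinStacks T (update S k (S k).tail) = joinStacks T S := by
      rw [h, List.tail_nil, ← h, update_eq_self]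
    rw [← e, ← update_joinStacks_inr]
    simp only [stmt, Turing.TM2.stepAux]
    simp [h]
  | @loop_cons k body S S' S'' a l t t' h h₁ h₂ ih ih' =>
    obtain ⟨o₁, s₁⟩ := ih (fun l => emb (some ⟨_, l⟩)) (emb none) (fun l => hm (some ⟨_, l⟩)) (some
        a)
    obtain ⟨o₂, s₂⟩ := ih' emb exit hm o₁
    refine ⟨o₂, Steps.trans (Steps.trans (Steps.one ((step _ _ _ _ (hm none)).trans ?_)) s₁) s₂⟩
    have e : (joinStacks T S) (Sum.inr k) = a :: l := h
    rw [← update_joinStacks_inr]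
    simp only [stmt, Turing.TM2.stepAux, e]
    rfl

/-! ### Running a stack program on the output of a Turing machine -/

/-- A statement of a machine `M`, as a statement of a machine with more stacks and more labels.
Where `M` halts, the new machine goes to the label `exit`. -/
def liftStmt {K₁ K Γ : Type} {Γ₁ : K₁ → Type} {σ Λ₁ Λ : Type} (emb : Λ₁ → Λ) (exit : Λ) :
    Turing.TM2.Stmt Γ₁ Λ₁ σ → Turing.TM2.Stmt (JoinAlphabet Γ₁ K Γ) Λ (σ × Option Γ)
  | .push k f q => .push (Sum.inl k) (fun v => f v.1) (liftStmt emb exit q)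
  | .peek k f q => .peek (Sum.inl k) (fun v o => (f v.1 o, v.2)) (liftStmt emb exit q)
  | .pop k f q => .pop (Sum.inl k) (fun v o => (f v.1 o, v.2)) (liftStmt emb exit q)
  | .load f q => .load (fun v => (f v.1, v.2)) (liftStmt emb exit q)
  | .branch f q q' => .branch (fun v => f v.1) (liftStmt emb exit q) (liftStmt emb exit q')
  | .goto l => .goto fun v => emb (l v.1)
  | .halt => .goto fun _ => exit

variable {K Γ : Type} [DecidableEq K]

theorem stepAux_liftStmt {K₁ : Type} [DecidableEq K₁] {Γ₁ : K₁ → Type} {σ Λ₁ Λ : Type}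
    (emb : Λ₁ → Λ) (exit : Λ) (q : Turing.TM2.Stmt Γ₁ Λ₁ σ) (v : σ) (o : Option Γ)
    (T : ∀ k, List (Γ₁ k)) (S : K → List Γ) :
    Turing.TM2.stepAux (liftStmt emb exit q) (v, o) (joinStacks T S) =
      ⟨some ((Turing.TM2.stepAux q v T).l.elim exit emb), ((Turing.TM2.stepAux q v T).var, o),
        joinStacks (Turing.TM2.stepAux q v T).stk S⟩ := by
  induction q generalizing v T with
  | push k f q ih =>
    simp only [liftStmt, Turing.TM2.stepAux]
    rw [← ih, ← update_joinStacks_inl]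
    rfl
  | peek k f q ih => exact ih _ _
  | pop k f q ih =>
    simp only [liftStmt, Turing.TM2.stepAux]
    rw [← ih, ← update_joinStacks_inl]
    rfl
  | load f q ih => exact ih _ _
  | branch f q q' ih ih' =>
    simp only [liftStmt, Turing.TM2.stepAux]
    cases f v
    · exact ih' _ _
    · exact ih _ _
  | goto l => rfl
  | halt => rfl

variable (M : Turing.FinTM2) (f : M.Γ M.k₁ → Γ) (p : StackProg K Γ) (i o : K)

/-- The statements of the machine that runs `M`, moves the output of `M` to stack `i` of the stack
program `p` (letter by letter, which reverses it), and runs `p`. -/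
def chainStmt [Inhabited Γ] : M.Λ ⊕ (Bool ⊕ p.Lbl) →
    Turing.TM2.Stmt (JoinAlphabet M.Γ K Γ) (M.Λ ⊕ (Bool ⊕ p.Lbl)) (M.σ × Option Γ)
  | .inl l => liftStmt Sum.inl (Sum.inr (Sum.inl true)) (M.m l)
  | .inr (.inl true) =>
    .pop (Sum.inl M.k₁) (fun v o => (v.1, o.map f)) (.branch (fun v => v.2.isSome)
      (.push (Sum.inr i) (fun v => v.2.getD default) (.goto fun _ => Sum.inr (Sum.inl true)))
      (.goto fun _ => Sum.inr (Sum.inr p.entry)))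
  | .inr (.inl false) => .load (fun v => (v.1, none)) .halt
  | .inr (.inr l) => p.stmt (fun l => Sum.inr (Sum.inr l)) (Sum.inr (Sum.inl false)) l

/-- The machine that runs `M`, moves the output of `M` to stack `i` of the stack program `p`, and
runs `p`, whose output is on stack `o`. -/
noncomputable def chain [Fintype K] [Fintype Γ] [Inhabited Γ] : Turing.FinTM2 :=
  letI := M.kFin
  letI := M.ΛFin
  letI := M.σFin
  letI := M.Γk₀Fin
  letI := p.finite_lbl
  letI := Fintype.ofFinite p.Lbl
  { K := M.K ⊕ K
    k₀ := Sum.inl M.k₀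
    k₁ := Sum.inr o
    Γ := JoinAlphabet M.Γ K Γ
    Λ := M.Λ ⊕ (Bool ⊕ p.Lbl)
    main := Sum.inl M.main
    σ := M.σ × Option Γ
    initialState := (M.initialState, none)
    Γk₀Fin := inferInstanceAs (Fintype (M.Γ M.k₀))
    m := chainStmt M f p i }

/-- The configuration of the combined machine while it simulates the first machine. -/
def liftCfg (c : M.Cfg) :
    Turing.TM2.Cfg (JoinAlphabet M.Γ K Γ) (M.Λ ⊕ (Bool ⊕ p.Lbl)) (M.σ × Option Γ) :=
  ⟨some (c.l.elim (Sum.inr (Sum.inl true)) Sum.inl), (c.var, none), joinStacks c.stk fun _ => []⟩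

section

variable [Inhabited Γ]

theorem step_liftCfg {c c' : M.Cfg} (h : M.step c = some c') :
    Turing.TM2.step (chainStmt M f p i) (liftCfg M p c) = some (liftCfg M p c') := by
  obtain ⟨l, v, T⟩ := c
  cases l with
  | none => simp at h
  | some l =>
    have h' : Turing.TM2.stepAux (M.m l) v T = c' := Option.some.inj h
    subst h'
    exact congrArg some (stepAux_liftStmt _ _ _ _ _ _ _)

theorem steps_liftCfg {c c' : M.Cfg} {t : ℕ} (h : Steps M.step t c c') :
    Steps (Turing.TM2.step (chainStmt M f p i)) t (liftCfg M p c) (liftCfg M p c') := by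
  induction t generalizing c with
  | zero =>
    obtain rfl : c = c' := Option.some.inj h
    rfl
  | succ t ih =>
    rw [Steps, Function.iterate_succ_apply] at h
    rcases e : M.step c with - | c₁
    · have e' : flip bind M.step (some c) = none := e
      have : (flip bind M.step)^[t] (none : Option M.Cfg) = none :=
        Function.iterate_fixed rfl t
      rw [e', this] at h
      cases h
    · have e' : flip bind M.step (some c) = some c₁ := e
      rw [e'] at h
      rw [add_comm]
      exact (Steps.one (step_liftCfg M f p i e)).trans (ih h)

theorem steps_transfer (s : M.σ) (y : List (M.Γ M.k₁)) (T : ∀ k, List (M.Γ k))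
    (hT : T M.k₁ = y) (S : K → List Γ) (b : Option Γ) :
    Steps (Turing.TM2.step (chainStmt M f p i)) (y.length + 1)
      ⟨some (Sum.inr (Sum.inl true)), (s, b), joinStacks T S⟩
      ⟨some (Sum.inr (Sum.inr p.entry)), (s, none), joinStacks (update T M.k₁ [])
        (update S i ((y.map f).reverse ++ S i))⟩ := by
  induction y generalizing T S b with
  | nil =>
    have e : joinStacks T S (Sum.inl M.k₁) = [] := hT
    refine Steps.one ?_
    have e₁ : update T M.k₁ [] = T := by rw [← hT, update_eq_self]
    simp only [Turing.TM2.step, chainStmt, Turing.TM2.stepAux, update_joinStacks_inl, e]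
    simp [e₁]
  | cons a y ih =>
    rw [List.length_cons, add_comm]
    have e : joinStacks T S (Sum.inl M.k₁) = a :: y := hT
    refine Steps.trans (Steps.one (c' := ⟨some (Sum.inr (Sum.inl true)), (s, some (f a)),
      joinStacks (update T M.k₁ y) (update S i (f a :: S i))⟩) ?_) ?_
    · simp only [Turing.TM2.step, chainStmt, Turing.TM2.stepAux, update_joinStacks_inl, e]
      simp only [List.head?_cons, Option.map_some, Option.isSome_some, cond_true, List.tail_cons,
        Option.getD_some]
      rw [← update_joinStacks_inr]
      rfl
    · have := ih (update T M.k₁ y) (by simp) (update S i (f a :: S i)) (some (f a))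
      simpa using this

/-- If `M` turns `x` into `y`, and `p` turns the image of `y` into `z`, then the combined machine
turns `x` into `z`. -/
theorem outputsInTime_chain [Fintype K] [Fintype Γ] {x : List (M.Γ M.k₀)} {y : List (M.Γ M.k₁)}
    {z : List Γ} {t₁ t₂ : ℕ} (h₁ : Turing.TM2OutputsInTime M x (some y) t₁)
    (h₂ : p.Exec (update (fun _ => []) i (y.map f).reverse) (update (fun _ => []) o z) t₂) :
    Nonempty (Turing.TM2OutputsInTime (chain M f p i o) x (some z)
      (t₁ + (y.length + 1) + t₂ + 1)) := by
  obtain ⟨⟨n, hn⟩, hnt⟩ := h₁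
  have hn' : Steps M.step n (Turing.initList M x) (Turing.haltList M y) := hn
  have s₁ := steps_liftCfg M f p i hn'
  have hk : (Turing.haltList M y).stk M.k₁ = y := by simp [Turing.haltList]
  have s₂ := steps_transfer M f p i M.initialState y (Turing.haltList M y).stk hk (fun _ => []) none
  have hk' : update (Turing.haltList M y).stk M.k₁ [] = fun _ => [] := by
    funext k
    by_cases h : k = M.k₁
    · subst h; simp
    · simp [Turing.haltList, h]
  rw [hk', List.append_nil] at s₂
  obtain ⟨b, s₃⟩ := h₂.steps (m := chainStmt M f p i) (fun k : M.K => ([] : List (M.Γ k)))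
    M.initialState (fun l => Sum.inr (Sum.inr l)) (Sum.inr (Sum.inl false)) (fun l => rfl) none
  have s₄ : Steps (Turing.TM2.step (chainStmt M f p i)) 1
      ⟨some (Sum.inr (Sum.inl false)), (M.initialState, b),
        joinStacks (fun _ => []) (update (fun _ => []) o z)⟩
      ⟨none, (M.initialState, none), joinStacks (fun _ => []) (update (fun _ => []) o z)⟩ := rfl
  have s := ((s₁.trans s₂).trans s₃).trans s₄
  have e₁ : liftCfg M p (Turing.initList M x) =
      (Turing.initList (chain M f p i o) x : (chain M f p i o).Cfg) := by
    change Turing.TM2.Cfg.mk _ _ _ = Turing.TM2.Cfg.mk _ _ _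
    congr 1
    funext k
    rcases k with k | k
    · by_cases h : k = M.k₀
      · subst h
        simp [joinStacks, Turing.initList, chain]
        rfl
      · simp [joinStacks, Turing.initList, chain, h]
    · simp [joinStacks, chain]
  have e₂ : (⟨none, (M.initialState, none), joinStacks (fun _ => []) (update (fun _ => []) o z)⟩ :
      Turing.TM2.Cfg (JoinAlphabet M.Γ K Γ) (M.Λ ⊕ (Bool ⊕ p.Lbl)) (M.σ × Option Γ)) =
      (Turing.haltList (chain M f p i o) z : (chain M f p i o).Cfg) := by
    change Turing.TM2.Cfg.mk _ _ _ = Turing.TM2.Cfg.mk _ _ _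
    congr 1
    funext k
    rcases k with k | k
    · simp [joinStacks, chain]
    · by_cases h : k = o
      · subst h
        simp [joinStacks, chain]
        rfl
      · simp [joinStacks, chain, h]
  rw [e₁, e₂] at s
  exact ⟨⟨⟨n + (y.length + 1) + t₂ + 1, s⟩, by dsimp only at hnt ⊢; omega⟩⟩

end

/-! ### The length of the output of a Turing machine -/

/-- The number of push instructions in a statement. -/
def pushCount {K₁ : Type} {Γ₁ : K₁ → Type} {σ Λ : Type} : Turing.TM2.Stmt Γ₁ Λ σ → ℕ
  | .push _ _ q => pushCount q + 1
  | .peek _ _ q => pushCount q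
  | .pop _ _ q => pushCount q
  | .load _ q => pushCount q
  | .branch _ q q' => pushCount q + pushCount q'
  | .goto _ => 0
  | .halt => 0

theorem length_stk_stepAux_le {K₁ : Type} [DecidableEq K₁] {Γ₁ : K₁ → Type} {σ Λ : Type}
    (q : Turing.TM2.Stmt Γ₁ Λ σ) (v : σ) (T : ∀ k, List (Γ₁ k)) (k : K₁) :
    ((Turing.TM2.stepAux q v T).stk k).length ≤ (T k).length + pushCount q := by
  induction q generalizing v T with
  | push k' f q ih =>
    refine (ih _ _).trans ?_
    rw [pushCount]
    by_cases h : k = k'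
    · subst h; simp; omega
    · simp [h]
  | peek k' f q ih => exact ih _ _
  | pop k' f q ih =>
    refine (ih _ _).trans ?_
    rw [pushCount]
    by_cases h : k = k'
    · subst h; simp
    · simp [h]
  | load f q ih => exact ih _ _
  | branch f q q' ih ih' =>
    simp only [Turing.TM2.stepAux, pushCount]
    cases f v
    · exact (ih' _ _).trans (by omega)
    · exact (ih _ _).trans (by omega)
  | goto l => exact Nat.le_add_right _ _
  | halt => exact Nat.le_add_right _ _

/-- The output of a Turing machine is not longer than its input and a multiple of its running time
together. -/
theorem exists_length_output_le (M : Turing.FinTM2) : ∃ C, ∀ (x : List (M.Γ M.k₀))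
    (y : List (M.Γ M.k₁)) (t : ℕ), Nonempty (Turing.TM2OutputsInTime M x (some y) t) →
    y.length ≤ x.length + C * t := by
  let := M.ΛFin
  refine ⟨∑ l, pushCount (M.m l), ?_⟩
  rintro x y t ⟨⟨n, hn⟩, hnt⟩
  have key : ∀ (n : ℕ) (c c' : M.Cfg), Steps M.step n c c' → ∀ k,
      (c'.stk k).length ≤ (c.stk k).length + (∑ l, pushCount (M.m l)) * n := by
    intro n
    induction n with
    | zero =>
      intro c c' h k
      obtain rfl : c = c' := Option.some.inj h
      simp
    | succ n ih =>
      intro c c' h k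
      rw [Steps, Function.iterate_succ_apply] at h
      rcases e : M.step c with - | c₁
      · have e' : flip bind M.step (some c) = none := e
        have : (flip bind M.step)^[n] (none : Option M.Cfg) = none :=
          Function.iterate_fixed rfl n
        rw [e', this] at h
        cases h
      · have e' : flip bind M.step (some c) = some c₁ := e
        rw [e'] at h
        refine (ih c₁ c' h k).trans ?_
        have h₁ : (c₁.stk k).length ≤ (c.stk k).length + ∑ l, pushCount (M.m l) := by
          obtain ⟨l, v, T⟩ := c
          cases l with
          | none => cases e
          | some l =>
            obtain rfl : Turing.TM2.stepAux (M.m l) v T = c₁ := Option.some.inj e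
            refine (length_stk_stepAux_le _ _ _ _).trans (Nat.add_le_add_left ?_ _)
            exact Finset.single_le_sum (f := fun l => pushCount (M.m l)) (fun _ _ => Nat.zero_le _)
              (Finset.mem_univ l)
        rw [Nat.mul_succ]
        omega
  have h := key n _ _ hn M.k₁
  have h₁ : (Turing.haltList M y).stk M.k₁ = y := by simp [Turing.haltList]
  have h₂ : ((Turing.initList M x).stk M.k₁).length ≤ x.length := by
    by_cases h : M.k₁ = M.k₀
    · have : ∀ (k : M.K) (h : k = M.k₀), ((Turing.initList M x).stk k).length ≤ x.length := by
        rintro k rfl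
        simp [Turing.initList]
      exact this _ h
    · simp [Turing.initList, h]
  rw [h₁] at h
  have := Nat.mul_le_mul_left (∑ l, pushCount (M.m l)) hnt
  dsimp only at this
  omega

end StackProg

/-- The letters of the strings that describe instances of first-order model checking. -/
abbrev OutLetter : Type := Option Bool ⊕ FOLetter

/-- The letter in which counters are written. -/
abbrev tick : OutLetter := Sum.inr FOLetter.tick

/-- The stacks of the programs that print an instance of model checking: the input word, the output
(as it is printed, that is, with the last letter on top, and in the final order), scratch stacks,
counters in unary, and the lists of the iterations still to be made by a loop over a counter. -/
inductive Stk
  | inp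
  | out
  | fin
  | a
  | b
  | w
  | tmp
  | ctr (c : Fin 8)
  | todo (c : Fin 8)
  deriving DecidableEq, Fintype

namespace StackProg

variable {K Γ : Type} [DecidableEq K]

/-! ### Elementary stack programs -/

theorem Exec.congr {p : StackProg K Γ} {S S' S'' : K → List Γ} {t t' : ℕ} (h : p.Exec S S' t)
    (hS : S' = S'') (ht : t = t') : p.Exec S S'' t' := hS ▸ ht ▸ h

theorem exec_clear (k : K) (S : K → List Γ) :
    Exec (.loop k fun _ => .skip) S (update S k []) (2 * (S k).length + 1) := by
  generalize h : S k = l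
  induction l generalizing S with
  | nil => exact (Exec.loop_nil h).congr (by rw [← h, update_eq_self]) rfl
  | cons a l ih =>
    refine (Exec.loop_cons h (.skip _) (ih (update S k l) (by simp))).congr (by simp) ?_
    simp; ring

theorem exec_move {src dst : K} (hne : src ≠ dst) (S : K → List Γ) :
    Exec (.loop src fun a => .push dst a) S
      (update (update S src []) dst ((S src).reverse ++ S dst)) (2 * (S src).length + 1) := by
  generalize h : S src = l
  induction l generalizing S with
  | nil => exact (Exec.loop_nil h).congr (by
      funext x
      simp only [update_apply]
      split_ifs <;> simp_all) rfl
  | cons a l ih =>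
    refine (Exec.loop_cons h (.push _ _ _) (ih _ ?_)).congr ?_ ?_
    · simp [hne]
    · funext x
      simp only [update_apply]
      split_ifs <;> simp_all
    · simp; ring

theorem exec_move_two {src dst dst' : K} (h₁ : src ≠ dst) (h₂ : src ≠ dst') (h₃ : dst ≠ dst')
    (S : K → List Γ) :
    Exec (.loop src fun a => .seq (.push dst a) (.push dst' a)) S
      (update (update (update S src []) dst ((S src).reverse ++ S dst)) dst'
        ((S src).reverse ++ S dst')) (3 * (S src).length + 1) := by
  generalize h : S src = l
  induction l generalizing S with
  | nil => exact (Exec.loop_nil h).congr (by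
      funext x
      simp only [update_apply]
      split_ifs <;> simp_all) rfl
  | cons a l ih =>
    refine (Exec.loop_cons h (.seq (.push _ _ _) (.push _ _ _)) (ih _ ?_)).congr ?_ ?_
    · simp [h₁, h₂]
    · funext x
      simp only [update_apply]
      split_ifs <;> simp_all
    · simp; ring

/-- Put the contents of `src` on top of `dst`, with the help of the empty stack `aux`. -/
def copy (src dst aux : K) : StackProg K Γ :=
  .seq (.loop src fun a => .push aux a) (.loop aux fun a => .seq (.push src a) (.push dst a))

theorem exec_copy {src dst aux : K} (h₁ : src ≠ dst) (h₂ : src ≠ aux) (h₃ : dst ≠ aux)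
    {S : K → List Γ} (h : S aux = []) :
    Exec (copy src dst aux) S (update S dst (S src ++ S dst)) (5 * (S src).length + 2) := by
  refine (Exec.seq (exec_move h₂ S) (exec_move_two h₂.symm h₃.symm h₁ _)).congr ?_ ?_
  · funext x
    simp only [update_apply]
    split_ifs <;> simp_all
  · simp [h]; ring

/-- Pop as many letters from `w` as there are on the stack `k`, which becomes empty. -/
theorem exec_drop {k w : K} (hne : k ≠ w) (S : K → List Γ) :
    Exec (.loop k fun _ => .pop w fun _ => .skip) S
      (update (update S k []) w ((S w).drop (S k).length)) (3 * (S k).length + 1) := by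
  generalize h : S k = l
  induction l generalizing S with
  | nil => exact (Exec.loop_nil h).congr (by
      funext x
      simp only [update_apply]
      split_ifs <;> simp_all) rfl
  | cons a l ih =>
    refine (Exec.loop_cons h (.pop (.skip _)) (ih _ ?_)).congr ?_ ?_
    · simp [hne]
    · funext x
      simp only [update_apply]
      split_ifs <;> simp_all
    · simp; ring

/-! ### Programs that print words -/

/-- A linear expression in the counters: a sum of counters, plus a constant. -/
abbrev CtrExpr : Type := List (Fin 8) × ℕ

/-- The value of an expression, when the counters have the given values. -/
def CtrExpr.val (E : CtrExpr) (v : Fin 8 → ℕ) : ℕ := (E.1.map v).sum + E.2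

theorem CtrExpr.val_le {E : CtrExpr} {v : Fin 8 → ℕ} {m : ℕ} (h : ∀ c, v c ≤ m) :
    E.val v ≤ E.1.length * m + E.2 := by
  refine Nat.add_le_add_right ?_ _
  have := List.sum_le_card_nsmul (E.1.map v) m (by simp; exact fun c _ => h c)
  simpa using this

/-- The store `S` holds the input word `x` and the values `v` of the counters, the counters from
number `d` on are not in use, and the scratch stacks are empty. -/
structure Holds (d : ℕ) (v : Fin 8 → ℕ) (x : List OutLetter) (S : Stk → List OutLetter) : Prop where
  inp : S .inp = x
  ctr : ∀ c, S (.ctr c) = List.replicate (v c) tick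
  todo : ∀ c : Fin 8, d ≤ c → S (.todo c) = []
  zero : ∀ c : Fin 8, d ≤ c → v c = 0
  a : S .a = []
  b : S .b = []
  w : S .w = []
  tmp : S .tmp = []

theorem Holds.update_out {d : ℕ} {v : Fin 8 → ℕ} {x : List OutLetter} {S : Stk → List OutLetter}
    (h : Holds d v x S) (l : List OutLetter) : Holds d v x (update S .out l) := by
  refine ⟨?_, ?_, ?_, h.zero, ?_, ?_, ?_, ?_⟩ <;> simp [h.inp, h.ctr, h.a, h.b, h.w, h.tmp]
  exact h.todo

/-- Put the value of an expression, in unary, on top of `dst`. -/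
def addExpr (E : CtrExpr) (dst : Stk) : StackProg Stk OutLetter :=
  E.1.foldr (fun c p => .seq (copy (.ctr c) dst .tmp) p)
    (Nat.rec .skip (fun _ p => .seq (.push dst tick) p) E.2)

theorem exec_addExpr (E : CtrExpr) {dst : Stk} (h₁ : ∀ c, dst ≠ .ctr c) (h₂ : dst ≠ .tmp)
    {v : Fin 8 → ℕ} {S : Stk → List OutLetter} (hc : ∀ c, S (.ctr c) = List.replicate (v c) tick)
    (ht : S .tmp = []) {m : ℕ} (hm : ∀ c, v c ≤ m) :
    ∃ t ≤ E.1.length * (5 * m + 2) + E.2 + 1,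
      Exec (addExpr E dst) S (update S dst (List.replicate (E.val v) tick ++ S dst)) t := by
  obtain ⟨L, r⟩ := E
  induction L generalizing S with
  | nil =>
    refine ⟨r + 1, by simp, ?_⟩
    simp only [addExpr, List.foldr_nil, CtrExpr.val, List.map_nil, List.sum_nil, Nat.zero_add]
    induction r generalizing S with
    | zero => exact (Exec.skip S).congr (by simp) rfl
    | succ r ih =>
      refine (Exec.seq (.push _ _ _) (ih (S := update S dst (tick :: S dst)) ?_ ?_)).congr ?_ ?_
      · intro c; rw [update_of_ne (h₁ c).symm]; exact hc c
      · rw [update_of_ne h₂.symm]; exact ht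
      · rw [update_self, update_idem, List.replicate_succ', List.append_assoc]; rfl
      · ring
  | cons c L ih =>
    have e := exec_copy (h₁ c).symm (by simp : Stk.ctr c ≠ .tmp) h₂ (S := S) ht
    obtain ⟨t, ht', h⟩ := ih (S := update S dst (S (.ctr c) ++ S dst))
      (fun c => by rw [update_of_ne (h₁ c).symm]; exact hc c)
      (by rw [update_of_ne h₂.symm]; exact ht)
    refine ⟨_, ?_, (Exec.seq e h).congr ?_ rfl⟩
    · simp only [hc, List.length_replicate, List.length_cons] at ht' ⊢
      have := hm c
      nlinarith
    · rw [update_self, update_idem, hc]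
      simp only [CtrExpr.val, List.map_cons, List.sum_cons]
      rw [← List.append_assoc, ← List.replicate_add]
      congr 3
      ring

/-- A word that depends on the counters and the input is printable if a stack program, in polynomial
time, prints it and leaves everything else unchanged.  Only the counters below `d` are in use. -/
def Printable (d : ℕ) (e : (Fin 8 → ℕ) → List OutLetter → List OutLetter) : Prop :=
  ∃ (p : StackProg Stk OutLetter) (T : Polynomial ℕ), ∀ (m : ℕ) (v : Fin 8 → ℕ)
    (x : List OutLetter) (S : Stk → List OutLetter), (∀ c, v c ≤ m) → x.length ≤ m →
    Holds d v x S → ∃ t ≤ T.eval m, p.Exec S (update S .out ((e v x).reverse ++ S .out)) t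

theorem Printable.congr {d : ℕ} {e e' : (Fin 8 → ℕ) → List OutLetter → List OutLetter}
    (h : Printable d e) (he : ∀ v x, e v x = e' v x) : Printable d e' := by
  obtain rfl : e = e' := funext fun v => funext fun x => he v x
  exact h

theorem printable_nil (d : ℕ) : Printable d fun _ _ => [] :=
  ⟨.skip, 1, fun m v x S _ _ _ => ⟨1, by simp, (Exec.skip S).congr (by simp) rfl⟩⟩

theorem printable_letter (d : ℕ) (a : OutLetter) : Printable d fun _ _ => [a] :=
  ⟨.push .out a, 1, fun m v x S _ _ _ => ⟨1, by simp, .push _ _ _⟩⟩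

theorem Printable.append {d : ℕ} {e e' : (Fin 8 → ℕ) → List OutLetter → List OutLetter}
    (h : Printable d e) (h' : Printable d e') : Printable d fun v x => e v x ++ e' v x := by
  obtain ⟨p, T, hp⟩ := h
  obtain ⟨p', T', hp'⟩ := h'
  refine ⟨.seq p p', T + T', fun m v x S hv hx hS => ?_⟩
  obtain ⟨t, ht, h⟩ := hp m v x S hv hx hS
  obtain ⟨t', ht', h'⟩ := hp' m v x _ hv hx (hS.update_out _)
  refine ⟨t + t', ?_, (Exec.seq h h').congr ?_ rfl⟩
  · rw [Polynomial.eval_add]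
    exact Nat.add_le_add ht ht'
  · simp

theorem Printable.cons {d : ℕ} {e : (Fin 8 → ℕ) → List OutLetter → List OutLetter}
    (a : OutLetter) (h : Printable d e) : Printable d fun v x => a :: e v x :=
  (printable_letter d a).append h

theorem printable_const (d : ℕ) (l : List OutLetter) : Printable d fun _ _ => l := by
  induction l with
  | nil => exact printable_nil d
  | cons a l ih => exact ih.cons a

/-- Comparison of two expressions. -/
theorem Printable.ite_lt {d : ℕ} {e e' : (Fin 8 → ℕ) → List OutLetter → List OutLetter}
    (E E' : CtrExpr) (h : Printable d e) (h' : Printable d e') :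
    Printable d fun v x => if E.val v < E'.val v then e v x else e' v x := by
  obtain ⟨p, T, hp⟩ := h
  obtain ⟨p', T', hp'⟩ := h'
  refine ⟨.seq (addExpr E .a) (.seq (addExpr E' .b)
    (.seq (.loop .a fun _ => .pop .b fun _ => .skip)
      (.pop .b fun o => o.elim p' fun _ => .seq (.loop .b fun _ => .skip) p))),
    (E.1.length * (5 * .X + 2) + E.2 + 1) + (E'.1.length * (5 * .X + 2) + E'.2 + 1) +
      (3 * (E.1.length * .X + E.2) + 1) + (2 * (E'.1.length * .X + E'.2) + 2) + T + T',
    fun m v x S hv hx hS => ?_⟩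
  obtain ⟨t₁, ht₁, h₁⟩ := exec_addExpr E (dst := .a) (by simp) (by simp) hS.ctr hS.tmp hv
  obtain ⟨t₂, ht₂, h₂⟩ := exec_addExpr E' (dst := .b) (by simp) (by simp)
    (S := update S .a (List.replicate (E.val v) tick ++ S .a))
    (by simpa using hS.ctr) (by simpa using hS.tmp) hv
  have h₃ := exec_drop (by simp : Stk.a ≠ Stk.b)
    (update (update S .a (List.replicate (E.val v) tick ++ S .a)) .b
      (List.replicate (E'.val v) tick ++ (update S .a (List.replicate (E.val v) tick ++ S .a)) .b))
  have e₃ : (update (update (update (update S .a (List.replicate (E.val v) tick ++ S .a)) .b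
      (List.replicate (E'.val v) tick ++ (update S .a (List.replicate (E.val v) tick ++ S .a)) .b))
      .a []) .b (List.drop (E.val v) (List.replicate (E'.val v) tick))) =
      update S .b (List.replicate (E'.val v - E.val v) tick) := by
    funext k
    have ha := hS.a
    simp only [update_apply]
    split_ifs <;> simp_all
  replace h₃ := h₃.congr (S'' := update S .b (List.replicate (E'.val v - E.val v) tick))
    (t' := 3 * E.val v + 1) (by rw [← e₃]; simp [hS.a, hS.b]) (by simp [hS.a])
  have b₁ := CtrExpr.val_le (E := E) hv
  have b₂ := CtrExpr.val_le (E := E') hv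
  simp only [Polynomial.eval_add, Polynomial.eval_mul, Polynomial.eval_X, Polynomial.eval_natCast,
    Polynomial.eval_ofNat, Polynomial.eval_one, Nat.cast_id]
  split_ifs with hlt
  · obtain ⟨t, ht, h⟩ := hp m v x S hv hx hS
    obtain ⟨r, hr⟩ : ∃ r, E'.val v - E.val v = r + 1 := ⟨E'.val v - E.val v - 1, by omega⟩
    rw [hr] at h₃
    have h₄ : Exec (.seq (.loop .b fun _ => .skip) p)
        (update (update S .b (List.replicate (r + 1) tick)) .b
          ((update S .b (List.replicate (r + 1) tick) .b).tail))
        (update S .out ((e v x).reverse ++ S .out)) (2 * r + 1 + t) := by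
      refine Exec.seq ((exec_clear _ _).congr (S'' := S) ?_ ?_) h
      · simp [← hS.b]
      · simp
    refine ⟨_, ?_, .seq h₁ (.seq h₂ (.seq h₃ (.pop (t := 2 * r + 1 + t) ?_)))⟩
    · omega
    · rw [List.replicate_succ] at h₄ ⊢
      simpa using h₄
  · obtain ⟨t, ht, h⟩ := hp' m v x S hv hx hS
    rw [Nat.sub_eq_zero_of_le (by omega)] at h₃
    refine ⟨_, ?_, .seq h₁ (.seq h₂ (.seq h₃ (.pop (t := t) ?_)))⟩
    · omega
    · have e : update S .b [] = S := by rw [← hS.b, update_eq_self]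
      simpa [e, hS.b] using h

/-- Pop as many letters from `w` as an expression says. -/
def dropExpr (E : CtrExpr) : StackProg Stk OutLetter :=
  .seq (addExpr E .b) (.loop .b fun _ => .pop .w fun _ => .skip)

theorem exec_dropExpr (E : CtrExpr) {v : Fin 8 → ℕ} {S : Stk → List OutLetter}
    (hc : ∀ c, S (.ctr c) = List.replicate (v c) tick) (hb : S .b = []) (ht : S .tmp = [])
    {m : ℕ} (hm : ∀ c, v c ≤ m) :
    ∃ t ≤ E.1.length * (8 * m + 2) + 4 * E.2 + 2,
      Exec (dropExpr E) S (update S .w ((S .w).drop (E.val v))) t := by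
  obtain ⟨t, ht, h⟩ := exec_addExpr E (dst := .b) (by simp) (by simp) hc ht hm
  have h' := exec_drop (by simp : Stk.b ≠ Stk.w)
    (update S .b (List.replicate (E.val v) tick ++ S .b))
  refine ⟨_, ?_, (Exec.seq h h').congr ?_ rfl⟩
  · have := CtrExpr.val_le (E := E) hm
    simp only [hb, update_self, List.append_nil, List.length_replicate]
    nlinarith
  · funext k
    simp only [update_apply]
    split_ifs <;> simp_all

/-- Pop as many rows from `w` as there are marks on the stack `a`, the length of the rows being
given by an expression. -/
theorem exec_dropRows (E : CtrExpr) {v : Fin 8 → ℕ} {m : ℕ} (hm : ∀ c, v c ≤ m) (r : ℕ)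
    {S : Stk → List OutLetter} (hc : ∀ c, S (.ctr c) = List.replicate (v c) tick)
    (ha : S .a = List.replicate r tick) (hb : S .b = []) (ht : S .tmp = []) :
    ∃ t ≤ r * (E.1.length * (8 * m + 2) + 4 * E.2 + 3) + 1,
      Exec (.loop .a fun _ => dropExpr E) S
        (update (update S .a []) .w ((S .w).drop (r * E.val v))) t := by
  induction r generalizing S with
  | zero =>
    refine ⟨1, by simp, (Exec.loop_nil ha).congr ?_ rfl⟩
    funext k
    simp only [update_apply]
    split_ifs <;> simp_all
  | succ r ih =>
    obtain ⟨t, ht₁, h₁⟩ := exec_dropExpr E (S := update S .a (List.replicate r tick))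
      (by simpa using hc) (by simpa using hb) (by simpa using ht) hm
    obtain ⟨t', ht₂, h₂⟩ := ih (S := update (update S .a (List.replicate r tick)) .w
      ((S .w).drop (E.val v))) (by simpa using hc) (by simp) (by simpa using hb) (by simpa using ht)
    refine ⟨_, ?_, (Exec.loop_cons (ha.trans List.replicate_succ) (by simpa using h₁) h₂).congr ?_
        rfl⟩
    · linarith
    · funext k
      simp only [update_apply]
      split_ifs <;> simp_all
      rw [Nat.add_mul, one_mul, Nat.add_comm]

/-- A test of a letter of the input, at a position that is given by a row, the length of the rows,
and the place in the row. -/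
theorem Printable.ite_letter {d : ℕ} {e e' : (Fin 8 → ℕ) → List OutLetter → List OutLetter}
    (R W C : CtrExpr) (P : Option OutLetter → Bool) (h : Printable d e) (h' : Printable d e') :
    Printable d fun v x => if P (x[R.val v * W.val v + C.val v]?) then e v x else e' v x := by
  obtain ⟨p, T, hp⟩ := h
  obtain ⟨p', T', hp'⟩ := h'
  refine ⟨.seq (copy .inp .w .tmp) (.seq (addExpr R .a) (.seq (.loop .a fun _ => dropExpr W)
    (.seq (dropExpr C)
      (.pop .w fun o => .seq (.loop .w fun _ => .skip) (if P o then p else p'))))),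
    (5 * .X + 2) + (R.1.length * (5 * .X + 2) + R.2 + 1) +
      ((R.1.length * .X + R.2) * (W.1.length * (8 * .X + 2) + 4 * W.2 + 3) + 1) +
      (C.1.length * (8 * .X + 2) + 4 * C.2 + 2) + (2 * .X + 2) + T + T',
    fun m v x S hv hx hS => ?_⟩
  have h₀ := exec_copy (by simp : Stk.inp ≠ .w) (by simp : Stk.inp ≠ .tmp) (by simp : Stk.w ≠ .tmp)
    hS.tmp
  simp only [hS.w, hS.inp, List.append_nil] at h₀
  obtain ⟨t₁, ht₁, h₁⟩ := exec_addExpr R (dst := .a) (by simp) (by simp)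
    (S := update S .w x) (by simpa using hS.ctr) (by simpa using hS.tmp) hv
  obtain ⟨t₂, ht₂, h₂⟩ := exec_dropRows W hv (R.val v)
    (S := update (update S .w x) .a (List.replicate (R.val v) tick ++ (update S .w x) .a))
    (by simpa using hS.ctr) (by simp [hS.a]) (by simp [hS.b]) (by simp [hS.tmp])
  have e₂ : update (update (update (update S .w x) .a (List.replicate (R.val v) tick ++
      (update S .w x) .a)) .a []) .w (x.drop (R.val v * W.val v)) =
      update S .w (x.drop (R.val v * W.val v)) := by
    funext k
    have ha := hS.a
    simp only [update_apply]
    split_ifs <;> simp_all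
  replace h₂ := h₂.congr (by simpa using e₂) rfl
  obtain ⟨t₃, ht₃, h₃⟩ := exec_dropExpr C (S := update S .w (x.drop (R.val v * W.val v)))
    (by simpa using hS.ctr) (by simpa using hS.b) (by simpa using hS.tmp) hv
  simp only [update_self, List.drop_drop, update_idem] at h₃
  set y := x.drop (R.val v * W.val v + C.val v) with hy
  have hyl : y.tail.length ≤ m := by simp [hy]; omega
  have hyh : y.head? = x[R.val v * W.val v + C.val v]? := by simp [hy]
  have h₄ : Exec (.loop .w fun _ => .skip) (update S .w y.tail) S (2 * y.tail.length + 1) := by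
    refine (exec_clear _ _).congr ?_ (by simp)
    rw [update_idem, ← hS.w, update_eq_self]
  have b₁ := CtrExpr.val_le (E := R) hv
  have key : ∃ t ≤ T.eval m + T'.eval m, Exec (if P y.head? then p else p') S
      (update S .out ((if P y.head? then e v x else e' v x).reverse ++ S .out)) t := by
    split_ifs
    · obtain ⟨t, ht, h⟩ := hp m v x S hv hx hS
      exact ⟨t, by omega, h⟩
    · obtain ⟨t, ht, h⟩ := hp' m v x S hv hx hS
      exact ⟨t, by omega, h⟩
  obtain ⟨t₅, ht₅, h₅⟩ := key
  have h₆ := Exec.seq h₀ (.seq h₁ (.seq h₂ (.seq h₃ (.pop (k := .w)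
    (body := fun o => .seq (.loop .w fun _ => .skip) (if P o then p else p'))
    (t := 2 * y.tail.length + 1 + t₅) (by simpa using Exec.seq h₄ h₅)))))
  rw [hyh] at h₆
  refine ⟨_, ?_, h₆⟩
  simp only [Polynomial.eval_add, Polynomial.eval_mul, Polynomial.eval_X, Polynomial.eval_natCast,
    Polynomial.eval_ofNat, Polynomial.eval_one, Nat.cast_id]
  have := Nat.mul_le_mul_right (W.1.length * (8 * m + 2) + 4 * W.2 + 3) b₁
  omega

/-- A loop: the counter `d` runs through the numbers below the value of an expression. -/
theorem Printable.flatMap_range {d : ℕ} (hd : d < 8)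
    {e : (Fin 8 → ℕ) → List OutLetter → List OutLetter} (E : CtrExpr) (h : Printable (d + 1) e) :
    Printable d fun v x => (List.range (E.val v)).flatMap fun i => e (update v ⟨d, hd⟩ i) x := by
  obtain ⟨p, T, hp⟩ := h
  let c : Fin 8 := ⟨d, hd⟩
  refine ⟨.seq (addExpr E (.todo c)) (.seq
    (.loop (.todo c) fun _ => .seq p (.push (.ctr c) tick)) (.loop (.ctr c) fun _ => .skip)),
    (E.1.length * (5 * .X + 2) + E.2 + 1) + ((E.1.length * .X + E.2) *
      (T.comp (E.1.length * .X + E.2 + .X) + 2) + 1) + (2 * (E.1.length * .X + E.2) + 1),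
    fun m v x S hv hx hS => ?_⟩
  obtain ⟨t₁, ht₁, h₁⟩ := exec_addExpr E (dst := .todo c) (by simp) (by simp) hS.ctr hS.tmp hv
  rw [hS.todo c le_rfl, List.append_nil] at h₁
  have hE := CtrExpr.val_le (E := E) hv
  have key : ∀ r i, i + r = E.val v → ∀ o, ∃ t ≤ r * (T.eval (E.1.length * m + E.2 + m) + 2) + 1,
      Exec (.loop (.todo c) fun _ => .seq p (.push (.ctr c) tick))
        (update (update (update S (.todo c) (List.replicate r tick)) (.ctr c)
          (List.replicate i tick)) .out o)
        (update (update S (.ctr c) (List.replicate (i + r) tick)) .out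
          (((List.range' i r).flatMap fun j => e (update v c j) x).reverse ++ o)) t := by
    intro r
    induction r with
    | zero =>
      intro i _ o
      refine ⟨1, by simp, (Exec.loop_nil (by simp)).congr ?_ rfl⟩
      have := hS.todo c le_rfl
      funext k
      simp only [update_apply]
      split_ifs <;> simp_all
    | succ r ih =>
      intro i hi o
      obtain ⟨t, ht, h⟩ := hp (E.1.length * m + E.2 + m) (update v c i) x
        (update (update (update S (.todo c) (List.replicate r tick)) (.ctr c)
          (List.replicate i tick)) .out o) (fun c' => by
            have := hv c'
            simp only [update_apply]
            split_ifs <;> omega) (by omega) (by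
            refine ⟨?_, ?_, ?_, ?_, ?_, ?_, ?_, ?_⟩
            · simpa using hS.inp
            · intro c'
              by_cases h : c' = c
              · subst h; simp
              · simp [h, hS.ctr c']
            · intro c' h
              have : c' ≠ c := by rintro rfl; simp [c] at h
              simpa [this] using hS.todo c' (by omega)
            · intro c' h
              have : c' ≠ c := by rintro rfl; simp [c] at h
              simpa [this] using hS.zero c' (by omega)
            · simpa using hS.a
            · simpa using hS.b
            · simpa using hS.w
            · simpa using hS.tmp)
      obtain ⟨t', ht', h'⟩ := ih (i + 1) (by omega) ((e (update v c i) x).reverse ++ o)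
      have h₀ : (update (update (update S (.todo c) (List.replicate (r + 1) tick)) (.ctr c)
          (List.replicate i tick)) .out o) (.todo c) = tick :: List.replicate r tick := by
        simp [List.replicate_succ]
      have hbody := Exec.seq h (.push (.ctr c) tick _)
      refine ⟨_, ?_, Exec.loop_cons h₀ (S' := update (update (update S (.todo c)
        (List.replicate r tick)) (.ctr c) (List.replicate (i + 1) tick)) .out
          ((e (update v c i) x).reverse ++ o)) (t := t + 1) ?_ (h'.congr ?_ rfl)⟩
      · linarith
      · convert hbody using 1
        · funext k
          simp only [update_apply]
          split_ifs <;> simp_all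
        · funext k
          simp only [update_apply]
          split_ifs <;> simp_all [List.replicate_succ]
      · rw [List.range'_succ, Nat.add_right_comm i 1 r, ← Nat.add_assoc]
        simp
  obtain ⟨t₂, ht₂, h₂⟩ := key (E.val v) 0 (by simp) (S .out)
  have e₂ : update (update (update S (.todo c) (List.replicate (E.val v) tick)) (.ctr c)
      (List.replicate 0 tick)) .out (S .out) =
      update S (.todo c) (List.replicate (E.val v) tick) := by
    have h₀ := hS.ctr c
    rw [hS.zero c le_rfl] at h₀
    funext k
    simp only [update_apply]
    split_ifs <;> simp_all
  rw [e₂, Nat.zero_add, ← List.range_eq_range'] at h₂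
  refine ⟨_, ?_, .seq h₁ (.seq h₂ ((exec_clear (Stk.ctr c) _).congr ?_ rfl))⟩
  · simp only [Polynomial.eval_add, Polynomial.eval_mul, Polynomial.eval_X, Polynomial.eval_natCast,
      Polynomial.eval_ofNat, Polynomial.eval_one, Polynomial.eval_comp, Nat.cast_id]
    have := Nat.mul_le_mul_right (T.eval (E.1.length * m + E.2 + m) + 2) hE
    simp
    omega
  · have h₀ := hS.ctr c
    rw [hS.zero c le_rfl] at h₀
    funext k
    simp only [update_apply]
    split_ifs <;> simp_all
    rfl

/-! ### Complete programs -/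

/-- Separate the letters of the word on stack `w`: those with `Q` are counted by counter 1, the
other ones are put on the input stack, and those with `P` among them are counted by counter 0. -/
def sortInput (P Q : OutLetter → Bool) : StackProg Stk OutLetter :=
  .loop .w fun a => if Q a then .push (.ctr 1) tick else
    .seq (if P a then .push (.ctr 0) tick else .skip) (.push .inp a)

theorem exec_sortInput (P Q : OutLetter → Bool) (l : List OutLetter) (S : Stk → List OutLetter)
    (hl : S .w = l) :
    ∃ t ≤ 3 * l.length + 1, Exec (sortInput P Q) S
      (update (update (update (update S .w []) (.ctr 0)
        (List.replicate ((l.filter fun a => !Q a).countP P) tick ++ S (.ctr 0))) (.ctr 1)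
        (List.replicate (l.countP Q) tick ++ S (.ctr 1))) .inp
        ((l.filter fun a => !Q a).reverse ++ S .inp)) t := by
  induction l generalizing S with
  | nil =>
    refine ⟨1, by simp, (Exec.loop_nil hl).congr ?_ rfl⟩
    funext k
    simp only [update_apply]
    split_ifs <;> simp_all
  | cons a l ih =>
    rcases hQ : Q a with - | -
    · rcases hP : P a with - | -
      · obtain ⟨t, ht, h⟩ := ih (update (update S .w l) .inp (a :: S .inp)) (by simp)
        refine ⟨1 + (1 + 1) + t, by simp; omega, Exec.loop_cons hl
          (S' := update (update S .w l) .inp (a :: S .inp)) ?_ (h.congr ?_ rfl)⟩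
        · rw [if_neg (by simp [hQ]), if_neg (by simp [hP])]
          exact (Exec.seq (.skip _) (.push _ _ _)).congr (by simp) rfl
        · funext k
          simp only [update_apply]
          split_ifs <;> simp_all
      · obtain ⟨t, ht, h⟩ := ih (update (update (update S .w l) (.ctr 0) (tick :: S (.ctr 0))) .inp
          (a :: S .inp)) (by simp)
        refine ⟨1 + (1 + 1) + t, by simp; omega, Exec.loop_cons hl
          (S' := update (update (update S .w l) (.ctr 0) (tick :: S (.ctr 0))) .inp
            (a :: S .inp)) ?_ (h.congr ?_ rfl)⟩
        · rw [if_neg (by simp [hQ]), if_pos hP]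
          exact (Exec.seq (.push _ _ _) (.push _ _ _)).congr (by simp) rfl
        · funext k
          simp only [update_apply]
          split_ifs <;> simp_all [List.replicate_succ']
    · obtain ⟨t, ht, h⟩ := ih (update (update S .w l) (.ctr 1) (tick :: S (.ctr 1))) (by simp)
      refine ⟨1 + 1 + t, by simp; omega, Exec.loop_cons hl
        (S' := update (update S .w l) (.ctr 1) (tick :: S (.ctr 1))) ?_ (h.congr ?_ rfl)⟩
      · rw [if_pos hQ]
        exact (Exec.push _ _ _).congr (by simp) rfl
      · funext k
        simp only [update_apply]
        split_ifs <;> simp_all [List.replicate_succ']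

theorem Exec.length_le {K Γ : Type} [DecidableEq K] {p : StackProg K Γ} {S S' : K → List Γ} {t : ℕ}
    (h : p.Exec S S' t) (k : K) : (S' k).length ≤ (S k).length + t := by
  induction h with
  | skip S => omega
  | push k' a S =>
    by_cases h : k = k'
    · subst h; simp
    · simp [h]
  | seq _ _ ih ih' => omega
  | @pop k' body S S' t h ih =>
    have : (update S k' (S k').tail k).length ≤ (S k).length := by
      by_cases h : k = k'
      · subst h; simp
      · simp [h]
    omega
  | loop_nil h => omega
  | @loop_cons k' body S S' S'' a l t t' h _ _ ih ih' =>
    have : (update S k' l k).length ≤ (S k).length := by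
      by_cases h' : k = k'
      · subst h'; simp [h]
      · simp [h']
    omega

/-- A complete program around a printable word: it splits its input into a word `x` and a number of
marks, counts letters, prints, and cleans up. -/
theorem Printable.exists_program {e : (Fin 8 → ℕ) → List OutLetter → List OutLetter}
    (h : Printable 2 e) (P Q : OutLetter → Bool) :
    ∃ (p : StackProg Stk OutLetter) (T : Polynomial ℕ), ∀ x y : List OutLetter,
      (∀ a ∈ x, Q a = false) → (∀ a ∈ y, Q a = true) → ∃ t ≤ T.eval (x ++ y).length,
        p.Exec (update (fun _ => []) .w (x ++ y).reverse)
          (update (fun _ => []) .fin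
            (e (update (update (fun _ => 0) 0 (x.countP P)) 1 y.length) x)) t := by
  obtain ⟨p, T, hp⟩ := h
  refine ⟨.seq (sortInput P Q) (.seq p (.seq (.loop .out fun a => .push .fin a)
    (.seq (.loop .inp fun _ => .skip) (.seq (.loop (.ctr 0) fun _ => .skip)
      (.loop (.ctr 1) fun _ => .skip))))),
    (3 * .X + 1) + T + (2 * T + 1) + (2 * .X + 1) + (2 * .X + 1) + (2 * .X + 1), fun x y hx hy =>
        ?_⟩
  obtain ⟨t₁, ht₁, h₁⟩ := exec_sortInput P Q (x ++ y).reverse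
    (update (fun _ => []) .w (x ++ y).reverse) (by simp)
  have f₁ : (x.filter fun a => !Q a) = x := List.filter_eq_self.2 (by simpa using hx)
  have f₂ : (y.filter fun a => !Q a) = [] := List.filter_eq_nil_iff.2 (by simpa using hy)
  have f₃ : x.countP Q = 0 := List.countP_eq_zero.2 (by simpa using hx)
  have f₄ : y.countP Q = y.length := List.countP_eq_length.2 (by simpa using hy)
  set v : Fin 8 → ℕ := update (update (fun _ => 0) 0 (x.countP P)) 1 y.length with hv
  set S₁ : Stk → List OutLetter := update (update (update (fun _ => []) (.ctr 0)
    (List.replicate (x.countP P) tick)) (.ctr 1) (List.replicate y.length tick)) .inp x with hS₁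
  replace h₁ := h₁.congr (S'' := S₁) (by
    simp [f₁, f₂, f₃, f₄, hS₁, List.filter_reverse, List.countP_reverse]) rfl
  have hvm : ∀ c, v c ≤ (x ++ y).length := by
    intro c
    have := List.countP_le_length (p := P) (l := x)
    simp only [hv, update_apply, List.length_append]
    split_ifs <;> omega
  obtain ⟨t₂, ht₂, h₂⟩ := hp (x ++ y).length v x S₁ hvm (by simp) (by
    refine ⟨?_, ?_, ?_, ?_, ?_, ?_, ?_, ?_⟩
    · simp [hS₁]
    · intro c
      simp only [hS₁, hv, update_apply]
      split_ifs <;> simp_all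
    · intro c _
      simp [hS₁]
    · intro c hc
      have h0 : c ≠ 0 := by rintro rfl; simp at hc
      have h1 : c ≠ 1 := by rintro rfl; simp at hc
      simp [hv, h0, h1]
    all_goals simp [hS₁])
  have hlen := h₂.length_le .out
  set z := e v x with hz
  have e₀ : S₁ .out = [] := by simp [hS₁]
  rw [e₀, List.append_nil] at h₂ hlen
  have h₃ := exec_move (by simp : Stk.out ≠ .fin) (update S₁ .out z.reverse)
  have h₄ := exec_clear Stk.inp (update (update (update S₁ .out z.reverse) .out []) .fin
    (((update S₁ .out z.reverse) .out).reverse ++ (update S₁ .out z.reverse) .fin))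
  have h₅ := exec_clear (Stk.ctr 0) (update (update (update (update S₁ .out z.reverse) .out []) .fin
    (((update S₁ .out z.reverse) .out).reverse ++ (update S₁ .out z.reverse) .fin)) .inp [])
  have h₆ := exec_clear (Stk.ctr 1) (update (update (update (update (update S₁ .out z.reverse) .out
      [])
    .fin (((update S₁ .out z.reverse) .out).reverse ++ (update S₁ .out z.reverse) .fin)) .inp [])
    (.ctr 0) [])
  refine ⟨_, ?_, .seq h₁ (.seq h₂ (.seq h₃ (.seq h₄ (.seq h₅ (h₆.congr ?_ rfl)))))⟩
  · have := List.countP_le_length (p := P) (l := x)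
    simp only [Polynomial.eval_add, Polynomial.eval_mul, Polynomial.eval_X,
      Polynomial.eval_ofNat, Polynomial.eval_one]
    simp [hS₁] at ht₁ ht₂ hlen ⊢
    omega
  · funext k
    simp only [update_apply, hS₁]
    split_ifs <;> simp_all

end StackProg

/-! ### Cluster graphs are interval graphs with lengths from a dense set -/

/-- The intervals of a cluster graph come in clusters, numbered from left to right, and all
intervals of a cluster start near one point and end near another one, where those of the next
cluster start. There, `l` and `r` say in which order the left ends and the right ends lie. -/
def ClusterAdj {V : Type*} (c l r : V → ℕ) (x y : V) : Prop :=
  c x = c y ∨ (c y = c x + 1 ∧ l y < r x) ∨ (c x = c y + 1 ∧ l x < r y)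

theorem Set.Ico_inter_Ico_nonempty {a b c d : ℝ} :
    (Set.Ico a b ∩ Set.Ico c d).Nonempty ↔ max a c < min b d := by
  rw [Set.Ico_inter_Ico, Set.nonempty_Ico]

/-- A set of non-negative numbers that is dense in an open set is dense in an interval with positive
ends. -/
theorem exists_dense_interval {L : Set ℝ} (hL : ∀ x ∈ L, 0 ≤ x)
    (hdense : ∃ U : Set ℝ, IsOpen U ∧ U.Nonempty ∧ U ⊆ closure L) :
    ∃ a δ : ℝ, 0 < δ ∧ δ ≤ a ∧ ∀ x y, a - δ ≤ x → x < y → y ≤ a + δ → ∃ z ∈ L, x < z ∧ z < y := by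
  obtain ⟨U, hU, ⟨p, hp⟩, hUL⟩ := hdense
  obtain ⟨ε, hε, hball⟩ := Metric.isOpen_iff.1 hU p hp
  have hcl : closure L ⊆ Set.Ici 0 := closure_minimal hL isClosed_Ici
  refine ⟨p, ε / 2, by linarith, ?_, fun x y hx hxy hy => ?_⟩
  · have : p - ε / 2 ∈ Metric.ball p ε := by
      rw [Metric.mem_ball, Real.dist_eq]
      rw [abs_lt]; constructor <;> linarith
    have := hcl (hUL (hball this))
    simpa using this
  · have hm : (x + y) / 2 ∈ closure L := hUL (hball (by
      rw [Metric.mem_ball, Real.dist_eq, abs_lt]; constructor <;> linarith))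
    obtain ⟨z, hz, hzL⟩ := mem_closure_iff.1 hm (Set.Ioo x y) isOpen_Ioo
      ⟨by linarith, by linarith⟩
    exact ⟨z, hzL, hz.1, hz.2⟩

/-- Finite cluster graphs are `L`-interval graphs.  The left ends are put at their exact places, and
density makes it possible to choose the right ends close enough to theirs. -/
theorem isIntervalGraphWithLengths_of_clusterAdj {V : Type*} [Finite V] {L : Set ℝ}
    (hL : ∀ x ∈ L, 0 ≤ x) (hdense : ∃ U : Set ℝ, IsOpen U ∧ U.Nonempty ∧ U ⊆ closure L)
    (c l r : V → ℕ) (G : SimpleGraph V) (hG : ∀ x y, x ≠ y → (G.Adj x y ↔ ClusterAdj c l r x y)) :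
    IsIntervalGraphWithLengths L G := by
  obtain ⟨a, δ, hδ, hδa, hLd⟩ := exists_dense_interval hL hdense
  obtain ⟨M, hM⟩ : ∃ M : ℕ, ∀ v, l v < M ∧ r v < M := by
    obtain ⟨M₁, h₁⟩ := (Set.finite_range l).bddAbove
    obtain ⟨M₂, h₂⟩ := (Set.finite_range r).bddAbove
    refine ⟨M₁ + M₂ + 1, fun v => ?_⟩
    have := h₁ (Set.mem_range_self v)
    have := h₂ (Set.mem_range_self v)
    omega
  have hM0 : (0 : ℝ) < M + 1 := by positivity
  set ε : ℝ := δ / (M + 1) with hε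
  have hεpos : 0 < ε := by positivity
  have hεM : ε * (M + 1) = δ := by rw [hε]; field_simp
  have key : ∀ v, ∃ z ∈ L, a + ((r v : ℝ) - 1 - l v) * ε < z ∧ z < a + ((r v : ℝ) - l v) * ε := by
    intro v
    have h₁ : (l v : ℝ) + 1 ≤ M := by exact_mod_cast (hM v).1
    have h₂ : (r v : ℝ) + 1 ≤ M := by exact_mod_cast (hM v).2
    have h₃ : (0 : ℝ) ≤ l v := Nat.cast_nonneg _
    have h₄ : (0 : ℝ) ≤ r v := Nat.cast_nonneg _
    refine hLd _ _ ?_ ?_ ?_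
    · nlinarith
    · nlinarith
    · nlinarith
  choose z hzL hz₁ hz₂ using key
  refine ⟨fun v => c v * a + l v * ε, fun v => c v * a + l v * ε + z v, fun v => ?_, ?_⟩
  · simpa using hzL v
  -- left ends are at `c * a + l * ε`, and right ends between `(c + 1) * a + (r - 1) * ε` and
  -- `(c + 1) * a + r * ε`
  have ha : 0 < a := by linarith
  have hl : ∀ v, (0 : ℝ) ≤ l v * ε ∧ l v * ε < a - ε := by
    intro v
    have h₁ : (l v : ℝ) + 1 ≤ M := by exact_mod_cast (hM v).1
    have h₃ : (0 : ℝ) ≤ l v := Nat.cast_nonneg _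
    constructor
    · positivity
    · nlinarith
  have hr : ∀ v, (0 : ℝ) ≤ r v * ε ∧ r v * ε < a := by
    intro v
    have h₁ : (r v : ℝ) + 1 ≤ M := by exact_mod_cast (hM v).2
    have h₃ : (0 : ℝ) ≤ r v := Nat.cast_nonneg _
    constructor
    · positivity
    · nlinarith
  have hzr : ∀ v, a + r v * ε - ε < l v * ε + z v ∧ l v * ε + z v < a + r v * ε := by
    intro v
    constructor
    · have := hz₁ v; linarith
    · have := hz₂ v; linarith
  -- the left end of `y` is smaller than the right end of `x`
  have hlt : ∀ x y, (c y * a + l y * ε < c x * a + l x * ε + z x) ↔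
      (c y ≤ c x ∨ (c y = c x + 1 ∧ l y < r x)) := by
    intro x y
    have hlx := hl x
    have hly := hl y
    have hrx := hr x
    have hzx := hzr x
    rcases le_or_gt (c y) (c x) with h | h
    · have h' : (c y : ℝ) ≤ c x := by exact_mod_cast h
      have := mul_le_mul_of_nonneg_right h' ha.le
      simp only [h, true_or, iff_true]
      linarith
    · rcases Nat.lt_or_ge (c x + 1) (c y) with h₂ | h₂
      · have h' : (c x : ℝ) + 2 ≤ c y := by exact_mod_cast h₂
        have := mul_le_mul_of_nonneg_right h' ha.le
        have e : ¬ (c y ≤ c x ∨ (c y = c x + 1 ∧ l y < r x)) := by omega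
        simp only [e, iff_false, not_lt]
        linarith
      · have e : c y = c x + 1 := by omega
        have e' : (c y : ℝ) = c x + 1 := by exact_mod_cast e
        rw [e', add_mul, one_mul]
        rcases lt_or_ge (l y) (r x) with h₃ | h₃
        · have h' : (l y : ℝ) + 1 ≤ r x := by exact_mod_cast h₃
          have := mul_le_mul_of_nonneg_right h' hεpos.le
          simp only [e, h₃, and_self, or_true, iff_true]
          linarith
        · have h' : (r x : ℝ) ≤ l y := by exact_mod_cast h₃
          have := mul_le_mul_of_nonneg_right h' hεpos.le
          have e : ¬ (c y ≤ c x ∨ (c y = c x + 1 ∧ l y < r x)) := by omega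
          simp only [e, iff_false, not_lt]
          linarith
  intro x y hxy
  simp only [hG x y hxy, Set.Ico_inter_Ico_nonempty, max_lt_iff, lt_min_iff, hlt, ClusterAdj]
  omega

/-! ### The graph of a circuit -/

open StackProg

/-- The families of vertices of the graph that describes a circuit.  Nodes of the circuit are
numbered from `0` to `n - 1`, and `n` is an additional conjunction gate which is fed by the output.
-/
inductive Fam
  /-- a leaf -/
  | leaf
  /-- the neighbour of the leaf, which is also adjacent to all left thresholds -/
  | hub
  /-- left thresholds, with which the left ends of the intervals of the middle cluster can be told
  apart -/
  | lthr
  /-- two copies of each node -/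
  | node
  /-- wires -/
  | wire
  /-- the wire from the output to the additional node -/
  | owire
  /-- marks of conjunction gates and of the additional node -/
  | cmark
  /-- marks of disjunction gates and of the additional node -/
  | dmark
  /-- right thresholds -/
  | rthr
  deriving DecidableEq

namespace Fam

/-- All families. -/
def all : List Fam := [leaf, hub, lthr, node, wire, owire, cmark, dmark, rthr]

theorem mem_all (f : Fam) : f ∈ all := by cases f <;> decide

/-- The number of the cluster. -/
def cluster : Fam → ℕ
  | leaf => 0
  | hub | lthr => 1
  | node | wire | owire | cmark | dmark => 2
  | rthr => 3

/-- The order of the left end of the vertex with indices `i` and `j`. -/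
def left : Fam → (n i j : ℕ) → ℕ
  | leaf, _, _, _ => 0
  | hub, _, _, _ => 0
  | lthr, _, _, _ => 1
  | node, _, i, _ => i + 1
  | wire, _, i, _ => i + 1
  | owire, _, i, _ => i + 1
  | cmark, _, _, _ => 0
  | dmark, n, _, _ => n + 2
  | rthr, _, i, _ => i

/-- The order of the right end of the vertex with indices `i` and `j`. -/
def right : Fam → (n i j : ℕ) → ℕ
  | leaf, _, _, _ => 1
  | hub, _, _, _ => 0
  | lthr, _, i, _ => i + 1
  | node, _, i, _ => i + 1
  | wire, _, _, j => j + 1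
  | owire, n, _, _ => n + 1
  | cmark, _, i, _ => i + 1
  | dmark, _, i, _ => i + 1
  | rthr, _, _, _ => 0

/-- The number of values of the first index. -/
def bound₁ : Fam → ℕ → ℕ
  | leaf, _ => 1
  | hub, _ => 1
  | lthr, n => n + 2
  | node, n => n + 1
  | wire, n => n
  | owire, n => n
  | cmark, n => n + 1
  | dmark, n => n + 1
  | rthr, n => n + 2

/-- The number of values of the second index. -/
def bound₂ : Fam → ℕ → ℕ
  | node, _ => 2
  | wire, n => n
  | _, _ => 1

/-- The row of the letter of the circuit that decides whether there is a vertex with indices `i` and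
`j`. -/
def row : Fam → (i j : ℕ) → ℕ
  | wire, _, j => j
  | _, i, _ => i

/-- The place in its row of the letter that decides whether there is a vertex with indices `i` and
`j`. -/
def col : Fam → (n i : ℕ) → ℕ
  | wire, _, i => i + 1
  | owire, n, _ => n + 1
  | _, _, _ => 0

end Fam

/-- The letters of circuits, as letters of the alphabet of the model checking problem, so that input
and output share one alphabet.  Only the fact that the letters stay different matters. -/
def encLetter : BoolCircuit.Letter ⊕ Unit → OutLetter
  | .inl (.inl .input) => Sum.inr .falsum
  | .inl (.inl .conj) => Sum.inr .eq
  | .inl (.inl .disj) => Sum.inr .adj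
  | .inl (.inl .neg) => Sum.inr .imp
  | .inl (.inr b) => Sum.inl (some b)
  | .inr _ => tick

/-- Whether the letter for a vertex of the given family is such that there is a vertex.  The
additional node has no letter. -/
def Fam.test : Fam → Option OutLetter → Bool
  | wire, o => o == some (Sum.inl (some true))
  | owire, o => o == some (Sum.inl (some true))
  | cmark, o => o == none || o == some (Sum.inr .eq)
  | dmark, o => o == none || o == some (Sum.inr .adj)
  | _, _ => true

/-- There is a vertex of family `f` with indices `i` and `j`. -/
def IsVert (n : ℕ) (x : List OutLetter) (p : Fam × ℕ × ℕ) : Prop :=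
  p.2.1 < p.1.bound₁ n ∧ p.2.2 < p.1.bound₂ n ∧
    p.1.test x[p.1.row p.2.1 p.2.2 * (n + 2) + p.1.col n p.2.1]? = true

instance (n : ℕ) (x : List OutLetter) : DecidablePred (IsVert n x) := fun _ =>
  inferInstanceAs (Decidable (_ ∧ _ ∧ _))

/-- The list of all vertices of the graph of a circuit. -/
def verts (n : ℕ) (x : List OutLetter) : List (Fam × ℕ × ℕ) :=
  Fam.all.flatMap fun f => (List.range (n + 2)).flatMap fun i => (List.range (n + 2)).flatMap fun j
      =>
    if IsVert n x (f, i, j) then [(f, i, j)] else []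

theorem mem_verts {n : ℕ} {x : List OutLetter} {p : Fam × ℕ × ℕ} :
    p ∈ verts n x ↔ IsVert n x p := by
  obtain ⟨f, i, j⟩ := p
  simp only [verts, List.mem_flatMap, List.mem_range]
  constructor
  · rintro ⟨f', -, i', -, j', -, h⟩
    split_ifs at h with h'
    · rw [List.mem_singleton] at h
      rwa [h]
    · simp at h
  · intro h
    refine ⟨f, Fam.mem_all f, i, ?_, j, ?_, ?_⟩
    · refine lt_of_lt_of_le h.1 ?_
      cases f <;> simp [Fam.bound₁]
    · refine lt_of_lt_of_le h.2.1 ?_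
      cases f <;> simp [Fam.bound₂]
    · rw [if_pos h]
      simp

theorem nodup_verts (n : ℕ) (x : List OutLetter) : (verts n x).Nodup := by
  have hif : ∀ q : Fam × ℕ × ℕ, (if IsVert n x q then [q] else []).Nodup := by
    intro q; split_ifs <;> simp
  have hmem : ∀ q p : Fam × ℕ × ℕ, p ∈ (if IsVert n x q then [q] else []) → p = q := by
    intro q p h
    split_ifs at h
    · simpa using h
    · simp at h
  refine List.nodup_flatMap.2 ⟨fun f _ => List.nodup_flatMap.2 ⟨fun i _ => List.nodup_flatMap.2
    ⟨fun j _ => hif _, ?_⟩, ?_⟩, ?_⟩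
  · refine List.nodup_range.imp fun {a b} hab => ?_
    intro p hp hp'
    have e := (hmem _ _ hp).symm.trans (hmem _ _ hp')
    simp only [Prod.mk.injEq, true_and] at e
    exact hab e
  · refine List.nodup_range.imp fun {a b} hab => ?_
    intro p hp hp'
    simp only [List.mem_flatMap] at hp hp'
    obtain ⟨_, -, hp⟩ := hp
    obtain ⟨_, -, hp'⟩ := hp'
    have e := (hmem _ _ hp).symm.trans (hmem _ _ hp')
    simp only [Prod.mk.injEq, true_and] at e
    exact hab e.1
  · have : Fam.all.Nodup := by decide
    refine this.imp fun {a b} hab => ?_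
    intro p hp hp'
    simp only [List.mem_flatMap] at hp hp'
    obtain ⟨_, -, _, -, hp⟩ := hp
    obtain ⟨_, -, _, -, hp'⟩ := hp'
    have e := (hmem _ _ hp).symm.trans (hmem _ _ hp')
    simp only [Prod.mk.injEq] at e
    exact hab e.1

/-- Adjacency of two vertices of the graph of a circuit. -/
def VertAdj (n : ℕ) (p q : Fam × ℕ × ℕ) : Prop :=
  p ≠ q ∧ ClusterAdj (fun p => p.1.cluster) (fun p => p.1.left n p.2.1 p.2.2)
    (fun p => p.1.right n p.2.1 p.2.2) p q

instance (n : ℕ) (p q : Fam × ℕ × ℕ) : Decidable (VertAdj n p q) :=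
  inferInstanceAs (Decidable (_ ∧ (_ ∨ (_ ∧ _) ∨ (_ ∧ _))))

theorem VertAdj.symm {n : ℕ} {p q : Fam × ℕ × ℕ} (h : VertAdj n p q) : VertAdj n q p := by
  obtain ⟨h, h'⟩ := h
  refine ⟨h.symm, ?_⟩
  rcases h' with h' | h' | h'
  · exact Or.inl h'.symm
  · exact Or.inr (Or.inr h')
  · exact Or.inr (Or.inl h')

/-- The graph of a circuit that is given by its string. -/
def vertGraph (n : ℕ) (x : List OutLetter) : SimpleGraph (Fin (verts n x).length) where
  Adj a b := VertAdj n (verts n x)[a] (verts n x)[b]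
  symm := ⟨fun _ _ h => h.symm⟩
  loopless := ⟨fun _ h => h.1 rfl⟩

theorem isIntervalGraphWithLengths_vertGraph {L : Set ℝ} (hL : ∀ x ∈ L, 0 ≤ x)
    (hdense : ∃ U : Set ℝ, IsOpen U ∧ U.Nonempty ∧ U ⊆ closure L) (n : ℕ) (x : List OutLetter) :
    IsIntervalGraphWithLengths L (vertGraph n x) := by
  refine isIntervalGraphWithLengths_of_clusterAdj hL hdense
    (fun a => (verts n x)[a].1.cluster)
    (fun a => (verts n x)[a].1.left n (verts n x)[a].2.1 (verts n x)[a].2.2)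
    (fun a => (verts n x)[a].1.right n (verts n x)[a].2.1 (verts n x)[a].2.2) _ fun a b hab => ?_
  have : (verts n x)[a] ≠ (verts n x)[b] := by
    intro h
    exact hab (Fin.ext ((nodup_verts n x).getElem_inj_iff.1 h))
  exact and_iff_right this

theorem List.ofFn_apply_getElem {α β : Type*} (l : List α) (f : α → β) :
    List.ofFn (fun a : Fin l.length => f l[a]) = l.map f := by
  conv_rhs => rw [← List.ofFn_getElem (xs := l), List.map_ofFn]
  rfl

theorem graphCode_vertGraph (n : ℕ) (x : List OutLetter) : graphCode (vertGraph n x) =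
    (verts n x).flatMap fun p => (verts n x).map (fun q => some (decide (VertAdj n p q))) ++ [none]
        := by
  have hrow : ∀ a : Fin (verts n x).length, adjRow (vertGraph n x) a =
      (verts n x).map (fun q => some (decide (VertAdj n (verts n x)[a] q))) ++ [none] := by
    intro a
    rw [adjRow]
    congr 1
    rw [← List.ofFn_apply_getElem]
    congr 1
    funext b
    simp only [vertGraph]
    congr
  rw [graphCode, concatRows, funext hrow, List.flatMap, ← List.ofFn_apply_getElem]

namespace Fam

theorem val_cons (c : Fin 8) (r : ℕ) (v : Fin 8 → ℕ) : CtrExpr.val ([c], r) v = v c + r := by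
  simp [CtrExpr.val]

theorem val_nil (r : ℕ) (v : Fin 8 → ℕ) : CtrExpr.val ([], r) v = r := by
  simp [CtrExpr.val]

theorem exists_left (f : Fam) (i j : Fin 8) :
    ∃ E : CtrExpr, ∀ v, E.val v = f.left (v 0) (v i) (v j) := by
  cases f
  exacts [⟨([], 0), by simp [val_nil, left]⟩, ⟨([], 0), by simp [val_nil, left]⟩,
    ⟨([], 1), by simp [val_nil, left]⟩, ⟨([i], 1), by simp [val_cons, left]⟩,
    ⟨([i], 1), by simp [val_cons, left]⟩, ⟨([i], 1), by simp [val_cons, left]⟩,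
    ⟨([], 0), by simp [val_nil, left]⟩, ⟨([0], 2), by simp [val_cons, left]⟩,
    ⟨([i], 0), by simp [val_cons, left]⟩]

theorem exists_right (f : Fam) (i j : Fin 8) :
    ∃ E : CtrExpr, ∀ v, E.val v = f.right (v 0) (v i) (v j) := by
  cases f
  exacts [⟨([], 1), by simp [val_nil, right]⟩, ⟨([], 0), by simp [val_nil, right]⟩,
    ⟨([i], 1), by simp [val_cons, right]⟩, ⟨([i], 1), by simp [val_cons, right]⟩,
    ⟨([j], 1), by simp [val_cons, right]⟩, ⟨([0], 1), by simp [val_cons, right]⟩,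
    ⟨([i], 1), by simp [val_cons, right]⟩, ⟨([i], 1), by simp [val_cons, right]⟩,
    ⟨([], 0), by simp [val_nil, right]⟩]

theorem exists_bound₁ (f : Fam) : ∃ E : CtrExpr, ∀ v, E.val v = f.bound₁ (v 0) := by
  cases f
  exacts [⟨([], 1), by simp [val_nil, bound₁]⟩, ⟨([], 1), by simp [val_nil, bound₁]⟩,
    ⟨([0], 2), by simp [val_cons, bound₁]⟩, ⟨([0], 1), by simp [val_cons, bound₁]⟩,
    ⟨([0], 0), by simp [val_cons, bound₁]⟩, ⟨([0], 0), by simp [val_cons, bound₁]⟩,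
    ⟨([0], 1), by simp [val_cons, bound₁]⟩, ⟨([0], 1), by simp [val_cons, bound₁]⟩,
    ⟨([0], 2), by simp [val_cons, bound₁]⟩]

theorem exists_bound₂ (f : Fam) : ∃ E : CtrExpr, ∀ v, E.val v = f.bound₂ (v 0) := by
  cases f
  case node => exact ⟨([], 2), by simp [val_nil, bound₂]⟩
  case wire => exact ⟨([0], 0), by simp [val_cons, bound₂]⟩
  all_goals exact ⟨([], 1), by simp [val_nil, bound₂]⟩

theorem exists_row (f : Fam) (i j : Fin 8) : ∃ E : CtrExpr, ∀ v, E.val v = f.row (v i) (v j) := by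
  cases f
  case wire => exact ⟨([j], 0), by simp [val_cons, row]⟩
  all_goals exact ⟨([i], 0), by simp [val_cons, row]⟩

theorem exists_col (f : Fam) (i : Fin 8) : ∃ E : CtrExpr, ∀ v, E.val v = f.col (v 0) (v i) := by
  cases f
  case wire => exact ⟨([i], 1), by simp [val_cons, col]⟩
  case owire => exact ⟨([0], 1), by simp [val_cons, col]⟩
  all_goals exact ⟨([], 0), by simp [val_nil, col]⟩

end Fam

namespace StackProg

theorem Printable.ite_isVert {d : ℕ} {e : (Fin 8 → ℕ) → List OutLetter → List OutLetter} (f : Fam)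
    (i j : Fin 8) (h : Printable d e) :
    Printable d fun v x => if IsVert (v 0) x (f, v i, v j) then e v x else [] := by
  obtain ⟨B₁, hB₁⟩ := f.exists_bound₁
  obtain ⟨B₂, hB₂⟩ := f.exists_bound₂
  obtain ⟨R, hR⟩ := f.exists_row i j
  obtain ⟨C, hC⟩ := f.exists_col i
  have h₁ := ((h.ite_letter R ([0], 2) C f.test (printable_nil d)).ite_lt ([j], 0) B₂
    (printable_nil d)).ite_lt ([i], 0) B₁ (printable_nil d)
  refine h₁.congr fun v x => ?_
  simp only [hB₁, hB₂, hR, hC, Fam.val_cons, add_zero]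
  by_cases hv : IsVert (v 0) x (f, v i, v j)
  · rw [if_pos hv, if_pos hv.1, if_pos hv.2.1, if_pos hv.2.2]
  · rw [if_neg hv]
    split_ifs with a b c
    · exact absurd ⟨a, b, c⟩ hv
    all_goals rfl

theorem Printable.flatMap_list {d : ℕ} {α : Type*} (l : List α)
    {e : α → (Fin 8 → ℕ) → List OutLetter → List OutLetter} (h : ∀ a, Printable d (e a)) :
    Printable d fun v x => l.flatMap fun a => e a v x := by
  induction l with
  | nil => exact printable_nil d
  | cons a l ih => exact (h a).append ih

/-- Loops over all vertices can be carried out. -/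
theorem Printable.flatMap_verts {d : ℕ} (hd : 2 ≤ d) (hd' : d + 1 < 8)
    {e : (Fin 8 → ℕ) → List OutLetter → Fam × ℕ × ℕ → List OutLetter}
    {e' : Fam → (Fin 8 → ℕ) → List OutLetter → List OutLetter}
    (h : ∀ f, Printable (d + 2) (e' f))
    (he : ∀ f v x i j,
      e' f (update (update v ⟨d, by omega⟩ i) ⟨d + 1, hd'⟩ j) x = e v x (f, i, j)) :
    Printable d fun v x => (verts (v 0) x).flatMap (e v x) := by
  have h₁ : ∀ f, Printable d _ := fun f => (((h f).ite_isVert f ⟨d, by omega⟩ ⟨d + 1,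
      hd'⟩).flatMap_range
    hd' ([0], 2)).flatMap_range (by omega) ([0], 2)
  refine (Printable.flatMap_list Fam.all h₁).congr fun v x => ?_
  have h0 : (0 : Fin 8) ≠ ⟨d, by omega⟩ := by
    intro h; have := congrArg Fin.val h; simp at this; omega
  have h0' : (0 : Fin 8) ≠ ⟨d + 1, hd'⟩ := by
    intro h; have := congrArg Fin.val h; simp at this
  have h1 : (⟨d, by omega⟩ : Fin 8) ≠ ⟨d + 1, hd'⟩ := by
    intro h; have := congrArg Fin.val h; simp at this
  simp only [he, Fam.val_cons, update_of_ne h0, update_of_ne h0', update_self, update_of_ne h1,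
      verts,
    List.flatMap_assoc]
  congr 1
  funext f
  congr 1
  funext i
  congr 1
  funext j
  split_ifs <;> simp

theorem printable_vertAdj (d : ℕ) (f g : Fam) (i j i' j' : Fin 8) :
    Printable d fun v _ =>
      [Sum.inl (some (decide (VertAdj (v 0) (f, v i, v j) (g, v i', v j'))))] := by
  have hconst : ∀ b : Bool, Printable d fun _ _ => [Sum.inl (some b)] :=
    fun b => printable_letter d _
  obtain ⟨Lf, hLf⟩ := f.exists_left i j
  obtain ⟨Rf, hRf⟩ := f.exists_right i j
  obtain ⟨Lg, hLg⟩ := g.exists_left i' j'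
  obtain ⟨Rg, hRg⟩ := g.exists_right i' j'
  by_cases hfg : f = g
  · subst hfg
    refine (Printable.ite_lt ([i], 0) ([i'], 0) (hconst true) (.ite_lt ([i'], 0) ([i], 0) (hconst
        true)
      (.ite_lt ([j], 0) ([j'], 0) (hconst true) (.ite_lt ([j'], 0) ([j], 0) (hconst true)
      (hconst false))))).congr fun v x => ?_
    simp only [Fam.val_cons, add_zero]
    split_ifs with h₁ h₂ h₃ h₄ <;> simp [VertAdj, ClusterAdj] <;> omega
  · by_cases hc : f.cluster = g.cluster
    · refine (hconst true).congr fun v x => ?_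
      simp [VertAdj, ClusterAdj, hfg, hc]
    · by_cases hc₁ : g.cluster = f.cluster + 1
      · refine (Printable.ite_lt Lg Rf (hconst true) (hconst false)).congr fun v x => ?_
        simp only [hLg, hRf]
        split_ifs with h <;> simp [VertAdj, ClusterAdj, hfg, hc₁, h]
        omega
      · by_cases hc₂ : f.cluster = g.cluster + 1
        · refine (Printable.ite_lt Lf Rg (hconst true) (hconst false)).congr fun v x => ?_
          simp only [hLf, hRg]
          split_ifs with h <;> simp [VertAdj, ClusterAdj, hfg, hc₂, h]
          omega
        · refine (hconst false).congr fun v x => ?_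
          simp [VertAdj, ClusterAdj, hc, hc₁, hc₂]

theorem printable_graphCode :
    Printable 2 fun v x => (graphCode (vertGraph (v 0) x)).map Sum.inl := by
  have h₁ : ∀ f, Printable 4 fun v x => (verts (v 0) x).flatMap fun q =>
      [Sum.inl (some (decide (VertAdj (v 0) (f, v 2, v 3) q)))] := by
    intro f
    refine Printable.flatMap_verts (by norm_num) (by norm_num)
      (fun g => printable_vertAdj _ f g 2 3 4 5) fun g v x i j => ?_
    have e₄ : (⟨4, by norm_num⟩ : Fin 8) = 4 := rfl
    have e₅ : (⟨4 + 1, by norm_num⟩ : Fin 8) = 5 := rfl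
    rw [e₄, e₅]
    simp
  refine (Printable.flatMap_verts (d := 2) (by norm_num) (by norm_num)
    (e := fun v x p => ((verts (v 0) x).flatMap fun q =>
      [Sum.inl (some (decide (VertAdj (v 0) p q)))]) ++ [Sum.inl none])
    (fun f => (h₁ f).append (printable_letter _ (Sum.inl none))) fun g v x i j => ?_).congr
      fun v x => ?_
  · have e₂ : (⟨2, by norm_num⟩ : Fin 8) = 2 := rfl
    have e₃ : (⟨2 + 1, by norm_num⟩ : Fin 8) = 3 := rfl
    rw [e₂, e₃]
    simp
  · rw [graphCode_vertGraph, List.map_flatMap]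
    congr 1
    funext p
    rw [List.map_append, List.map_map, ← List.flatMap_pure_eq_map]
    rfl

end StackProg

/-! ### The first-order sentence -/

/-- First-order formulas in the language of graphs with `n` free variables. -/
abbrev GraphFormula (n : ℕ) : Type := FirstOrder.Language.graph.BoundedFormula Empty n

namespace GraphFormula

variable {n : ℕ}

/-- The formula `x ~ y`. -/
def adj (x y : Fin n) : GraphFormula n :=
  .rel FirstOrder.Language.adj ![.var (Sum.inr x), .var (Sum.inr y)]

/-- The formula `x = y`. -/
def eq (x y : Fin n) : GraphFormula n :=
  .equal (.var (Sum.inr x)) (.var (Sum.inr y))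

/-- `x` and `y` have the same neighbours among the neighbours of the hub `h`. -/
def sameLeft (h x y : Fin n) : GraphFormula n :=
  .all ((adj h.castSucc (Fin.last n)).imp
    ((adj x.castSucc (Fin.last n)).iff (adj y.castSucc (Fin.last n))))

/-- `x` and `y` have the same neighbours, except for the neighbours of the hub `h`, and `x` and `y`
themselves. -/
def sameRight (h x y : Fin n) : GraphFormula n :=
  .all ((adj h.castSucc (Fin.last n)).not.imp ((eq (Fin.last n) x.castSucc).not.imp
    ((eq (Fin.last n) y.castSucc).not.imp
      ((adj x.castSucc (Fin.last n)).iff (adj y.castSucc (Fin.last n))))))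

/-- `x` represents a node: there is another vertex with the same left and right neighbours. -/
def node (h x : Fin n) : GraphFormula n :=
  .ex ((eq (Fin.last n) x.castSucc).not ⊓ (sameLeft h.castSucc x.castSucc (Fin.last n) ⊓
    sameRight h.castSucc x.castSucc (Fin.last n)))

/-- There is a wire from the node `u` to the node `v`. -/
def wire (h u v : Fin n) : GraphFormula n :=
  .ex ((node h.castSucc (Fin.last n)).not ⊓ (sameLeft h.castSucc (Fin.last n) u.castSucc ⊓
    sameRight h.castSucc (Fin.last n) v.castSucc))

/-- The node `v` is marked by a vertex that is adjacent to all neighbours of the hub `h`, except for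
the leaf `s`. -/
def cmark (s h v : Fin n) : GraphFormula n :=
  .ex (.all ((adj h.castSucc.castSucc (Fin.last _)).imp
    ((eq (Fin.last _) s.castSucc.castSucc).not.imp (adj (Fin.last n).castSucc (Fin.last _)))) ⊓
    sameRight h.castSucc (Fin.last n) v.castSucc)

/-- The node `v` is marked by a vertex that is adjacent to no neighbour of the hub `h`. -/
def dmark (h v : Fin n) : GraphFormula n :=
  .ex (.all ((adj h.castSucc.castSucc (Fin.last _)).imp
      (adj (Fin.last n).castSucc (Fin.last _)).not)
    ⊓ sameRight h.castSucc (Fin.last n) v.castSucc)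

/-- `y` is one of the vertices `X i`. -/
def mem {k : ℕ} (X : Fin k → Fin n) (y : Fin n) : GraphFormula n :=
  (List.finRange k).foldr (fun i φ => (eq y (X i)).not.imp φ) ⊥

/-- The node `v` is true when the true input nodes are the `X i`, as far as can be told by going
back fewer than `d` wires in the circuit.  A node without a mark is an input node, which is true if
it is one of the `X i`, or a negation gate, which is true if the node before it is false. -/
def val {k : ℕ} : (d : ℕ) → {n : ℕ} → (s h : Fin n) → (X : Fin k → Fin n) → (v : Fin n) →
    GraphFormula n
  | 0, _, _, _, _, _ => ⊥
  | d + 1, n, s, h, X, v =>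
    ((cmark s h v).imp (.all ((node h.castSucc (Fin.last n)).imp
      ((wire h.castSucc (Fin.last n) v.castSucc).imp
        (val d s.castSucc h.castSucc (fun i => (X i).castSucc) (Fin.last n)))))) ⊓
    ((cmark s h v).not.imp
      (((dmark h v).imp (.ex (node h.castSucc (Fin.last n) ⊓
        (wire h.castSucc (Fin.last n) v.castSucc ⊓
          val d s.castSucc h.castSucc (fun i => (X i).castSucc) (Fin.last n))))) ⊓
      ((dmark h v).not.imp
        ((FirstOrder.Language.BoundedFormula.ex (mem (fun i => (X i).castSucc) (Fin.last n) ⊓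
          sameRight h.castSucc v.castSucc (Fin.last n))).not.imp
        (.ex (node h.castSucc (Fin.last n) ⊓
        (wire h.castSucc (Fin.last n) v.castSucc ⊓
          (val d s.castSucc h.castSucc (fun i => (X i).castSucc) (Fin.last n)).not)))))))

/-- `v` represents an input node. -/
def input (s h v : Fin n) : GraphFormula n :=
  node h v ⊓ ((cmark s h v).not ⊓ ((dmark h v).not ⊓
    .all ((node h.castSucc (Fin.last n)).imp (wire h.castSucc (Fin.last n) v.castSucc).not)))

/-- The vertex `s` has at most one neighbour. -/
def leaf (s : Fin n) : GraphFormula n :=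
  .all (.all ((adj s.castSucc.castSucc (Fin.last n).castSucc).imp
    ((adj s.castSucc.castSucc (Fin.last _)).imp (eq (Fin.last n).castSucc (Fin.last _)))))

/-- `x` and `y` represent different nodes. -/
def differ (h x y : Fin n) : GraphFormula n :=
  .all (.all ((eq (Fin.last n).castSucc x.castSucc.castSucc).imp
    ((eq (Fin.last _) y.castSucc.castSucc).imp
      (sameRight h.castSucc.castSucc (Fin.last n).castSucc (Fin.last _)).not)))

/-- The pairs of different numbers below `k`. -/
def pairs (k : ℕ) : List (Fin k × Fin k) :=
  (List.finRange k).flatMap fun i => (List.finRange k).flatMap fun j =>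
    if i < j then [(i, j)] else []

/-- The additional node is false, when the true input nodes are the `X i`. -/
def refuted {k : ℕ} (d : ℕ) (s h : Fin n) (X : Fin k → Fin n) : GraphFormula n :=
  .all ((node h.castSucc (Fin.last n)).imp ((cmark s.castSucc h.castSucc (Fin.last n)).imp
    ((dmark h.castSucc (Fin.last n)).imp
      (val d s.castSucc h.castSucc (fun i => (X i).castSucc) (Fin.last n)).not)))

/-- The vertices `X i` do not represent different input nodes that make the output true. -/
def body {k : ℕ} (d : ℕ) (s h : Fin n) (X : Fin k → Fin n) : GraphFormula n :=
  (leaf s).imp ((adj s h).imp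
    ((FirstOrder.Language.BoundedFormula.all ((mem (fun i => (X i).castSucc) (Fin.last n)).imp
      (input s.castSucc h.castSucc (Fin.last n)))).imp
      ((pairs k).foldr (fun p φ => (differ h (X p.1) (X p.2)).imp φ) (refuted d s h X))))

/-- The sentence that says that the circuit accepts some set of `k` input nodes, if it has depth at
most `d - 2`.  It is the negation of a universal closure. -/
def sentence (d k : ℕ) : FirstOrder.Language.graph.Sentence :=
  (body (n := k + 2) d 0 1 fun i => i.addNat 2).alls.not

end GraphFormula

namespace StackProg

open GraphFormula

/-- A formula that depends on the counter with number 1 is printable. -/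
def FormulaPrintable (d : ℕ) (N : ℕ → ℕ) (φ : ∀ k, GraphFormula (N k)) : Prop :=
  Printable d fun v _ => (formulaCode (φ (v 1))).map Sum.inr

/-- The index of a variable that depends on the counter with number 1 is given by an expression in
the counters. -/
def HasExpr (f : ℕ → ℕ) : Prop := ∃ E : CtrExpr, ∀ v, E.val v = f (v 1)

theorem HasExpr.succ {f : ℕ → ℕ} (h : HasExpr f) : HasExpr fun k => f k + 1 := by
  obtain ⟨E, h⟩ := h
  exact ⟨(E.1, E.2 + 1), fun v => congrArg (· + 1) (h v)⟩

theorem flatMap_singleton_const {α β : Type*} (l : List α) (b : β) :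
    l.flatMap (fun _ => [b]) = List.replicate l.length b := by
  induction l with
  | nil => rfl
  | cons a l ih => simp [ih, List.replicate_succ]

theorem printable_varCode {d : ℕ} (hd : d < 8) (E : CtrExpr) :
    Printable d fun v _ => (varCode (E.val v)).map Sum.inr := by
  refine ((Printable.flatMap_range hd E (printable_letter _ tick)).append
    (printable_letter d (Sum.inr .comma))).congr fun v x => ?_
  have : (List.range (E.val v)).flatMap (fun _ => [tick]) = List.replicate (E.val v) tick := by
    rw [flatMap_singleton_const, List.length_range]
  rw [this, varCode, List.map_append, List.map_replicate]
  rfl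

variable {d : ℕ} {N : ℕ → ℕ}

theorem FormulaPrintable.eq {x y : ∀ k, Fin (N k)} (hd : d < 8) (hx : HasExpr fun k => x k)
    (hy : HasExpr fun k => y k) : FormulaPrintable d N fun k => .eq (x k) (y k) := by
  obtain ⟨E, hE⟩ := hx
  obtain ⟨E', hE'⟩ := hy
  refine (((printable_varCode hd E).append (printable_varCode hd E')).cons (Sum.inr .eq)).congr
    fun v _ => ?_
  simp [GraphFormula.eq, formulaCode, termCode, hE, hE']

theorem FormulaPrintable.adj {x y : ∀ k, Fin (N k)} (hd : d < 8) (hx : HasExpr fun k => x k)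
    (hy : HasExpr fun k => y k) : FormulaPrintable d N fun k => .adj (x k) (y k) := by
  obtain ⟨E, hE⟩ := hx
  obtain ⟨E', hE'⟩ := hy
  refine (((printable_varCode hd E).append (printable_varCode hd E')).cons (Sum.inr .adj)).congr
    fun v _ => ?_
  simp [GraphFormula.adj, formulaCode, termCode, hE, hE', concatRows]

theorem FormulaPrintable.bot : FormulaPrintable d N fun _ => ⊥ :=
  printable_letter d (Sum.inr .falsum)

theorem FormulaPrintable.imp {φ ψ : ∀ k, GraphFormula (N k)} (hφ : FormulaPrintable d N φ)
    (hψ : FormulaPrintable d N ψ) : FormulaPrintable d N fun k => (φ k).imp (ψ k) := by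
  refine ((Printable.append hφ hψ).cons (Sum.inr .imp)).congr fun v _ => ?_
  simp [formulaCode]

theorem FormulaPrintable.all {φ : ∀ k, GraphFormula (N k + 1)}
    (hφ : FormulaPrintable d (fun k => N k + 1) φ) : FormulaPrintable d N fun k => (φ k).all :=
  Printable.cons (Sum.inr .all) hφ

theorem FormulaPrintable.not {φ : ∀ k, GraphFormula (N k)} (hφ : FormulaPrintable d N φ) :
    FormulaPrintable d N fun k => (φ k).not := hφ.imp .bot

theorem FormulaPrintable.ex {φ : ∀ k, GraphFormula (N k + 1)}
    (hφ : FormulaPrintable d (fun k => N k + 1) φ) : FormulaPrintable d N fun k => (φ k).ex :=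
  (FormulaPrintable.all hφ.not).not

theorem FormulaPrintable.inf {φ ψ : ∀ k, GraphFormula (N k)} (hφ : FormulaPrintable d N φ)
    (hψ : FormulaPrintable d N ψ) : FormulaPrintable d N fun k => φ k ⊓ ψ k :=
  (hφ.imp hψ.not).not

theorem FormulaPrintable.iff {φ ψ : ∀ k, GraphFormula (N k)} (hφ : FormulaPrintable d N φ)
    (hψ : FormulaPrintable d N ψ) : FormulaPrintable d N fun k => (φ k).iff (ψ k) :=
  (hφ.imp hψ).inf (hψ.imp hφ)

theorem FormulaPrintable.sameLeft {h x y : ∀ k, Fin (N k)} (hd : d < 8)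
    (hN : HasExpr N) (hh : HasExpr fun k => h k) (hx : HasExpr fun k => x k)
    (hy : HasExpr fun k => y k) : FormulaPrintable d N fun k => .sameLeft (h k) (x k) (y k) :=
  .all (.imp (.adj hd hh hN) (.iff (.adj hd hx hN) (.adj hd hy hN)))

theorem FormulaPrintable.sameRight {h x y : ∀ k, Fin (N k)} (hd : d < 8)
    (hN : HasExpr N) (hh : HasExpr fun k => h k) (hx : HasExpr fun k => x k)
    (hy : HasExpr fun k => y k) : FormulaPrintable d N fun k => .sameRight (h k) (x k) (y k) :=
  .all (.imp (.not (.adj hd hh hN)) (.imp (.not (.eq hd hN hx)) (.imp (.not (.eq hd hN hy))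
    (.iff (.adj hd hx hN) (.adj hd hy hN)))))

theorem FormulaPrintable.node {h x : ∀ k, Fin (N k)} (hd : d < 8)
    (hN : HasExpr N) (hh : HasExpr fun k => h k) (hx : HasExpr fun k => x k) :
    FormulaPrintable d N fun k => .node (h k) (x k) :=
  .ex (.inf (.not (.eq hd hN hx)) (.inf (.sameLeft hd hN.succ hh hx hN)
    (.sameRight hd hN.succ hh hx hN)))

theorem FormulaPrintable.wire {h u v : ∀ k, Fin (N k)} (hd : d < 8)
    (hN : HasExpr N) (hh : HasExpr fun k => h k) (hu : HasExpr fun k => u k)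
    (hv : HasExpr fun k => v k) : FormulaPrintable d N fun k => .wire (h k) (u k) (v k) :=
  .ex (.inf (.not (.node hd hN.succ hh hN)) (.inf (.sameLeft hd hN.succ hh hN hu)
    (.sameRight hd hN.succ hh hN hv)))

theorem FormulaPrintable.cmark {s h v : ∀ k, Fin (N k)} (hd : d < 8)
    (hN : HasExpr N) (hs : HasExpr fun k => s k) (hh : HasExpr fun k => h k)
    (hv : HasExpr fun k => v k) : FormulaPrintable d N fun k => .cmark (s k) (h k) (v k) :=
  .ex (.inf (.all (.imp (.adj hd hh hN.succ) (.imp (.not (.eq hd hN.succ hs))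
    (.adj hd hN hN.succ)))) (.sameRight hd hN.succ hh hN hv))

theorem FormulaPrintable.dmark {h v : ∀ k, Fin (N k)} (hd : d < 8)
    (hN : HasExpr N) (hh : HasExpr fun k => h k)
    (hv : HasExpr fun k => v k) : FormulaPrintable d N fun k => .dmark (h k) (v k) :=
  .ex (.inf (.all (.imp (.adj hd hh hN.succ) (.not (.adj hd hN hN.succ))))
    (.sameRight hd hN.succ hh hN hv))

theorem formulaCode_foldr_imp {α : Type*} {n : ℕ} (A : α → GraphFormula n) (ψ : GraphFormula n)
    (l : List α) : formulaCode (l.foldr (fun a φ => (A a).imp φ) ψ) =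
      l.flatMap (fun a => .imp :: formulaCode (A a)) ++ formulaCode ψ := by
  induction l with
  | nil => rfl
  | cons a l ih => simp [formulaCode, ih]

theorem flatMap_finRange {α : Type*} (k : ℕ) (F : ℕ → List α) :
    (List.finRange k).flatMap (fun i : Fin k => F i) = (List.range k).flatMap F := by
  have : List.range k = (List.finRange k).map Fin.val := by simp
  rw [this, List.flatMap_map]

/-- The disjunction over the variables that come after the first two ones is printed in a loop. -/
theorem FormulaPrintable.mem {X : ∀ k, Fin k → Fin (N k)} {y : ∀ k, Fin (N k)} (hd : d < 7)
    (hd' : 2 ≤ d) (hX : ∀ k i, (X k i : ℕ) = i + 2) (hy : HasExpr fun k => y k) :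
    FormulaPrintable d N fun k => .mem (X k) (y k) := by
  obtain ⟨f, hf⟩ : ∃ f : ℕ → ℕ, ∀ k, (y k : ℕ) = f k := ⟨_, fun _ => rfl⟩
  obtain ⟨E, hE⟩ := hy
  simp only [hf] at hE
  have h₁ : Printable (d + 1) _ := ((printable_const (d + 1)
    (([.imp, .imp, .eq] : List FOLetter).map Sum.inr)).append ((printable_varCode
      (by omega) E).append (printable_varCode (by omega) ([⟨d, by omega⟩], 2)))).append
        (printable_letter (d + 1) (Sum.inr .falsum))
  refine ((h₁.flatMap_range (by omega) ([1], 0)).append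
    (printable_letter d (Sum.inr .falsum))).congr fun v x => ?_
  have h1 : (1 : Fin 8) ≠ ⟨d, by omega⟩ := by
    intro h; have := congrArg Fin.val h; simp at this; omega
  change _ = List.map _ (formulaCode (List.foldr _ _ _))
  rw [formulaCode_foldr_imp, List.map_append, List.map_flatMap]
  simp only [GraphFormula.eq, formulaCode, termCode, hX, hE, hf, update_of_ne h1, Fam.val_cons,
    add_zero, update_self]
  rw [flatMap_finRange (v 1) fun i => List.map Sum.inr (FOLetter.imp :: FOLetter.imp ::
    (FOLetter.eq :: (varCode (f (v 1)) ++ varCode (i + 2)) ++ [FOLetter.falsum]))]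
  simp

theorem FormulaPrintable.val {X : ∀ k, Fin k → Fin (N k)} {s h v : ∀ k, Fin (N k)} (hd : d < 7)
    (hd' : 2 ≤ d) (hN : HasExpr N) (hX : ∀ k i, (X k i : ℕ) = i + 2) (hs : HasExpr fun k => s k)
    (hh : HasExpr fun k => h k) (hv : HasExpr fun k => v k) (r : ℕ) :
    FormulaPrintable d N fun k => .val r (s k) (h k) (X k) (v k) := by
  induction r generalizing N with
  | zero => exact .bot
  | succ r ih =>
    have hd₁ : d < 8 := by omega
    have h₁ : FormulaPrintable d (fun k => N k + 1) fun k => GraphFormula.val r (s k).castSucc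
      (h k).castSucc (fun i => (X k i).castSucc) (Fin.last (N k)) := ih hN.succ hX hs hh hN
    have hn : FormulaPrintable d (fun k => N k + 1) fun k => .node (h k).castSucc (Fin.last (N k))
        :=
      .node hd₁ hN.succ hh hN
    have hw : FormulaPrintable d (fun k => N k + 1) fun k => .wire (h k).castSucc (Fin.last (N k))
      (v k).castSucc := .wire hd₁ hN.succ hh hN hv
    have hc : FormulaPrintable d N fun k => .cmark (s k) (h k) (v k) := .cmark hd₁ hN hs hh hv
    have hm : FormulaPrintable d N fun k => .dmark (h k) (v k) := .dmark hd₁ hN hh hv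
    exact .inf (.imp hc (.all (.imp hn (.imp hw h₁)))) (.imp hc.not (.inf
      (.imp hm (.ex (.inf hn (.inf hw h₁)))) (.imp hm.not (.imp (.not (.ex (.inf
        (.mem hd hd' hX hN) (.sameRight hd₁ hN.succ hh hv hN)))) (.ex (.inf hn (.inf hw
            h₁.not)))))))

theorem FormulaPrintable.input {s h v : ∀ k, Fin (N k)} (hd : d < 8)
    (hN : HasExpr N) (hs : HasExpr fun k => s k) (hh : HasExpr fun k => h k)
    (hv : HasExpr fun k => v k) : FormulaPrintable d N fun k => .input (s k) (h k) (v k) :=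
  .inf (.node hd hN hh hv) (.inf (.not (.cmark hd hN hs hh hv)) (.inf (.not (.dmark hd hN hh hv))
    (.all (.imp (.node hd hN.succ hh hN) (.not (.wire hd hN.succ hh hN hv))))))

theorem FormulaPrintable.leaf {s : ∀ k, Fin (N k)} (hd : d < 8)
    (hN : HasExpr N) (hs : HasExpr fun k => s k) : FormulaPrintable d N fun k => .leaf (s k) :=
  .all (.all (.imp (.adj hd hs hN) (.imp (.adj hd hs hN.succ) (.eq hd hN hN.succ))))

theorem FormulaPrintable.refuted {X : ∀ k, Fin k → Fin (N k)} {s h : ∀ k, Fin (N k)} (hd : d < 7)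
    (hd' : 2 ≤ d) (hN : HasExpr N) (hX : ∀ k i, (X k i : ℕ) = i + 2) (hs : HasExpr fun k => s k)
    (hh : HasExpr fun k => h k) (r : ℕ) :
    FormulaPrintable d N fun k => .refuted r (s k) (h k) (X k) :=
  have hd₁ : d < 8 := by omega
  .all (.imp (.node hd₁ hN.succ hh hN) (.imp (.cmark hd₁ hN.succ hs hh hN)
    (.imp (.dmark hd₁ hN.succ hh hN) (.not (.val hd hd' hN.succ hX hs hh hN r)))))

theorem formulaCode_alls {n : ℕ} (φ : GraphFormula n) :
    formulaCode φ.alls = List.replicate n .all ++ formulaCode φ := by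
  induction n with
  | zero => rfl
  | succ n ih =>
    rw [FirstOrder.Language.BoundedFormula.alls, ih, formulaCode, List.replicate_succ']
    simp

theorem hasExpr_const (r : ℕ) : HasExpr fun _ => r := ⟨([], r), fun _ => Fam.val_nil _ _⟩

theorem hasExpr_add (r : ℕ) : HasExpr fun k => k + r := ⟨([1], r), fun _ => Fam.val_cons _ _ _⟩

/-- The part of the sentence that says that the nodes are different is printed in a double loop. -/
theorem printable_pairs (h : ∀ k : ℕ, Fin (k + 2)) (hh : HasExpr fun k => h k) :
    Printable 2 fun v _ => ((pairs (v 1)).flatMap fun p => FOLetter.imp ::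
      formulaCode (differ (h (v 1)) (p.1.addNat 2) (p.2.addNat 2))).map Sum.inr := by
  have hs : FormulaPrintable 4 (fun k => k + 2 + 1 + 1) fun k =>
      (GraphFormula.sameRight (h k).castSucc.castSucc (Fin.last (k + 2)).castSucc (Fin.last _)).not
          :=
    .not (.sameRight (by norm_num) (hasExpr_add 4) hh (hasExpr_add 2) (hasExpr_add 3))
  have h₁ : Printable 4 _ := ((printable_const 4 (([.imp, .all, .all, .imp, .eq] :
    List FOLetter).map Sum.inr)).append ((printable_varCode (by norm_num) ([1], 2)).append
      (printable_varCode (by norm_num) ([2], 2)))).append (((printable_const 4 (([.imp, .eq] :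
        List FOLetter).map Sum.inr)).append ((printable_varCode (by norm_num) ([1], 3)).append
          (printable_varCode (by norm_num) ([3], 2)))).append hs)
  refine (((h₁.ite_lt ([2], 0) ([3], 0) (printable_nil 4)).flatMap_range (by norm_num)
    ([1], 0)).flatMap_range (by norm_num) ([1], 0)).congr fun v x => ?_
  have h₂ : ∀ k (i j : Fin k), formulaCode (differ (h k) (i.addNat 2) (j.addNat 2)) =
      [.all, .all, .imp, .eq] ++ (varCode (k + 2) ++ varCode (i + 2)) ++ ([.imp, .eq] ++
        (varCode (k + 3) ++ varCode (j + 2)) ++ formulaCode (GraphFormula.sameRight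
          (h k).castSucc.castSucc (Fin.last (k + 2)).castSucc (Fin.last _)).not) := by
    intro k i j
    simp [differ, formulaCode, GraphFormula.eq, termCode]
  rw [pairs, List.flatMap_assoc, List.map_flatMap]
  simp only [List.flatMap_assoc, List.map_flatMap, Fam.val_cons, Fin.reduceFinMk, update_self,
    Fin.isValue, ne_eq, Fin.reduceEq, not_false_eq_true, update_of_ne, add_zero, h₂]
  rw [← flatMap_finRange]
  congr 1
  funext i
  rw [← flatMap_finRange]
  congr 1
  funext j
  have e : update (update v 2 (i : ℕ)) 3 (j : ℕ) 1 = v 1 := by simp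
  simp only [Fin.val_fin_lt]
  rw [e]
  split_ifs <;> simp

/-- The sentence can be printed when the depth of the circuits is fixed. -/
theorem printable_sentence (r : ℕ) :
    Printable 2 fun v _ => (formulaCode (sentence r (v 1))).map Sum.inr := by
  have hN : HasExpr fun k => k + 2 := hasExpr_add 2
  have hs : HasExpr fun k => ((0 : Fin (k + 2)) : ℕ) := hasExpr_const 0
  have hh : HasExpr fun k => ((1 : Fin (k + 2)) : ℕ) := hasExpr_const 1
  have h₁ : FormulaPrintable 2 (fun k => k + 2) fun k => .leaf (0 : Fin (k + 2)) :=
    .leaf (by norm_num) hN hs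
  have h₂ : FormulaPrintable 2 (fun k => k + 2) fun k => .adj (0 : Fin (k + 2)) 1 :=
    .adj (by norm_num) hs hh
  have h₃ : FormulaPrintable 2 (fun k => k + 2) fun k => FirstOrder.Language.BoundedFormula.all
      ((GraphFormula.mem (fun i => (i.addNat 2).castSucc) (Fin.last (k + 2))).imp
        (GraphFormula.input (0 : Fin (k + 2)).castSucc (1 : Fin (k + 2)).castSucc (Fin.last (k +
            2)))) :=
    .all (.imp (.mem (by norm_num) le_rfl (fun _ _ => rfl) hN)
      (.input (by norm_num) hN.succ hs hh hN))
  have h₄ : FormulaPrintable 2 (fun k => k + 2) fun k =>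
      .refuted r (0 : Fin (k + 2)) 1 fun i => i.addNat 2 :=
    .refuted (by norm_num) le_rfl hN (fun _ _ => rfl) hs hh r
  have h₅ : Printable 2 fun v _ => (List.replicate (v 1 + 2) FOLetter.all).map Sum.inr := by
    refine ((printable_letter 3 (Sum.inr .all)).flatMap_range (by norm_num) ([1], 2)).congr
      fun v x => ?_
    rw [flatMap_singleton_const, List.length_range, List.map_replicate, Fam.val_cons]
  refine ((h₅.append ((h₁.append ((h₂.append ((h₃.append ((printable_pairs (fun _ => 1) hh).append
    h₄)).cons (Sum.inr .imp))).cons (Sum.inr .imp))).cons (Sum.inr .imp))).append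
      (printable_letter 2 (Sum.inr .falsum))).cons (Sum.inr .imp) |>.congr fun v x => ?_
  change _ = List.map Sum.inr (FOLetter.imp :: (formulaCode (body (n := v 1 + 2) r 0 1
    fun i => i.addNat 2).alls ++ [FOLetter.falsum]))
  rw [formulaCode_alls, body]
  simp only [formulaCode, formulaCode_foldr_imp (fun p : Fin (v 1) × Fin (v 1) =>
    differ (1 : Fin (v 1 + 2)) (p.1.addNat 2) (p.2.addNat 2))]
  simp

end StackProg

/-! ### The meaning of the formulas -/

namespace GraphFormula

variable {V : Type*} {G : SimpleGraph V} {n : ℕ}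

/-- The formula `φ` is true in the graph `G` when its free variables have the values `xs`. -/
def Sat (G : SimpleGraph V) (φ : GraphFormula n) (xs : Fin n → V) : Prop :=
  @FirstOrder.Language.BoundedFormula.Realize _ V G.structure _ _ φ default xs

section Sat

variable {φ ψ : GraphFormula n} {θ : GraphFormula (n + 1)} {xs : Fin n → V} {x y h s u v : Fin n}

@[simp]
theorem sat_imp : Sat G (φ.imp ψ) xs ↔ (Sat G φ xs → Sat G ψ xs) := Iff.rfl

@[simp]
theorem sat_bot : ¬ Sat G (⊥ : GraphFormula n) xs := id

@[simp]
theorem sat_not : Sat G φ.not xs ↔ ¬ Sat G φ xs := Iff.rfl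

@[simp]
theorem sat_inf : Sat G (φ ⊓ ψ) xs ↔ Sat G φ xs ∧ Sat G ψ xs :=
  @FirstOrder.Language.BoundedFormula.realize_inf _ V G.structure _ _ _ _ _ _

@[simp]
theorem sat_iff : Sat G (φ.iff ψ) xs ↔ (Sat G φ xs ↔ Sat G ψ xs) :=
  @FirstOrder.Language.BoundedFormula.realize_iff _ V G.structure _ _ _ _ _ _

@[simp]
theorem sat_all : Sat G θ.all xs ↔ ∀ a, Sat G θ (Fin.snoc xs a) := Iff.rfl

@[simp]
theorem sat_ex : Sat G θ.ex xs ↔ ∃ a, Sat G θ (Fin.snoc xs a) :=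
  @FirstOrder.Language.BoundedFormula.realize_ex _ V G.structure _ _ _ _ _

@[simp]
theorem sat_eq : Sat G (eq x y) xs ↔ xs x = xs y := Iff.rfl

@[simp]
theorem sat_adj : Sat G (adj x y) xs ↔ G.Adj (xs x) (xs y) := Iff.rfl

/-- `x` and `y` have the same neighbours among the neighbours of `h`. -/
def SameLeft (G : SimpleGraph V) (h x y : V) : Prop :=
  ∀ z, G.Adj h z → (G.Adj x z ↔ G.Adj y z)

/-- `x` and `y` have the same neighbours, except for the neighbours of `h`, and `x` and `y`
themselves. -/
def SameRight (G : SimpleGraph V) (h x y : V) : Prop :=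
  ∀ z, ¬ G.Adj h z → z ≠ x → z ≠ y → (G.Adj x z ↔ G.Adj y z)

@[simp]
theorem sat_sameLeft : Sat G (sameLeft h x y) xs ↔ SameLeft G (xs h) (xs x) (xs y) := by
  simp [sameLeft, SameLeft]

@[simp]
theorem sat_sameRight : Sat G (sameRight h x y) xs ↔ SameRight G (xs h) (xs x) (xs y) := by
  simp [sameRight, SameRight]

@[simp]
theorem sat_node : Sat G (node h x) xs ↔
    ∃ y, y ≠ xs x ∧ SameLeft G (xs h) (xs x) y ∧ SameRight G (xs h) (xs x) y := by
  simp [node]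

@[simp]
theorem sat_wire : Sat G (wire h u v) xs ↔
    ∃ e, (¬ ∃ y, y ≠ e ∧ SameLeft G (xs h) e y ∧ SameRight G (xs h) e y) ∧
      SameLeft G (xs h) e (xs u) ∧ SameRight G (xs h) e (xs v) := by
  simp [wire]

@[simp]
theorem sat_cmark : Sat G (cmark s h v) xs ↔
    ∃ e, (∀ z, G.Adj (xs h) z → z ≠ xs s → G.Adj e z) ∧ SameRight G (xs h) e (xs v) := by
  simp [cmark]

@[simp]
theorem sat_dmark : Sat G (dmark h v) xs ↔
    ∃ e, (∀ z, G.Adj (xs h) z → ¬ G.Adj e z) ∧ SameRight G (xs h) e (xs v) := by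
  simp [dmark]

@[simp]
theorem sat_foldr_imp {α : Type*} (A : α → GraphFormula n) (l : List α) :
    Sat G (l.foldr (fun a φ => (A a).imp φ) ψ) xs ↔ ((∀ a ∈ l, Sat G (A a) xs) → Sat G ψ xs) := by
  induction l with
  | nil => simp
  | cons a l ih => simp [ih]

@[simp]
theorem sat_mem {k : ℕ} {X : Fin k → Fin n} : Sat G (mem X y) xs ↔ ∃ i, xs y = xs (X i) := by
  rw [mem, sat_foldr_imp fun i => (eq y (X i)).not]
  simp

@[simp]
theorem sat_leaf : Sat G (leaf s) xs ↔ ∀ y z, G.Adj (xs s) y → G.Adj (xs s) z → y = z := by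
  simp [leaf]

@[simp]
theorem sat_differ : Sat G (differ h x y) xs ↔ ¬ SameRight G (xs h) (xs x) (xs y) := by
  simp [differ]

theorem sat_alls {m : ℕ} {φ : GraphFormula m} :
    @FirstOrder.Language.Sentence.Realize _ V G.structure φ.alls ↔ ∀ xs, Sat G φ xs :=
  @FirstOrder.Language.BoundedFormula.realize_alls _ V G.structure _ _ _ _

theorem mem_pairs {k : ℕ} {p : Fin k × Fin k} : p ∈ pairs k ↔ p.1 < p.2 := by
  obtain ⟨i, j⟩ := p
  simp only [pairs, List.mem_flatMap, List.mem_finRange, true_and]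
  constructor
  · rintro ⟨a, b, h⟩
    split_ifs at h with hab
    · simp at h; simpa [h] using hab
    · simp at h
  · intro h
    exact ⟨i, j, by simpa using h⟩

end Sat

end GraphFormula

/-! ### The graph of a circuit, seen by formulas -/

open GraphFormula

/-- The vertices of the graph of a circuit. -/
abbrev Vert (n : ℕ) (x : List OutLetter) : Type := {p : Fam × ℕ × ℕ // IsVert n x p}

/-- The graph of a circuit, on its own set of vertices. -/
def circuitGraph (n : ℕ) (x : List OutLetter) : SimpleGraph (Vert n x) where
  Adj a b := VertAdj n a.1 b.1
  symm := ⟨fun _ _ h => h.symm⟩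
  loopless := ⟨fun _ h => h.1 rfl⟩

/-- The graph on `Vert n x` and its copy on `Fin` satisfy the same sentences. -/
theorem vertGraph_realize {n : ℕ} {x : List OutLetter} (φ : FirstOrder.Language.graph.Sentence) :
    @FirstOrder.Language.Sentence.Realize _ _ (vertGraph n x).structure φ ↔
      @FirstOrder.Language.Sentence.Realize _ _ (circuitGraph n x).structure φ := by
  have hb : Bijective fun a : Fin (verts n x).length =>
      (⟨(verts n x)[a], mem_verts.1 (List.getElem_mem _)⟩ : Vert n x) := by
    constructor
    · intro a b h
      exact Fin.ext ((nodup_verts n x).getElem_inj_iff.1 (congrArg Subtype.val h))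
    · rintro ⟨p, hp⟩
      obtain ⟨i, hi, rfl⟩ := List.mem_iff_getElem.1 (mem_verts.2 hp)
      exact ⟨⟨i, hi⟩, rfl⟩
  let := (vertGraph n x).structure
  let := (circuitGraph n x).structure
  let e : FirstOrder.Language.graph.Equiv (Fin (verts n x).length) (Vert n x) :=
    { Equiv.ofBijective _ hb with
      map_fun' := fun f => isEmptyElim f
      map_rel' := by
        intro m r xs
        cases r
        rfl }
  exact FirstOrder.Language.StrongHomClass.realize_sentence e φ

namespace Vert

variable {n : ℕ} {x : List OutLetter} {a b h s : Vert n x}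

/-- The leaf. -/
def leaf (n : ℕ) (x : List OutLetter) : Vert n x :=
  ⟨(.leaf, 0, 0), by simp [IsVert, Fam.bound₁, Fam.bound₂, Fam.test]⟩

/-- The neighbour of the leaf. -/
def hub (n : ℕ) (x : List OutLetter) : Vert n x :=
  ⟨(.hub, 0, 0), by simp [IsVert, Fam.bound₁, Fam.bound₂, Fam.test]⟩

/-- The left threshold with index `i`. -/
def lthr (x : List OutLetter) {i : ℕ} (hi : i < n + 2) : Vert n x :=
  ⟨(.lthr, i, 0), by simpa [IsVert, Fam.bound₁, Fam.bound₂, Fam.test]⟩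

/-- The right threshold with index `i`. -/
def rthr (x : List OutLetter) {i : ℕ} (hi : i < n + 2) : Vert n x :=
  ⟨(.rthr, i, 0), by simpa [IsVert, Fam.bound₁, Fam.bound₂, Fam.test]⟩

/-- The copy `j` of the node `i`. -/
def node (x : List OutLetter) {i j : ℕ} (hi : i < n + 1) (hj : j < 2) : Vert n x :=
  ⟨(.node, i, j), hi, hj, rfl⟩

/-- The number of the cluster of a vertex. -/
def cluster (a : Vert n x) : ℕ := a.1.1.cluster

/-- The order of the left end of a vertex. -/
def left (a : Vert n x) : ℕ := a.1.1.left n a.1.2.1 a.1.2.2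

/-- The order of the right end of a vertex. -/
def right (a : Vert n x) : ℕ := a.1.1.right n a.1.2.1 a.1.2.2

theorem adj_iff : (circuitGraph n x).Adj a b ↔ a ≠ b ∧ (a.cluster = b.cluster ∨
    (b.cluster = a.cluster + 1 ∧ b.left < a.right) ∨
      (a.cluster = b.cluster + 1 ∧ a.left < b.right)) := by
  rw [Ne, Subtype.ext_iff]
  rfl

theorem eq_leaf (ha : a.cluster = 0) : a = leaf n x := by
  obtain ⟨⟨f, i, j⟩, hp⟩ := a
  have h₁ := hp.1
  have h₂ := hp.2.1
  cases f <;> simp [cluster, Fam.cluster, leaf, Subtype.ext_iff, Fam.bound₁,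
    Fam.bound₂] at ha h₁ h₂ ⊢
  exact ⟨h₁, h₂⟩

theorem eq_hub_or (ha : a.cluster = 1) : a = hub n x ∨ ∃ i, ∃ hi : i < n + 2, a = lthr x hi := by
  obtain ⟨⟨f, i, j⟩, hp⟩ := a
  have h₁ := hp.1
  have h₂ := hp.2.1
  cases f <;> simp [cluster, Fam.cluster, hub, lthr, Subtype.ext_iff, Fam.bound₁,
    Fam.bound₂] at ha h₁ h₂ ⊢
  · exact ⟨h₁, h₂⟩
  · exact ⟨h₁, h₂⟩

theorem eq_rthr (ha : a.cluster = 3) : ∃ i, ∃ hi : i < n + 2, a = rthr x hi := by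
  obtain ⟨⟨f, i, j⟩, hp⟩ := a
  have h₁ := hp.1
  have h₂ := hp.2.1
  cases f <;> simp [cluster, Fam.cluster, rthr, Subtype.ext_iff, Fam.bound₁,
    Fam.bound₂] at ha h₁ h₂ ⊢
  exact ⟨h₁, h₂⟩

theorem cluster_le (a : Vert n x) : a.cluster ≤ 3 := by
  obtain ⟨⟨f, i, j⟩, hp⟩ := a
  cases f <;> simp [cluster, Fam.cluster]

theorem left_le (ha : a.cluster = 2) : a.left ≤ n + 2 := by
  obtain ⟨⟨f, i, j⟩, hp⟩ := a
  have h₁ := hp.1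
  cases f <;> simp [cluster, Fam.cluster, left, Fam.left, Fam.bound₁] at ha h₁ ⊢ <;> omega

theorem right_le (ha : a.cluster = 2) : a.right ≤ n + 1 := by
  obtain ⟨⟨f, i, j⟩, hp⟩ := a
  have h₁ := hp.1
  have h₂ := hp.2.1
  cases f <;> simp [cluster, Fam.cluster, right, Fam.right, Fam.bound₁, Fam.bound₂] at ha h₁ h₂ ⊢
    <;> omega

theorem right_pos (ha : a.cluster = 2) : 0 < a.right := by
  obtain ⟨⟨f, i, j⟩, hp⟩ := a
  cases f <;> simp [cluster, Fam.cluster, right, Fam.right] at ha ⊢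

theorem cluster_leaf : (leaf n x).cluster = 0 := rfl
theorem right_leaf : (leaf n x).right = 1 := rfl
theorem cluster_hub : (hub n x).cluster = 1 := rfl
theorem right_hub : (hub n x).right = 0 := rfl
theorem cluster_lthr {i : ℕ} (hi : i < n + 2) : (lthr x hi).cluster = 1 := rfl
theorem left_lthr {i : ℕ} (hi : i < n + 2) : (lthr x hi).left = 1 := rfl
theorem right_lthr {i : ℕ} (hi : i < n + 2) : (lthr x hi).right = i + 1 := rfl
theorem cluster_rthr {i : ℕ} (hi : i < n + 2) : (rthr x hi).cluster = 3 := rfl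
theorem left_rthr {i : ℕ} (hi : i < n + 2) : (rthr x hi).left = i := rfl
theorem cluster_node {i j : ℕ} (hi : i < n + 1) (hj : j < 2) : (node x hi hj).cluster = 2 := rfl

theorem hub_ne_lthr {i : ℕ} (hi : i < n + 2) : hub n x ≠ lthr x hi := by
  simp [hub, lthr, Subtype.ext_iff]

theorem lthr_inj {i j : ℕ} {hi : i < n + 2} {hj : j < n + 2} : lthr x hi = lthr x hj ↔ i = j := by
  simp [lthr, Subtype.ext_iff]

theorem rthr_inj {i j : ℕ} {hi : i < n + 2} {hj : j < n + 2} : rthr x hi = rthr x hj ↔ i = j := by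
  simp [rthr, Subtype.ext_iff]

theorem ne_of_cluster_ne (h : a.cluster ≠ b.cluster) : a ≠ b := fun e => h (congrArg _ e)

theorem adj_lthr_iff (ha : a.cluster = 2) {i : ℕ} (hi : i < n + 2) :
    (circuitGraph n x).Adj a (lthr x hi) ↔ a.left ≤ i := by
  rw [adj_iff]
  have : a ≠ lthr x hi := ne_of_cluster_ne (by rw [ha, cluster_lthr]; decide)
  simp only [ha, cluster_lthr, right_lthr]
  simp [this]

theorem adj_rthr_iff (ha : a.cluster = 2) {i : ℕ} (hi : i < n + 2) :
    (circuitGraph n x).Adj a (rthr x hi) ↔ i < a.right := by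
  rw [adj_iff]
  have : a ≠ rthr x hi := ne_of_cluster_ne (by rw [ha, cluster_rthr]; decide)
  simp only [ha, cluster_rthr, left_rthr]
  simp [this]

theorem adj_of_cluster_eq (h : a.cluster = b.cluster) : (circuitGraph n x).Adj a b ↔ a ≠ b := by
  rw [adj_iff, and_iff_left (Or.inl h)]

theorem not_adj_of_cluster (h : a.cluster + 2 ≤ b.cluster) : ¬ (circuitGraph n x).Adj a b := by
  rw [adj_iff]
  rintro ⟨-, h' | h' | h'⟩ <;> omega

theorem adj_comm : (circuitGraph n x).Adj a b ↔ (circuitGraph n x).Adj b a :=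
  (circuitGraph n x).adj_comm a b

theorem adj_hub_leaf : (circuitGraph n x).Adj (hub n x) (leaf n x) := by
  rw [adj_iff]
  exact ⟨ne_of_cluster_ne Nat.one_ne_zero, Or.inr (Or.inr ⟨rfl, Nat.one_pos⟩)⟩

theorem adj_hub_lthr {i : ℕ} (hi : i < n + 2) : (circuitGraph n x).Adj (hub n x) (lthr x hi) :=
  (adj_of_cluster_eq (a := hub n x) (b := lthr x hi) rfl).2 (hub_ne_lthr hi)

theorem adj_lthr_lthr {i j : ℕ} (hi : i < n + 2) (hj : j < n + 2) :
    (circuitGraph n x).Adj (lthr x hi) (lthr x hj) ↔ i ≠ j := by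
  rw [adj_of_cluster_eq (by rw [cluster_lthr, cluster_lthr]), Ne, lthr_inj]

theorem adj_rthr_rthr {i j : ℕ} (hi : i < n + 2) (hj : j < n + 2) :
    (circuitGraph n x).Adj (rthr x hi) (rthr x hj) ↔ i ≠ j := by
  rw [adj_of_cluster_eq (by rw [cluster_rthr, cluster_rthr]), Ne, rthr_inj]

theorem adj_leaf_iff : (circuitGraph n x).Adj (leaf n x) a ↔ a = hub n x := by
  constructor
  · intro h
    obtain ⟨hne, h | ⟨h, h'⟩ | ⟨h, h'⟩⟩ := adj_iff.1 h
    · exact absurd (eq_leaf h.symm).symm hne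
    · obtain rfl | ⟨i, hi, rfl⟩ := eq_hub_or h
      · rfl
      · simp [left_lthr, right_leaf] at h'
    · simp [cluster_leaf] at h
  · rintro rfl
    exact adj_hub_leaf.symm

theorem adj_hub_iff : (circuitGraph n x).Adj (hub n x) a ↔
    a = leaf n x ∨ ∃ i, ∃ hi : i < n + 2, a = lthr x hi := by
  constructor
  · intro h
    obtain ⟨hne, h | ⟨h, h'⟩ | ⟨h, h'⟩⟩ := adj_iff.1 h
    · obtain rfl | h := eq_hub_or h.symm
      · exact absurd rfl hne
      · exact Or.inr h
    · simp [right_hub] at h'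
    · exact Or.inl (eq_leaf (by simpa [cluster_hub] using h.symm))
  · rintro (rfl | ⟨i, hi, rfl⟩)
    · exact adj_hub_leaf
    · exact adj_hub_lthr hi

theorem not_adj_hub (ha : 2 ≤ a.cluster) : ¬ (circuitGraph n x).Adj (hub n x) a := by
  intro h
  obtain rfl | ⟨i, hi, rfl⟩ := adj_hub_iff.1 h
  · simp [cluster_leaf] at ha
  · simp [cluster_lthr] at ha

/-- The left thresholds tell the left ends of the middle cluster apart. -/
theorem sameLeft_iff (ha : a.cluster = 2) (hb : b.cluster = 2) :
    SameLeft (circuitGraph n x) (hub n x) a b ↔ a.left = b.left := by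
  constructor
  · intro h
    have hla := left_le ha
    have hlb := left_le hb
    have key : ∀ i, i < n + 2 → (a.left ≤ i ↔ b.left ≤ i) := by
      intro i hi
      rw [← adj_lthr_iff ha hi, ← adj_lthr_iff hb hi]
      exact h _ (adj_hub_lthr hi)
    by_contra hne
    rcases Nat.lt_or_gt_of_ne hne with hlt | hlt
    · have := key a.left (by omega); omega
    · have := key b.left (by omega); omega
  · intro h z hz
    obtain rfl | ⟨i, hi, rfl⟩ := adj_hub_iff.1 hz
    · rw [adj_comm, iff_false_left (not_adj_of_cluster (by rw [ha, cluster_leaf])), adj_comm]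
      exact not_adj_of_cluster (by rw [hb, cluster_leaf])
    · rw [adj_lthr_iff ha, adj_lthr_iff hb, h]

theorem _root_.GraphFormula.SameRight.symm {V : Type*} {G : SimpleGraph V} {h x y : V}
    (H : SameRight G h x y) : SameRight G h y x := fun z h₁ h₂ h₃ => (H z h₁ h₃ h₂).symm

theorem _root_.GraphFormula.SameLeft.symm {V : Type*} {G : SimpleGraph V} {h x y : V}
    (H : SameLeft G h x y) : SameLeft G h y x := fun z h₁ => (H z h₁).symm

/-- The right thresholds tell the right ends of the middle cluster apart, and they tell the middle
cluster apart from the others. -/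
theorem sameRight_iff (hb : b.cluster = 2) : SameRight (circuitGraph n x) (hub n x) a b ↔
    a.cluster = 2 ∧ a.right = b.right := by
  have hrb := right_le hb
  have hpb := right_pos hb
  constructor
  · intro h
    have hrthr : ∀ {i : ℕ} (hi : i < n + 2), a ≠ rthr x hi →
        ((circuitGraph n x).Adj a (rthr x hi) ↔ i < b.right) := by
      intro i hi hne
      rw [← adj_rthr_iff hb hi]
      exact h _ (not_adj_hub (by rw [cluster_rthr]; decide)) hne.symm
        (ne_of_cluster_ne (by rw [hb, cluster_rthr]; decide))
    have hca : a.cluster = 2 := by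
      by_contra hca
      by_cases h3 : a.cluster = 3
      · -- the last right threshold is adjacent to the other right thresholds, but not to `b`
        obtain ⟨j, hj, rfl⟩ := eq_rthr h3
        by_cases hjn : j = n + 1
        · subst hjn
          have hne : ∃ c : Vert n x, c.cluster = 2 ∧ c ≠ b := by
            by_cases hc : node x (i := 0) (j := 0) (by omega) (by omega) = b
            · refine ⟨node x (i := 0) (j := 1) (by omega) (by omega), rfl, fun hc' => ?_⟩
              have := hc.trans hc'.symm
              simp [node, Subtype.ext_iff] at this
            · exact ⟨_, rfl, hc⟩
          obtain ⟨c, hc, hcb⟩ := hne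
          have := h c (not_adj_hub (by omega)) (ne_of_cluster_ne (by omega)) hcb
          rw [adj_of_cluster_eq (hb.trans hc.symm), adj_comm, adj_rthr_iff hc] at this
          have hrc := right_le hc
          have := this.2 hcb.symm
          omega
        · have := (hrthr (i := n + 1) (by omega) (by rwa [Ne, rthr_inj])).1
            ((adj_rthr_rthr hj _).2 hjn)
          omega
      · have hne : a ≠ rthr x (i := 0) (by omega) := ne_of_cluster_ne (by rwa [cluster_rthr])
        have hcl := cluster_le a
        exact not_adj_of_cluster (by rw [cluster_rthr]; omega) ((hrthr (by omega) hne).2 hpb)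
    refine ⟨hca, ?_⟩
    have hra := right_le hca
    have key : ∀ i, i < n + 2 → (i < a.right ↔ i < b.right) := by
      intro i hi
      rw [← adj_rthr_iff hca hi]
      exact hrthr hi (ne_of_cluster_ne (by rw [hca, cluster_rthr]; decide))
    by_contra hne
    rcases Nat.lt_or_gt_of_ne hne with hlt | hlt
    · have := key a.right (by omega); omega
    · have := key b.right (by omega); omega
  · rintro ⟨ha, hr⟩ z hz hza hzb
    have hcz := cluster_le z
    obtain h0 | h1 | h2 | h3 : z.cluster = 0 ∨ z.cluster = 1 ∨ z.cluster = 2 ∨ z.cluster = 3 := by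
      omega
    · exact absurd (adj_hub_iff.2 (Or.inl (eq_leaf h0))) hz
    · obtain rfl | h' := eq_hub_or h1
      · rw [adj_comm, iff_false_left (not_adj_hub (by omega)), adj_comm]
        exact not_adj_hub (by omega)
      · exact absurd (adj_hub_iff.2 (Or.inr h')) hz
    · rw [adj_of_cluster_eq (ha.trans h2.symm), adj_of_cluster_eq (hb.trans h2.symm)]
      exact iff_of_true hza.symm hzb.symm
    · obtain ⟨i, hi, rfl⟩ := eq_rthr h3
      rw [adj_rthr_iff ha, adj_rthr_iff hb, hr]

/-- Vertices outside the middle cluster can be told apart. -/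
theorem cluster_eq_of_same (hne : b ≠ a) (hl : SameLeft (circuitGraph n x) (hub n x) a b)
    (hr : SameRight (circuitGraph n x) (hub n x) a b) : a.cluster = 2 := by
  by_contra ha
  have hb : b.cluster ≠ 2 := fun hb => ha ((sameRight_iff hb).1 hr).1
  have hcb := cluster_le b
  have hca := cluster_le a
  have hrthr : ∀ {a b : Vert n x}, b ≠ a → b.cluster ≠ 2 →
      SameRight (circuitGraph n x) (hub n x) a b → a.cluster ≠ 3 := by
    intro a b hne hb hr ha
    have hcb := cluster_le b
    obtain ⟨i, hi, rfl⟩ := eq_rthr ha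
    by_cases h3 : b.cluster = 3
    · obtain ⟨j, hj, rfl⟩ := eq_rthr h3
      rw [Ne, rthr_inj] at hne
      have key : ∀ m (hm : m < n + 1), (i < m + 1 ↔ j < m + 1) := by
        intro m hm
        have := hr (node x (j := 0) hm (by omega)) (not_adj_hub le_rfl)
          (ne_of_cluster_ne (by rw [cluster_node, cluster_rthr]; decide))
          (ne_of_cluster_ne (by rw [cluster_node, cluster_rthr]; decide))
        rwa [adj_comm, adj_rthr_iff rfl, adj_comm, adj_rthr_iff rfl] at this
      rcases Nat.lt_or_gt_of_ne hne with hlt | hlt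
      · have := key j (by omega); omega
      · have := key i (by omega); omega
    · have hm : ∃ m, ∃ hm : m < n + 2, m ≠ i := by
        by_cases h0 : i = 0
        · exact ⟨1, by omega, by omega⟩
        · exact ⟨0, by omega, Ne.symm h0⟩
      obtain ⟨m, hm, hmi⟩ := hm
      have hmi' : rthr x hm ≠ rthr x hi := by rwa [Ne, rthr_inj]
      have := hr (rthr x hm) (not_adj_hub (by rw [cluster_rthr]; decide)) hmi'
        (ne_of_cluster_ne (by rw [cluster_rthr]; omega))
      exact not_adj_of_cluster (by rw [cluster_rthr]; omega)
        (this.1 ((adj_rthr_rthr hi hm).2 hmi.symm))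
  have ha3 := hrthr hne hb hr
  have hb3 := hrthr hne.symm ha hr.symm
  have hnl : ∀ {i : ℕ} (hi : i < n + 2), ¬ (circuitGraph n x).Adj (leaf n x) (lthr x hi) := by
    intro i hi h
    exact hub_ne_lthr hi (adj_leaf_iff.1 h).symm
  -- the leaf is adjacent to no neighbour of the hub, and the hub is adjacent to all of them
  have hleaf : ∀ {a b : Vert n x}, b ≠ a → b.cluster < 2 →
      SameLeft (circuitGraph n x) (hub n x) a b → a ≠ leaf n x := by
    rintro a b hne hb hl rfl
    obtain h0 | h1 : b.cluster = 0 ∨ b.cluster = 1 := by omega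
    · exact hne (eq_leaf h0)
    · obtain rfl | ⟨i, hi, rfl⟩ := eq_hub_or h1
      · exact (circuitGraph n x).loopless.irrefl _ ((hl _ adj_hub_leaf).2 adj_hub_leaf)
      · have hm : ∃ m, ∃ hm : m < n + 2, i ≠ m := by
          by_cases h0 : i = 0
          · exact ⟨1, by omega, by omega⟩
          · exact ⟨0, by omega, h0⟩
        obtain ⟨m, hm, him⟩ := hm
        exact hnl hm ((hl _ (adj_hub_lthr hm)).2 ((adj_lthr_lthr hi hm).2 him))
  have ha0 := hleaf hne (by omega) hl
  have hb0 := hleaf hne.symm (by omega) hl.symm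
  have hnl' : ∀ {i : ℕ} (hi : i < n + 2), ¬ (circuitGraph n x).Adj (lthr x hi) (leaf n x) :=
    fun hi h => hnl hi h.symm
  have ha1 : a.cluster = 1 := by
    by_contra h1; exact ha0 (eq_leaf (by omega))
  have hb1 : b.cluster = 1 := by
    by_contra h1; exact hb0 (eq_leaf (by omega))
  obtain rfl | ⟨i, hi, rfl⟩ := eq_hub_or ha1
  · obtain rfl | ⟨j, hj, rfl⟩ := eq_hub_or hb1
    · exact hne rfl
    · exact hnl' hj ((hl _ adj_hub_leaf).1 adj_hub_leaf)
  · obtain rfl | ⟨j, hj, rfl⟩ := eq_hub_or hb1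
    · exact hnl' hi ((hl _ adj_hub_leaf).2 adj_hub_leaf)
    · exact (circuitGraph n x).loopless.irrefl _
        ((hl _ (adj_hub_lthr hi)).2 ((adj_lthr_lthr hj hi).2 fun e => hne (lthr_inj.2 e)))

end Vert

/-! ### Nodes, wires and marks of the graph of a circuit -/

namespace Vert

variable {n : ℕ} {x : List OutLetter} {a b u v h s : Vert n x}

/-- The first index of a vertex. -/
def index (a : Vert n x) : ℕ := a.1.2.1

/-- A vertex that represents a node. -/
def IsNode (a : Vert n x) : Prop := a.1.1 = Fam.node

/-- There is a wire from the node `i` to the node `j`, which may be the additional node. -/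
def Edge (n : ℕ) (x : List OutLetter) (i j : ℕ) : Prop :=
  IsVert n x (.wire, i, j) ∨ (IsVert n x (.owire, i, 0) ∧ j = n)

theorem isNode_node {i j : ℕ} (hi : i < n + 1) (hj : j < 2) : (node x hi hj).IsNode := rfl

theorem IsNode.cluster (ha : a.IsNode) : a.cluster = 2 := by
  rw [Vert.cluster, show a.1.1 = Fam.node from ha]; rfl

theorem IsNode.left (ha : a.IsNode) : a.left = a.index + 1 := by
  rw [Vert.left, show a.1.1 = Fam.node from ha]; rfl

theorem IsNode.right (ha : a.IsNode) : a.right = a.index + 1 := by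
  rw [Vert.right, show a.1.1 = Fam.node from ha]; rfl

theorem IsNode.index_lt (ha : a.IsNode) : a.index < n + 1 := by
  have := a.2.1
  rwa [show a.1.1 = Fam.node from ha] at this

theorem exists_isNode_and {P : ℕ → Prop} :
    (∃ a : Vert n x, a.IsNode ∧ P a.index) ↔ ∃ i < n + 1, P i :=
  ⟨fun ⟨_, ha, hP⟩ => ⟨_, ha.index_lt, hP⟩,
    fun ⟨_, hi, hP⟩ => ⟨node x hi zero_lt_two, rfl, hP⟩⟩

/-- The cases of a vertex of the middle cluster. -/
theorem cases_of_cluster_eq_two (ha : a.cluster = 2) : (a.IsNode ∧ a.left = a.index + 1 ∧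
      a.right = a.index + 1) ∨
    (∃ i j, a.1 = (.wire, i, j) ∧ a.left = i + 1 ∧ a.right = j + 1 ∧ i < n ∧ j < n) ∨
    (∃ i, a.1 = (.owire, i, 0) ∧ a.left = i + 1 ∧ a.right = n + 1 ∧ i < n) ∨
    (∃ i, a.1 = (.cmark, i, 0) ∧ a.left = 0 ∧ a.right = i + 1 ∧ i < n + 1) ∨
    ∃ i, a.1 = (.dmark, i, 0) ∧ a.left = n + 2 ∧ a.right = i + 1 ∧ i < n + 1 := by
  obtain ⟨⟨f, i, j⟩, hp⟩ := a
  have h₁ := hp.1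
  have h₂ := hp.2.1
  cases f <;> simp [Vert.cluster, Fam.cluster, IsNode, Vert.left, Vert.right, index, Fam.left,
    Fam.right, Fam.bound₁, Fam.bound₂] at ha h₁ h₂ ⊢ <;> omega

/-- Only nodes come in two copies. -/
theorem exists_same_iff (hlt : ∀ i j, IsVert n x (.wire, i, j) → i < j) :
    (∃ y, y ≠ a ∧ SameLeft (circuitGraph n x) (hub n x) a y ∧
      SameRight (circuitGraph n x) (hub n x) a y) ↔ a.IsNode := by
  constructor
  · rintro ⟨b, hne, hl, hr⟩
    have ha := cluster_eq_of_same hne hl hr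
    have hb := ((sameRight_iff ha).1 hr.symm).1
    rw [sameLeft_iff ha hb] at hl
    have hr := ((sameRight_iff hb).1 hr).2
    rw [Ne, Subtype.ext_iff] at hne
    obtain ⟨h₁, -⟩ | ⟨i, j, h₁, hl₁, hr₁, hi₁, hj₁⟩ | ⟨i, h₁, hl₁, hr₁, hi₁⟩ | ⟨i, h₁, hl₁, hr₁,
        hi₁⟩ |
      ⟨i, h₁, hl₁, hr₁, hi₁⟩ := cases_of_cluster_eq_two ha
    · exact h₁
    all_goals
      exfalso
      obtain ⟨-, hl₂, hr₂⟩ | ⟨i', j', h₂, hl₂, hr₂, hi₂, hj₂⟩ | ⟨i', h₂, hl₂, hr₂, hi₂⟩ |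
        ⟨i', h₂, hl₂, hr₂, hi₂⟩ | ⟨i', h₂, hl₂, hr₂, hi₂⟩ := cases_of_cluster_eq_two hb
    · have := hlt i j (h₁ ▸ a.2); omega
    · refine hne ?_
      rw [h₁, h₂]
      simp only [Prod.mk.injEq, true_and]
      omega
    any_goals omega
    all_goals
      refine hne ?_
      rw [h₁, h₂]
      simp only [Prod.mk.injEq, true_and, and_true]
      omega
  · intro ha
    obtain ⟨⟨f, i, j⟩, hp⟩ := a
    obtain rfl : f = .node := ha
    have hi : i < n + 1 := hp.1
    have hj : j < 2 := hp.2.1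
    have hb : (node x hi (j := 1 - j) (by omega)).cluster = 2 := rfl
    refine ⟨node x hi (j := 1 - j) (by omega), ?_, ?_, ?_⟩
    · rw [Ne, Subtype.ext_iff]
      simp only [node, Prod.mk.injEq, true_and]
      omega
    · exact (sameLeft_iff rfl rfl).2 rfl
    · exact (sameRight_iff rfl).2 ⟨rfl, rfl⟩

/-- Vertices that are not nodes and have the left end of one node and the right end of another one
are wires. -/
theorem wire_iff (hu : u.IsNode) (hv : v.IsNode) :
    (∃ e : Vert n x, ¬ e.IsNode ∧ SameLeft (circuitGraph n x) (hub n x) e u ∧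
      SameRight (circuitGraph n x) (hub n x) e v) ↔ Edge n x u.index v.index := by
  have hul := hu.index_lt
  constructor
  · rintro ⟨e, hne, hl, hr⟩
    obtain ⟨hc, hr⟩ := (sameRight_iff hv.cluster).1 hr
    rw [sameLeft_iff hc hu.cluster, hu.left] at hl
    rw [hv.right] at hr
    obtain ⟨h₁, -⟩ | ⟨i, j, h₁, hl₁, hr₁, hi₁, hj₁⟩ | ⟨i, h₁, hl₁, hr₁, hi₁⟩ | ⟨i, h₁, hl₁, hr₁,
        hi₁⟩ |
      ⟨i, h₁, hl₁, hr₁, hi₁⟩ := cases_of_cluster_eq_two hc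
    · exact absurd h₁ hne
    · obtain rfl : u.index = i := by omega
      obtain rfl : v.index = j := by omega
      exact Or.inl (h₁ ▸ e.2)
    · obtain rfl : u.index = i := by omega
      exact Or.inr ⟨h₁ ▸ e.2, by omega⟩
    · omega
    · omega
  · rintro (he | ⟨he, hn⟩)
    · refine ⟨⟨_, he⟩, by simp [IsNode], (sameLeft_iff rfl hu.cluster).2 hu.left.symm,
        (sameRight_iff hv.cluster).2 ⟨rfl, hv.right.symm⟩⟩
    · refine ⟨⟨_, he⟩, by simp [IsNode], (sameLeft_iff rfl hu.cluster).2 hu.left.symm,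
        (sameRight_iff hv.cluster).2 ⟨rfl, ?_⟩⟩
      rw [hv.right, hn]
      rfl

/-- Marks of conjunctions are the vertices of the middle cluster with the smallest left end. -/
theorem cmark_iff (hv : v.IsNode) :
    (∃ e : Vert n x, (∀ z, (circuitGraph n x).Adj (hub n x) z → z ≠ leaf n x →
      (circuitGraph n x).Adj e z) ∧ SameRight (circuitGraph n x) (hub n x) e v) ↔
        IsVert n x (.cmark, v.index, 0) := by
  constructor
  · rintro ⟨e, hl, hr⟩
    obtain ⟨hc, hr⟩ := (sameRight_iff hv.cluster).1 hr
    rw [hv.right] at hr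
    have h0 := (adj_lthr_iff hc (i := 0) (by omega)).1 (hl _ (adj_hub_lthr _)
      (ne_of_cluster_ne (by rw [cluster_lthr, cluster_leaf]; decide)))
    obtain ⟨h₁, hl₁, -⟩ | ⟨i, j, h₁, hl₁, hr₁, hi₁, hj₁⟩ | ⟨i, h₁, hl₁, hr₁, hi₁⟩ |
      ⟨i, h₁, hl₁, hr₁, hi₁⟩ | ⟨i, h₁, hl₁, hr₁, hi₁⟩ := cases_of_cluster_eq_two hc
    any_goals omega
    obtain rfl : v.index = i := by omega
    exact h₁ ▸ e.2
  · intro he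
    refine ⟨⟨_, he⟩, fun z hz hzl => ?_, (sameRight_iff hv.cluster).2 ⟨rfl, hv.right.symm⟩⟩
    obtain rfl | ⟨i, hi, rfl⟩ := adj_hub_iff.1 hz
    · exact absurd rfl hzl
    · rw [adj_lthr_iff rfl]
      exact Nat.zero_le _

/-- Marks of disjunctions are the vertices of the middle cluster with the largest left end. -/
theorem dmark_iff (hv : v.IsNode) :
    (∃ e : Vert n x, (∀ z, (circuitGraph n x).Adj (hub n x) z → ¬ (circuitGraph n x).Adj e z) ∧
      SameRight (circuitGraph n x) (hub n x) e v) ↔ IsVert n x (.dmark, v.index, 0) := by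
  constructor
  · rintro ⟨e, hl, hr⟩
    obtain ⟨hc, hr⟩ := (sameRight_iff hv.cluster).1 hr
    rw [hv.right] at hr
    have h0 := mt (adj_lthr_iff hc (i := n + 1) (by omega)).2 (hl _ (adj_hub_lthr _))
    obtain ⟨h₁, hl₁, -⟩ | ⟨i, j, h₁, hl₁, hr₁, hi₁, hj₁⟩ | ⟨i, h₁, hl₁, hr₁, hi₁⟩ |
      ⟨i, h₁, hl₁, hr₁, hi₁⟩ | ⟨i, h₁, hl₁, hr₁, hi₁⟩ := cases_of_cluster_eq_two hc
    · have := h₁.index_lt; omega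
    any_goals omega
    obtain rfl : v.index = i := by omega
    exact h₁ ▸ e.2
  · intro he
    refine ⟨⟨_, he⟩, fun z hz => ?_, (sameRight_iff hv.cluster).2 ⟨rfl, hv.right.symm⟩⟩
    obtain rfl | ⟨i, hi, rfl⟩ := adj_hub_iff.1 hz
    · rw [adj_comm]
      exact not_adj_of_cluster le_rfl
    · rw [adj_lthr_iff rfl]
      exact not_le.2 hi

theorem IsNode.sameRight_iff (ha : a.IsNode) (hb : b.IsNode) :
    SameRight (circuitGraph n x) (hub n x) a b ↔ a.index = b.index := by
  rw [Vert.sameRight_iff hb.cluster, ha.right, hb.right]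
  simp [ha.cluster]

/-- The leaf is the only vertex with one neighbour. -/
theorem leaf_and_adj_iff (hn : 1 ≤ n) : ((∀ y z, (circuitGraph n x).Adj s y →
    (circuitGraph n x).Adj s z → y = z) ∧ (circuitGraph n x).Adj s h) ↔
      s = leaf n x ∧ h = hub n x := by
  constructor
  · rintro ⟨hs, hh⟩
    suffices s = leaf n x by
      subst this
      exact ⟨rfl, adj_leaf_iff.1 hh⟩
    by_contra hne
    have hc := cluster_le s
    obtain h0 | h1 | h2 | h3 : s.cluster = 0 ∨ s.cluster = 1 ∨ s.cluster = 2 ∨ s.cluster = 3 := by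
      omega
    · exact hne (eq_leaf h0)
    · obtain rfl | ⟨i, hi, rfl⟩ := eq_hub_or h1
      · have := hs _ _ adj_hub_leaf (adj_hub_lthr (i := 0) (by omega))
        exact absurd (congrArg cluster this) (by rw [cluster_leaf, cluster_lthr]; decide)
      · obtain ⟨m, hm, hmi⟩ : ∃ m, ∃ hm : m < n + 2, i ≠ m := by
          by_cases h0 : i = 0
          · exact ⟨1, by omega, by omega⟩
          · exact ⟨0, by omega, h0⟩
        exact hub_ne_lthr hm (hs _ _ (adj_hub_lthr hi).symm ((adj_lthr_lthr hi hm).2 hmi))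
    · obtain ⟨c, hcc, hcs⟩ : ∃ c : Vert n x, c.cluster = 2 ∧ s ≠ c := by
        by_cases hc : node x (i := 0) (j := 0) (by omega) (by omega) = s
        · refine ⟨node x (i := 0) (j := 1) (by omega) (by omega), rfl, fun hc' => ?_⟩
          have := hc.trans hc'
          simp [node, Subtype.ext_iff] at this
        · exact ⟨_, rfl, Ne.symm hc⟩
      have := hs _ _ ((adj_of_cluster_eq (h2.trans hcc.symm)).2 hcs)
        ((adj_rthr_iff h2 (i := 0) (by omega)).2 (right_pos h2))
      exact absurd (congrArg cluster this) (by rw [cluster_rthr, hcc]; decide)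
    · obtain ⟨i, hi, rfl⟩ := eq_rthr h3
      obtain ⟨m, m', hm, hm', hmi, hmi', hmm⟩ : ∃ m m', ∃ (_ : m < n + 2) (_ : m' < n + 2),
          i ≠ m ∧ i ≠ m' ∧ m ≠ m' := by
        by_cases h0 : i = 0
        · exact ⟨1, 2, by omega, by omega, by omega, by omega, by omega⟩
        · by_cases h1 : i = 1
          · exact ⟨0, 2, by omega, by omega, by omega, by omega, by omega⟩
          · exact ⟨0, 1, by omega, by omega, by omega, by omega, by omega⟩
      exact hmm (rthr_inj.1 (hs _ _ ((adj_rthr_rthr hi hm).2 hmi) ((adj_rthr_rthr hi hm').2 hmi')))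
  · rintro ⟨rfl, rfl⟩
    refine ⟨fun y z hy hz => ?_, adj_leaf_iff.2 rfl⟩
    rw [adj_leaf_iff.1 hy, adj_leaf_iff.1 hz]

/-- The value of the node `j` when exactly the input nodes in `A` are true, computed by looking at
no more than `d` levels of the circuit. -/
def levelValue (n : ℕ) (x : List OutLetter) (A : Set ℕ) : ℕ → ℕ → Prop
  | 0, _ => False
  | d + 1, j =>
    (IsVert n x (.cmark, j, 0) → ∀ i < n + 1, Edge n x i j → levelValue n x A d i) ∧
    (¬ IsVert n x (.cmark, j, 0) →
      (IsVert n x (.dmark, j, 0) → ∃ i < n + 1, Edge n x i j ∧ levelValue n x A d i) ∧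
      (¬ IsVert n x (.dmark, j, 0) → j ∉ A → ∃ i < n + 1, Edge n x i j ∧ ¬ levelValue n x A d i))

/-- The formula `val` computes `levelValue`. -/
theorem sat_val (hlt : ∀ i j, IsVert n x (.wire, i, j) → i < j) {k : ℕ} (d : ℕ) {m : ℕ}
    {xs : Fin m → Vert n x} {s h v : Fin m} {X : Fin k → Fin m} (hs : xs s = leaf n x)
    (hh : xs h = hub n x) (hv : (xs v).IsNode) (hX : ∀ i, (xs (X i)).IsNode) :
    Sat (circuitGraph n x) (val d s h X v) xs ↔
      levelValue n x (Set.range fun i => (xs (X i)).index) d (xs v).index := by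
  induction d generalizing m with
  | zero => simp [val, levelValue]
  | succ d ih =>
    have key : ∀ a : Vert n x, a.IsNode → (Sat (circuitGraph n x) (val d s.castSucc h.castSucc
        (fun i => (X i).castSucc) (Fin.last m)) (Fin.snoc xs a) ↔
          levelValue n x (Set.range fun i => (xs (X i)).index) d a.index) := by
      intro a ha
      rw [ih] <;> simp_all
    have h₁ : (∃ a, (∃ i, a = xs (X i)) ∧ SameRight (circuitGraph n x) (hub n x) (xs v) a) ↔
        (xs v).index ∈ Set.range fun i => (xs (X i)).index := by
      constructor
      · rintro ⟨_, ⟨i, rfl⟩, hi⟩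
        exact ⟨i, ((hv.sameRight_iff (hX i)).1 hi).symm⟩
      · rintro ⟨i, hi⟩
        exact ⟨_, ⟨i, rfl⟩, (hv.sameRight_iff (hX i)).2 hi.symm⟩
    simp only [val, sat_inf, sat_imp, sat_not, sat_all, sat_ex, sat_cmark, sat_dmark, sat_node,
      sat_wire, sat_mem, sat_sameRight, Fin.snoc_castSucc, Fin.snoc_last, hs, hh, cmark_iff hv,
      dmark_iff hv, exists_same_iff hlt, levelValue]
    rw [h₁]
    have h₂ : ∀ P : ℕ → Prop, ∀ Q : Vert n x → Prop,
        (∀ a : Vert n x, a.IsNode → (Q a ↔ P a.index)) →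
        ((∃ a : Vert n x, a.IsNode ∧ (∃ e : Vert n x, ¬ e.IsNode ∧
          SameLeft (circuitGraph n x) (hub n x) e a ∧
            SameRight (circuitGraph n x) (hub n x) e (xs v)) ∧ Q a) ↔ ∃ i < n + 1, Edge n x i (xs v).index ∧ P i) := by
      intro P Q hPQ
      rw [← exists_isNode_and (x := x)]
      refine exists_congr fun a => and_congr_right fun ha => ?_
      rw [wire_iff ha hv, hPQ a ha]
    rw [h₂ _ _ key, h₂ (fun i => ¬ levelValue n x (Set.range fun i => (xs (X i)).index) d i) _
      fun a ha => not_congr (key a ha)]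
    refine and_congr_left fun _ => imp_congr_right fun _ => ?_
    constructor
    · intro H i hi he
      exact (key _ (isNode_node hi zero_lt_two)).1
        (H _ rfl ((wire_iff (isNode_node hi zero_lt_two) hv).2 he))
    · intro H a ha he
      exact (key a ha).2 (H _ ha.index_lt ((wire_iff ha hv).1 he))

end Vert

/-! ### The meaning of the sentence -/

namespace Vert

variable {n : ℕ} {x : List OutLetter}

/-- The node `j` has no gate and no incoming wires. -/
def IsInput (n : ℕ) (x : List OutLetter) (j : ℕ) : Prop :=
  ¬ IsVert n x (.cmark, j, 0) ∧ ¬ IsVert n x (.dmark, j, 0) ∧ ∀ i < n + 1, ¬ Edge n x i j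

theorem sat_input (hlt : ∀ i j, IsVert n x (.wire, i, j) → i < j) {m : ℕ} {xs : Fin m → Vert n x}
    {s h v : Fin m} (hs : xs s = leaf n x) (hh : xs h = hub n x) :
    Sat (circuitGraph n x) (input s h v) xs ↔ (xs v).IsNode ∧ IsInput n x (xs v).index := by
  simp only [input, sat_inf, sat_imp, sat_not, sat_all, sat_cmark, sat_dmark, sat_node, sat_wire,
    Fin.snoc_castSucc, Fin.snoc_last, hs, hh, exists_same_iff hlt, IsInput]
  refine and_congr_right fun hv => ?_
  rw [cmark_iff hv, dmark_iff hv]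
  refine and_congr_right fun _ => and_congr_right fun _ => ?_
  constructor
  · intro H i hi he
    exact H _ (isNode_node hi zero_lt_two) ((wire_iff (isNode_node hi zero_lt_two) hv).2 he)
  · intro H a ha he
    exact H _ ha.index_lt ((wire_iff ha hv).1 he)

/-- The formula `refuted` denies the additional node, which is the only one with both marks. -/
theorem sat_refuted (hlt : ∀ i j, IsVert n x (.wire, i, j) → i < j) {m k : ℕ} (d : ℕ)
    {xs : Fin m → Vert n x} {s h : Fin m} {X : Fin k → Fin m} (hs : xs s = leaf n x)
    (hh : xs h = hub n x) (hX : ∀ i, (xs (X i)).IsNode) :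
    Sat (circuitGraph n x) (refuted d s h X) xs ↔ ¬ ∃ w < n + 1, IsVert n x (.cmark, w, 0) ∧
      IsVert n x (.dmark, w, 0) ∧ levelValue n x (Set.range fun i => (xs (X i)).index) d w := by
  simp only [refuted, sat_imp, sat_not, sat_all, sat_cmark, sat_dmark, sat_node,
    Fin.snoc_castSucc, Fin.snoc_last, hs, hh, exists_same_iff hlt]
  rw [← exists_isNode_and (x := x)]
  have key : ∀ a : Vert n x, a.IsNode → (Sat (circuitGraph n x) (val d s.castSucc h.castSucc
      (fun i => (X i).castSucc) (Fin.last m)) (Fin.snoc xs a) ↔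
        levelValue n x (Set.range fun i => (xs (X i)).index) d a.index) := by
    intro a ha
    rw [sat_val hlt] <;> simp_all
  constructor
  · rintro H ⟨a, ha, hc, hd, hl⟩
    exact H a ha ((cmark_iff ha).2 hc) ((dmark_iff ha).2 hd) ((key a ha).2 hl)
  · intro H a ha hc hd hl
    exact H ⟨a, ha, (cmark_iff ha).1 hc, (dmark_iff ha).1 hd, (key a ha).1 hl⟩

/-- What the sentence says about the graph of a circuit. -/
theorem realize_sentence (hn : 1 ≤ n) (hlt : ∀ i j, IsVert n x (.wire, i, j) → i < j) (d k : ℕ) :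
    @FirstOrder.Language.Sentence.Realize _ _ (circuitGraph n x).structure (sentence d k) ↔
      ∃ a : Fin k → ℕ, Injective a ∧ (∀ i, a i < n + 1 ∧ IsInput n x (a i)) ∧
        ∃ w < n + 1, IsVert n x (.cmark, w, 0) ∧ IsVert n x (.dmark, w, 0) ∧
          levelValue n x (Set.range a) d w := by
  have h₁ : @FirstOrder.Language.Sentence.Realize _ _ (circuitGraph n x).structure (sentence d k) ↔
      ¬ ∀ xs, Sat (circuitGraph n x) (body (n := k + 2) d 0 1 fun i => i.addNat 2) xs :=
    not_congr sat_alls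
  have hinput : ∀ xs : Fin (k + 2) → Vert n x, xs 0 = leaf n x → xs 1 = hub n x →
      (Sat (circuitGraph n x) (FirstOrder.Language.BoundedFormula.all ((mem (fun i : Fin k =>
        (i.addNat 2).castSucc) (Fin.last (k + 2))).imp (input (0 : Fin (k + 2)).castSucc
          (1 : Fin (k + 2)).castSucc (Fin.last (k + 2))))) xs ↔
        ∀ i : Fin k, (xs (i.addNat 2)).IsNode ∧ IsInput n x (xs (i.addNat 2)).index) := by
    intro xs h0 h1
    simp only [sat_all, sat_imp, sat_mem, Fin.snoc_castSucc, Fin.snoc_last]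
    constructor
    · intro H i
      have := (sat_input hlt (by rwa [Fin.snoc_castSucc]) (by rwa [Fin.snoc_castSucc])).1
        (H (xs (i.addNat 2)) ⟨i, rfl⟩)
      rwa [Fin.snoc_last] at this
    · rintro H _ ⟨i, rfl⟩
      refine (sat_input hlt (by rwa [Fin.snoc_castSucc]) (by rwa [Fin.snoc_castSucc])).2 ?_
      rw [Fin.snoc_last]
      exact H i
  rw [h₁, not_forall]
  simp only [body, sat_imp, sat_foldr_imp (fun p : Fin k × Fin k =>
    differ (1 : Fin (k + 2)) (p.1.addNat 2) (p.2.addNat 2)), sat_leaf, sat_adj, sat_differ,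
        mem_pairs,
    Classical.not_imp]
  constructor
  · rintro ⟨xs, hl, ha, hi, hp, hr⟩
    obtain ⟨h0, h1⟩ := (leaf_and_adj_iff hn).1 ⟨hl, ha⟩
    rw [hinput xs h0 h1] at hi
    rw [sat_refuted hlt d h0 h1 fun i => (hi i).1, not_not] at hr
    refine ⟨fun i => (xs (i.addNat 2)).index, ?_, fun i => ⟨(hi i).1.index_lt, (hi i).2⟩, hr⟩
    intro i j hij
    by_contra hne
    rcases lt_or_gt_of_ne hne with hlt | hlt
    · exact hp (i, j) hlt (by rw [h1]; exact ((hi i).1.sameRight_iff (hi j).1).2 hij)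
    · exact hp (j, i) hlt (by rw [h1]; exact ((hi j).1.sameRight_iff (hi i).1).2 hij.symm)
  · rintro ⟨a, hinj, hi, hr⟩
    let xs : Fin (k + 2) → Vert n x :=
      Fin.cons (leaf n x) (Fin.cons (hub n x) fun i => node x (hi i).1 zero_lt_two)
    have h0 : xs 0 = leaf n x := rfl
    have h1 : xs 1 = hub n x := rfl
    have h2 : ∀ i : Fin k, xs (i.addNat 2) = node x (hi i).1 zero_lt_two := fun i => rfl
    obtain ⟨hl, ha⟩ := (leaf_and_adj_iff hn).2 ⟨h0, h1⟩
    refine ⟨xs, hl, ha, (hinput xs h0 h1).2 fun i => ?_, ?_, ?_⟩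
    · rw [h2]
      exact ⟨rfl, (hi i).2⟩
    · rintro ⟨i, j⟩ hij hs
      rw [h1, h2, h2] at hs
      exact hij.ne (hinj ((IsNode.sameRight_iff (isNode_node _ _) (isNode_node _ _)).1 hs))
    · rw [sat_refuted hlt d h0 h1 fun i => by rw [h2]; rfl, not_not]
      exact hr

end Vert

namespace BoolCircuit

/-- The letters of a circuit, in the alphabet of the model checking problem. -/
def letters (C : BoolCircuit) : List OutLetter := C.code.map fun a => encLetter (.inl a)

theorem _root_.getElem?_concatRows {α : Type} {n l : ℕ} {row : Fin n → List α}
    (h : ∀ i, (row i).length = l) (i : Fin n) {j : ℕ} (hj : j < l) :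
    (concatRows row)[(i : ℕ) * l + j]? = (row i)[j]? := by
  induction n with
  | zero => exact i.elim0
  | succ n ih =>
    rw [concatRows, List.ofFn_succ, List.flatten_cons]
    refine Fin.cases ?_ (fun i => ?_) i
    · rw [List.getElem?_append_left (by simpa [h] using hj)]
      simp
    · rw [List.getElem?_append_right (by rw [h, Fin.val_succ, add_mul]; omega), h]
      have := ih (row := fun i => row i.succ) (fun i => h _) i
      rw [concatRows] at this
      rw [← this]
      congr 1
      rw [Fin.val_succ, add_mul]
      omega

variable (C : BoolCircuit)

theorem length_row (j : Fin C.size) : (C.row j).length = C.size + 2 := by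
  simp [row]

theorem getElem?_letters (j : Fin C.size) {c : ℕ} (hc : c < C.size + 2) :
    C.letters[(j : ℕ) * (C.size + 2) + c]? = ((C.row j)[c]?).map fun a => encLetter (.inl a) := by
  rw [letters, List.getElem?_map, code, getElem?_concatRows C.length_row j hc]

theorem getElem?_letters_kind (j : Fin C.size) :
    C.letters[(j : ℕ) * (C.size + 2)]? = some (encLetter (.inl (.inl (C.kind j)))) := by
  have := C.getElem?_letters j (c := 0) (by omega)
  simpa [row] using this

theorem getElem?_letters_wire (i j : Fin C.size) :
    C.letters[(j : ℕ) * (C.size + 2) + (i + 1)]? = some (Sum.inl (some (C.wire i j))) := by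
  rw [C.getElem?_letters j (by omega)]
  simp [row, encLetter]

theorem getElem?_letters_output (j : Fin C.size) :
    C.letters[(j : ℕ) * (C.size + 2) + (C.size + 1)]? =
      some (Sum.inl (some (decide (j = C.output)))) := by
  rw [C.getElem?_letters j (by omega)]
  simp [row, encLetter]

theorem length_letters : C.letters.length = C.size * (C.size + 2) := by
  rw [letters, List.length_map, code, concatRows, List.length_flatten, List.map_ofFn]
  have : List.length ∘ C.row = fun _ => C.size + 2 := funext C.length_row
  rw [this, List.sum_ofFn]
  simp

theorem isVert_cmark_iff (j : Fin C.size) :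
    IsVert C.size C.letters (.cmark, j, 0) ↔ C.kind j = .conj := by
  simp only [IsVert, Fam.bound₁, Fam.bound₂, Fam.row, Fam.col, Fam.test, add_zero,
    getElem?_letters_kind]
  rw [and_iff_right (by omega), and_iff_right (by omega)]
  cases C.kind j <;> decide

theorem isVert_dmark_iff (j : Fin C.size) :
    IsVert C.size C.letters (.dmark, j, 0) ↔ C.kind j = .disj := by
  simp only [IsVert, Fam.bound₁, Fam.bound₂, Fam.row, Fam.col, Fam.test, add_zero,
    getElem?_letters_kind]
  rw [and_iff_right (by omega), and_iff_right (by omega)]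
  cases C.kind j <;> decide

theorem isVert_mark_size : IsVert C.size C.letters (.cmark, C.size, 0) ∧
    IsVert C.size C.letters (.dmark, C.size, 0) := by
  have : C.letters[C.size * (C.size + 2)]? = none := by
    rw [List.getElem?_eq_none_iff, length_letters]
  simp [IsVert, Fam.bound₁, Fam.bound₂, Fam.row, Fam.col, Fam.test, this]

theorem isVert_wire_iff (i j : Fin C.size) :
    IsVert C.size C.letters (.wire, i, j) ↔ C.wire i j = true := by
  simp only [IsVert, Fam.bound₁, Fam.bound₂, Fam.row, Fam.col, Fam.test, getElem?_letters_wire]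
  rw [and_iff_right i.2, and_iff_right j.2]
  cases C.wire i j <;> decide

theorem isVert_owire_iff (i : Fin C.size) :
    IsVert C.size C.letters (.owire, i, 0) ↔ i = C.output := by
  simp only [IsVert, Fam.bound₁, Fam.bound₂, Fam.row, Fam.col, Fam.test, getElem?_letters_output]
  rw [and_iff_right i.2, and_iff_right (by omega)]
  by_cases h : i = C.output
  · simp only [h, decide_true]
    decide
  · simp only [h, decide_false]
    decide

theorem lt_of_isVert_wire {i j : ℕ} (h : IsVert C.size C.letters (.wire, i, j)) : i < j := by
  have hi : i < C.size := h.1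
  have hj : j < C.size := h.2.1
  exact C.lt_of_wire ⟨i, hi⟩ ⟨j, hj⟩ ((C.isVert_wire_iff ⟨i, hi⟩ ⟨j, hj⟩).1 h)

open Vert

theorem edge_iff {i : ℕ} (j : Fin C.size) :
    Edge C.size C.letters i j ↔ ∃ hi : i < C.size, C.wire ⟨i, hi⟩ j = true := by
  constructor
  · rintro (h | ⟨-, h⟩)
    · exact ⟨h.1, (C.isVert_wire_iff ⟨i, h.1⟩ j).1 h⟩
    · have := j.2; omega
  · rintro ⟨hi, h⟩
    exact Or.inl ((C.isVert_wire_iff ⟨i, hi⟩ j).2 h)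

theorem edge_size_iff {i : ℕ} : Edge C.size C.letters i C.size ↔ i = C.output := by
  constructor
  · rintro (h | ⟨h, -⟩)
    · exact absurd h.2.1 (lt_irrefl _)
    · exact congrArg Fin.val ((C.isVert_owire_iff ⟨i, h.1⟩).1 h)
  · rintro rfl
    exact Or.inr ⟨(C.isVert_owire_iff _).2 rfl, rfl⟩

theorem isInput_iff {j : ℕ} (hj : j < C.size + 1) :
    IsInput C.size C.letters j ↔ ∃ h : j < C.size, C.kind ⟨j, h⟩ = .input := by
  constructor
  · rintro ⟨h₁, h₂, h₃⟩
    have hlt : j < C.size := by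
      by_contra h
      obtain rfl : j = C.size := by omega
      exact h₁ C.isVert_mark_size.1
    refine ⟨hlt, ?_⟩
    rw [C.isVert_cmark_iff ⟨j, hlt⟩] at h₁
    rw [C.isVert_dmark_iff ⟨j, hlt⟩] at h₂
    match hk : C.kind ⟨j, hlt⟩ with
    | .input => rfl
    | .conj => exact absurd hk h₁
    | .disj => exact absurd hk h₂
    | .neg =>
      obtain ⟨i, hi, -⟩ := C.wire_neg _ hk
      exact absurd ((C.edge_iff ⟨j, hlt⟩).2 ⟨i.2, hi⟩) (h₃ i (by omega))
  · rintro ⟨hlt, hk⟩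
    refine ⟨?_, ?_, fun i _ he => ?_⟩
    · rw [C.isVert_cmark_iff ⟨j, hlt⟩, hk]; decide
    · rw [C.isVert_dmark_iff ⟨j, hlt⟩, hk]; decide
    · obtain ⟨hi, he⟩ := (C.edge_iff ⟨j, hlt⟩).1 he
      rw [C.wire_input _ _ hk] at he
      exact absurd he (by decide)

/-- Formulas that look back far enough see the value of a node. -/
theorem levelValue_iff (S : Finset (Fin C.size)) (hS : ∀ i ∈ S, C.kind i = .input) (d : ℕ)
    (j : Fin C.size) (hd : ∀ p : List (Fin C.size), p.IsChain (fun i j => C.wire i j = true) →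
      p.getLast? = some j → p.length ≤ d) :
    levelValue C.size C.letters {i | ∃ h : i < C.size, (⟨i, h⟩ : Fin C.size) ∈ S} d j ↔
      C.value S j := by
  induction d generalizing j with
  | zero => exact absurd (hd [j] (by simp) (by simp)) (by simp)
  | succ d ih =>
    replace ih : ∀ i, C.wire i j = true → (levelValue C.size C.letters
        {i | ∃ h : i < C.size, (⟨i, h⟩ : Fin C.size) ∈ S} d i ↔ C.value S i) := by
      intro i hi
      refine ih i fun p hp hpi => ?_
      have := hd (p ++ [j]) (List.IsChain.append hp (by simp) (by simp [hpi, hi])) (by simp)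
      simpa using this
    have hall : ∀ P : ℕ → Prop, (∀ i < C.size + 1, Edge C.size C.letters i j → P i) ↔
        ∀ i, C.wire i j = true → P i := by
      intro P
      constructor
      · intro H i hi
        exact H i (by omega) ((C.edge_iff j).2 ⟨i.2, hi⟩)
      · intro H i _ he
        obtain ⟨hi, he⟩ := (C.edge_iff j).1 he
        exact H ⟨i, hi⟩ he
    have hex : ∀ P : ℕ → Prop, (∃ i < C.size + 1, Edge C.size C.letters i j ∧ P i) ↔
        ∃ i, C.wire i j = true ∧ P i := by
      intro P
      constructor
      · rintro ⟨i, _, he, hP⟩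
        obtain ⟨hi, he⟩ := (C.edge_iff j).1 he
        exact ⟨⟨i, hi⟩, he, hP⟩
      · rintro ⟨i, hi, hP⟩
        exact ⟨i, by omega, (C.edge_iff j).2 ⟨i.2, hi⟩, hP⟩
    rw [levelValue, hall, hex, hex, C.isVert_cmark_iff, C.isVert_dmark_iff, value]
    match hk : C.kind j with
    | .input =>
      have := fun i => C.wire_input i j hk
      simp [this]
    | .conj =>
      simp only [true_imp_iff, not_true, false_imp_iff, and_true]
      exact forall_congr' fun i => forall_congr' fun hi => ih i hi
    | .disj =>
      simp only [reduceCtorEq, false_imp_iff, true_and, not_false_eq_true, true_imp_iff, not_true,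
        and_true, exists_prop]
      exact exists_congr fun i => and_congr_right fun hi => ih i hi
    | .neg =>
      obtain ⟨i, hi, hu⟩ := C.wire_neg j hk
      have hj : j ∉ S := fun h => by
        have := hS j h
        rw [hk] at this
        exact absurd this (by decide)
      simp only [reduceCtorEq, false_imp_iff, true_and, not_false_eq_true, true_imp_iff,
        Set.mem_ofPred_eq, Fin.eta, j.2, exists_true_left, hj]
      constructor
      · rintro ⟨i', hi', hv⟩ i'' hi''
        rw [hu _ hi'']
        rw [hu _ hi', ih i hi] at hv
        exact hv
      · intro H
        exact ⟨i, hi, fun h => H i hi ((ih i hi).1 h)⟩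

/-- The sentence is true in the graph of the circuit if and only if the circuit has a solution. -/
theorem realize_sentence_iff {h : ℕ} (hC : C.DepthLE h) (k : ℕ) :
    @FirstOrder.Language.Sentence.Realize _ _ (vertGraph C.size C.letters).structure
      (sentence (h + 2) k) ↔ C.HasWeightedSolution k := by
  have hn : 1 ≤ C.size := by have := C.output.2; omega
  rw [vertGraph_realize, Vert.realize_sentence hn fun i j => C.lt_of_isVert_wire]
  have hlast : ∀ A : Set ℕ, (∃ w < C.size + 1, IsVert C.size C.letters (.cmark, w, 0) ∧
      IsVert C.size C.letters (.dmark, w, 0) ∧ levelValue C.size C.letters A (h + 2) w) ↔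
        levelValue C.size C.letters A (h + 1) C.output := by
    intro A
    have hs : levelValue C.size C.letters A (h + 2) C.size ↔
        levelValue C.size C.letters A (h + 1) C.output := by
      rw [levelValue]
      simp only [C.isVert_mark_size.1, true_imp_iff, not_true, false_imp_iff, and_true,
          edge_size_iff]
      constructor
      · intro H
        exact H _ (by omega) rfl
      · rintro H _ _ rfl
        exact H
    constructor
    · rintro ⟨w, hw, h₁, h₂, h₃⟩
      obtain rfl : w = C.size := by
        by_contra hne
        have hlt : w < C.size := by omega
        rw [C.isVert_cmark_iff ⟨w, hlt⟩] at h₁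
        rw [C.isVert_dmark_iff ⟨w, hlt⟩, h₁] at h₂
        exact absurd h₂ (by decide)
      exact hs.1 h₃
    · intro H
      exact ⟨C.size, by omega, C.isVert_mark_size.1, C.isVert_mark_size.2, hs.2 H⟩
  simp only [hlast]
  constructor
  · rintro ⟨a, hinj, ha, hv⟩
    choose ha hk using fun i => (C.isInput_iff (ha i).1).1 (ha i).2
    let f : Fin k ↪ Fin C.size := ⟨fun i => ⟨a i, ha i⟩, fun i j hij => hinj (by simpa using hij)⟩
    have hS : ∀ i ∈ Finset.univ.map f, C.kind i = .input := by
      intro i hi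
      obtain ⟨j, -, rfl⟩ := Finset.mem_map.1 hi
      exact hk j
    refine ⟨Finset.univ.map f, hS, by simp, ?_⟩
    rw [← C.levelValue_iff _ hS (h + 1) C.output fun p hp hl => hC p ⟨hp, hl⟩]
    convert hv using 1
    ext i
    simp only [Finset.mem_map, Finset.mem_univ, true_and, Set.mem_ofPred_eq, Set.mem_range]
    constructor
    · rintro ⟨_, j, hj⟩
      exact ⟨j, congrArg Fin.val hj⟩
    · rintro ⟨j, rfl⟩
      exact ⟨ha j, j, rfl⟩
  · rintro ⟨S, hS, rfl, hv⟩
    let f := S.equivFin.symm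
    refine ⟨fun i => (f i : Fin C.size), fun i j hij => f.injective (Subtype.ext (Fin.ext hij)),
      fun i => ?_, ?_⟩
    · have := (f i : Fin C.size).2
      exact ⟨by simp only; omega, (C.isInput_iff (by simp only; omega)).2 ⟨this, hS _ (f i).2⟩⟩
    rw [← C.levelValue_iff _ hS (h + 1) C.output fun p hp hl => hC p ⟨hp, hl⟩] at hv
    convert hv using 1
    ext i
    simp only [Set.mem_range, Set.mem_ofPred_eq]
    constructor
    · rintro ⟨j, rfl⟩
      exact ⟨by omega, (f j).2⟩
    · rintro ⟨hi, hiS⟩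
      exact ⟨f.symm ⟨_, hiS⟩, by simp⟩

end BoolCircuit

/-! ### The reduction -/

theorem Polynomial.exists_eval_le_mul_pow (T : Polynomial ℕ) :
    ∃ B D, ∀ m M, m ≤ M → 1 ≤ M → T.eval m ≤ B * M ^ D := by
  refine ⟨∑ i ∈ Finset.range (T.natDegree + 1), T.coeff i, T.natDegree, fun m M hm hM => ?_⟩
  rw [Polynomial.eval_eq_sum_range, Finset.sum_mul]
  refine Finset.sum_le_sum fun i hi => Nat.mul_le_mul_left _
    ((Nat.pow_le_pow_left hm i).trans (Nat.pow_le_pow_right hM ?_))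
  simpa [Nat.lt_succ_iff] using hi

/-- The total time is bounded by an fpt function when the input of length `N` is transformed in time
`F * (N + 1) ^ c`, and the result, which has length `l`, is processed in polynomial time. -/
theorem total_time_le {B C D F N c l t : ℕ} (hl : l ≤ N + C * (F * (N + 1) ^ c))
    (ht : ∀ M, l ≤ M → 1 ≤ M → t ≤ B * M ^ D) : F * (N + 1) ^ c + (l + 1) + t + 1 ≤
      (C + 4 + B * (C + 1) ^ D) * (F + 1) ^ (D + 1) * (N + 1) ^ ((c + 1) * (D + 1)) := by
  set X := (F + 1) * (N + 1) ^ (c + 1) with hX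
  have hp : 1 ≤ (N + 1) ^ c := Nat.one_le_pow _ _ (by omega)
  have hX₁ : F * (N + 1) ^ c ≤ X :=
    Nat.mul_le_mul (by omega) (Nat.pow_le_pow_right (by omega) (by omega))
  have hX₂ : N + 1 ≤ X := by
    simpa using Nat.mul_le_mul (Nat.le_add_left 1 F)
      (Nat.pow_le_pow_right (Nat.succ_pos N) (Nat.le_add_left 1 c))
  have hlX : l ≤ (C + 1) * X := by nlinarith
  have ht' := ht ((C + 1) * X) hlX (by nlinarith)
  have hY : (F + 1) ^ (D + 1) * (N + 1) ^ ((c + 1) * (D + 1)) = X ^ (D + 1) := by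
    rw [hX, mul_pow, ← pow_mul]
  have hXY : X ≤ X ^ (D + 1) := Nat.le_self_pow (by omega) X
  have hXY' : X ^ D ≤ X ^ (D + 1) := Nat.pow_le_pow_right (by omega) (by omega)
  rw [mul_assoc, hY]
  calc F * (N + 1) ^ c + (l + 1) + t + 1
      ≤ X + ((C + 1) * X + X) + B * (C + 1) ^ D * X ^ D + X := by
        rw [mul_pow, ← mul_assoc] at ht'
        omega
    _ = (C + 4) * X + B * (C + 1) ^ D * X ^ D := by ring
    _ ≤ (C + 4) * X ^ (D + 1) + B * (C + 1) ^ D * X ^ (D + 1) := by gcongr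
    _ = (C + 4 + B * (C + 1) ^ D) * X ^ (D + 1) := by ring

theorem Computable.mul_succ_pow {f : ℕ → ℕ} (hf : Computable f) (K D : ℕ) :
    Computable fun k => K * (f k + 1) ^ D := by
  have hs : Computable fun k => f k + 1 := Computable.succ.comp hf
  have hp : Computable fun k => (f k + 1) ^ D := by
    induction D with
    | zero => exact Computable.const 1
    | succ D ih => exact Primrec.nat_mul.to_comp.comp ih hs
  exact Primrec.nat_mul.to_comp.comp (Computable.const K) hp

/-- The letters that stand for the kind of a node. -/
def isKindLetter (a : OutLetter) : Bool :=
  a == Sum.inr .falsum || a == Sum.inr .eq || a == Sum.inr .adj || a == Sum.inr .imp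

theorem BoolCircuit.countP_letters (C : BoolCircuit) : C.letters.countP isKindLetter = C.size := by
  rw [letters, List.countP_map, code]
  refine countP_concatRows _ fun j => ?_
  have h : ∀ b : Bool, isKindLetter (encLetter (.inl (.inr b))) = false := by decide
  have h' : ∀ a : NodeKind, isKindLetter (encLetter (.inl (.inl a))) = true := by
    rintro ⟨⟩ <;> decide
  have h0 : (List.ofFn fun i => (Sum.inr (C.wire i j) : BoolCircuit.Letter)).countP
      (isKindLetter ∘ fun a => encLetter (.inl a)) = 0 := by
    simp [List.countP_eq_zero, List.mem_ofFn, h]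
  rw [row, List.countP_cons, List.countP_append, h0]
  simp [h, h']

/-- The graph and the sentence for a circuit and a weight. -/
noncomputable def checkingInst {L : Set ℝ} (hL : ∀ x ∈ L, 0 ≤ x)
    (hdense : ∃ U : Set ℝ, IsOpen U ∧ U.Nonempty ∧ U ⊆ closure L) (h : ℕ)
    (C : BoolCircuit) (k : ℕ) :
    ModelCheckingInst fun _ G => IsIntervalGraphWithLengths L G where
  order := _
  graph := vertGraph C.size C.letters
  mem := isIntervalGraphWithLengths_vertGraph hL hdense _ _
  sentence := sentence (h + 2) k

/-- The string for the graph and the sentence can be computed from the string for the circuit and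
the weight, and the length of the sentence is bounded in terms of the weight. -/
theorem exists_program_checkingInst (h : ℕ) : ∃ (p : StackProg Stk OutLetter) (T : Polynomial ℕ),
    (∀ (C : BoolCircuit) (k : ℕ), ∃ t ≤ T.eval (C.letters ++ List.replicate k tick).length,
      p.Exec (update (fun _ => []) .w (C.letters ++ List.replicate k tick).reverse)
        (update (fun _ => []) .fin ((graphCode (vertGraph C.size C.letters)).map Sum.inl ++
          (formulaCode (sentence (h + 2) k)).map Sum.inr)) t) ∧
    ∀ k, (formulaCode (sentence (h + 2) k)).length ≤ T.eval k := by
  obtain ⟨p, T, hp⟩ := (printable_graphCode.append (printable_sentence (h + 2))).exists_program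
    isKindLetter fun a => a == tick
  have htick : ∀ (k : ℕ), ∀ a ∈ List.replicate k tick, (a == tick) = true := by
    intro k a ha
    rw [List.eq_of_mem_replicate ha]
    decide
  refine ⟨p, T, fun C k => ?_, fun k => ?_⟩
  · have hx : ∀ a ∈ C.letters, (a == tick) = false := by
      intro a ha
      obtain ⟨b, -, rfl⟩ := List.mem_map.1 ha
      have : ∀ b : BoolCircuit.Letter, (encLetter (.inl b) == tick) = false := by decide
      exact this b
    obtain ⟨t, ht, h₁⟩ := hp C.letters (List.replicate k tick) hx (htick k)
    rw [update_self, update_of_ne (by decide : (0 : Fin 8) ≠ 1), update_self, C.countP_letters,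
      List.length_replicate] at h₁
    exact ⟨t, ht, h₁⟩
  · -- printing the sentence for an empty circuit takes at least as many steps as it has letters
    obtain ⟨t, ht, h₁⟩ := hp [] (List.replicate k tick) (by simp) (htick k)
    have := h₁.length_le .fin
    rw [List.nil_append, List.length_replicate] at ht
    rw [update_self, List.length_append, List.length_map, List.length_map, List.length_replicate,
      update_self, update_of_ne (by decide : Stk.fin ≠ Stk.w), List.length_nil, zero_add] at this
    exact (Nat.le_add_left _ _).trans (this.trans ht)

theorem mainTheorem3 (L : Set ℝ) (hL : ∀ x ∈ L, 0 ≤ x)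
    (hdense : ∃ U : Set ℝ, IsOpen U ∧ U.Nonempty ∧ U ⊆ closure L) :
    WHard 2 (foModelChecking fun _ G => IsIntervalGraphWithLengths L G) := by
  rintro A ⟨h, R₁, M₁, f₁, g₁, c₁, hf₁, hg₁, hyes, hparam, hM₁⟩
  obtain ⟨p, T, hp, hlen⟩ := exists_program_checkingInst h
  obtain ⟨B, D, hBD⟩ := T.exists_eval_le_mul_pow
  obtain ⟨C, hC⟩ := exists_length_output_le M₁.tm
  have : Inhabited OutLetter := ⟨tick⟩
  refine ⟨fun x => checkingInst hL hdense h (R₁ x).1.1 (R₁ x).2,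
    ⟨chain M₁.tm (encLetter ∘ M₁.outputAlphabet) p .w .fin, M₁.inputAlphabet, Equiv.refl _⟩,
    fun k => (C + 4 + B * (C + 1) ^ D) * (f₁ k + 1) ^ (D + 1), fun k => B * (g₁ k + 1) ^ D,
    (c₁ + 1) * (D + 1), hf₁.mul_succ_pow _ _, hg₁.mul_succ_pow _ _, fun x => ?_, fun x => ?_,
    fun x => ?_⟩
  · rw [hyes]
    exact ((R₁ x).1.1.realize_sentence_iff (R₁ x).1.2.2 (R₁ x).2).symm
  · exact (hlen _).trans (hBD _ _ ((hparam x).trans (Nat.le_succ _)) (Nat.succ_pos _))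
  · obtain ⟨t₂, ht₂, h₂⟩ := hp (R₁ x).1.1 (R₁ x).2
    obtain ⟨h₁⟩ := hM₁ x
    have hl := hC _ _ _ ⟨h₁⟩
    have he : (((weightedCircuitSat 2 h).encode (R₁ x)).map M₁.outputAlphabet.symm).map
        (encLetter ∘ M₁.outputAlphabet) =
          (R₁ x).1.1.letters ++ List.replicate (R₁ x).2 tick := by
      have hf : (encLetter ∘ M₁.outputAlphabet) ∘ M₁.outputAlphabet.symm = encLetter :=
        funext fun a => congrArg encLetter (M₁.outputAlphabet.apply_symm_apply a)
      rw [List.map_map, hf]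
      have hm : ∀ (a : List BoolCircuit.Letter) (k : ℕ), List.map encLetter (a.map Sum.inl ++
          (List.replicate k ()).map Sum.inr) = a.map (fun a => encLetter (.inl a)) ++
            List.replicate k tick := by
        intro a k
        rw [List.map_append, List.map_map, List.map_map, List.map_replicate]
        rfl
      exact hm _ _
    have hel := congrArg List.length he
    rw [List.length_map] at hel
    rw [← he] at h₂
    obtain ⟨⟨h₃, h₄⟩⟩ := outputsInTime_chain M₁.tm (encLetter ∘ M₁.outputAlphabet) p .w .fin h₁ h₂
    rw [List.length_map (f := M₁.inputAlphabet.symm)] at hl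
    have htime := total_time_le (D := D) (B := B) (t := t₂) hl fun M hM hM' =>
      ht₂.trans (hBD _ _ (hel ▸ hM) hM')
    have hM : Nonempty (Turing.TM2OutputsInTime (chain M₁.tm (encLetter ∘ M₁.outputAlphabet) p .w
        .fin)
        ((A.encode x).map M₁.inputAlphabet.symm) _
          ((C + 4 + B * (C + 1) ^ D) * (f₁ (A.param x) + 1) ^ (D + 1) *
            ((A.encode x).length + 1) ^ ((c₁ + 1) * (D + 1)))) := ⟨⟨h₃, h₄.trans htime⟩⟩
    convert hM using 3
    · rfl
    · exact congrArg some (List.map_id _)
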